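/- Let $K$ be a field with algebraic closure $\overline K$, let $\mathbb T$ be a split torus over $K$ of dimension $n$ with character lattice $M$, and let $N=\operatorname{Hom}(M,\mathbb Z)$, $N_{\mathbb R}=N\otimes\mathbb R$ and $M_{\mathbb R}=M\otimes\mathbb R$. Let $0\le k\le n$ and let $f_1,\dots,f_k\in K[M]$ be nonzero Laurent polynomials. Let $\Sigma$ be a complete fan of strongly convex rational polyhedral cones on $N_{\mathbb R}$ that is compatible with the Newton polytopes $\Delta_i\subset M_{\mathbb R}$ of the $f_i$, that is, each support function $\Psi_i(u)=\min_{x\in \Delta_i}\langle u,x\rangle$ is linear on each cone of $\Sigma$, and let $X$ be the toric variety over $K$ of $\Sigma$, which contains $\mathbb T$ as a dense open subset. Let $D_{f_i}$ be the toric Cartier divisor on $X$ that is given on the affine chart $X_\sigma$ of each cone $\sigma\in\Sigma$ by the local equation $\chi^{-m_\sigma}$, where $m_\sigma\in M$ satisfies $\Psi_i=\langle\,\cdot\,,m_\sigma\rangle$ on $\sigma$, let $L_{f_i}=\mathcal O(D_{f_i})$, and let $s_{f_i}$ be the global section of $L_{f_i}$ given by the rational function $f_i$. For $\boldsymbol t=(t_1,\dots,t_k)\in\mathbb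 T(\overline K)^k$ let $\tau_{t_i}$ be the translation by $t_i$ on $\mathbb T_{\overline K}$ and on $X_{\overline K}$, and consider the twists $t_i^*f_i=\tau_{t_i}^*f_i$ (if $f_i=\sum_m\alpha_m\chi^m$, then $t_i^*f_i=\sum_m\alpha_m\chi^m(t_i)\chi^m$) and $t_i^*s_{f_i}=\tau_{t_i}^*s_{f_i}$, which are again global sections, of the structure sheaf of $\mathbb T_{\overline K}$ and of $L_{f_i}$ on $X_{\overline K}$, respectively. Global sections $s_1,\dots,s_k$ of line bundles on $Y_{\overline K}$, for $Y=X$ or $Y=\mathbb T$, are said to meet properly if for every $I\subseteq\{1,\dots,k\}$ each irreducible component of the common zero set of the $s_i$, $i\in I$, has codimension $\#I$. In this case, their intersection cycle is $Z_Y(s_1,\dots,s_k)=\operatorname{div}(s_1)\cdots\operatorname{div}(s_k)\cdot Y_{\overline K}$. **Theorem.** There is a proper closed subset $H\subsetneq\mathbb T^k$ such that for every $\boldsymbol t\in(\mathbb T^k\setminus H)(\overline K)$ the global sections $t_1^*s_{f_1},\dots,t_k^*s_{f_k}$ meet properly on $X_{\overline K}$, the Laurent polynomials $t_1^*f_1,\dots,t_k^*f_k$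 meet properly on $\mathbb T_{\overline K}$, and the closure in $X_{\overline K}$ of the intersection cycle $Z_{\mathbb T}(t_1^*f_1,\dots,t_k^*f_k)$ is $$\overline{Z_{\mathbb T}(t_1^*f_1,\dots,t_k^*f_k)}=Z_X(t_1^*s_{f_1},\dots,t_k^*s_{f_k}).$$ -/

import Mathlib

universe u v

open CategoryTheory CategoryTheory.Limits AlgebraicGeometry TopologicalSpace

namespace ToricCycles

noncomputable section

/-! ### Lattices, cones and fans -/

section Cones

variable (M : Type v) [AddCommGroup M]

/-- The real vector space `N_ℝ` of a lattice `M` with dual lattice `N = Hom(M, ℤ)`: it is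
`N ⊗ ℝ = Hom(M, ℝ)`. The pairing of `u : N_ℝ` with `m : M` is `u m`. -/
abbrev NR : Type v := M →ₗ[ℤ] ℝ

/-- The real vector space `M_ℝ = ℝ ⊗ M`. -/
abbrev MR : Type v := TensorProduct ℤ ℝ M

variable {M}

/-- The inclusion of the dual lattice `N` in `N_ℝ`. -/
def latticeIncl (w : M →ₗ[ℤ] ℤ) : NR M := (Algebra.linearMap ℤ ℝ).comp w

/-- The pairing `⟨u, x⟩` of `u : N_ℝ` with `x : M_ℝ`. -/
def pairing (u : NR M) : MR M →ₗ[ℝ] ℝ := LinearMap.liftBaseChange ℝ u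

@[simp] lemma latticeIncl_apply (w : M →ₗ[ℤ] ℤ) (m : M) : latticeIncl w m = (w m : ℝ) := by
  simp [latticeIncl]

@[simp] lemma pairing_tmul (u : NR M) (r : ℝ) (m : M) : pairing u (r ⊗ₜ[ℤ] m) = r * u m := by
  simp [pairing]

/-- A convex cone in `N_ℝ` is rational polyhedral if it is generated by finitely many vectors of
the dual lattice `N`. -/
def IsRationalPolyhedral (σ : PointedCone ℝ (NR M)) : Prop :=
  ∃ S : Finset (M →ₗ[ℤ] ℤ), σ = PointedCone.hull ℝ (latticeIncl '' (S : Set (M →ₗ[ℤ] ℤ)))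

/-- A cone is strongly convex if it contains no line. -/
def IsStronglyConvex (σ : PointedCone ℝ (NR M)) : Prop :=
  ∀ u ∈ σ, -u ∈ σ → u = 0

/-- The monoid `σ^∨ ∩ M` of the lattice points of the dual cone of `σ`. -/
def dualMonoid (σ : PointedCone ℝ (NR M)) : AddSubmonoid M where
  carrier := {m | ∀ u ∈ σ, 0 ≤ u m}
  zero_mem' := by simp
  add_mem' := by
    intro a b ha hb u hu
    rw [map_add]
    exact add_nonneg (ha u hu) (hb u hu)

lemma mem_dualMonoid {σ : PointedCone ℝ (NR M)} {m : M} :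
    m ∈ dualMonoid σ ↔ ∀ u ∈ σ, 0 ≤ u m := Iff.rfl

lemma dualMonoid_anti {σ τ : PointedCone ℝ (NR M)} (h : τ ≤ σ) : dualMonoid σ ≤ dualMonoid τ :=
  fun _ hm u hu => hm u (h hu)

/-- `τ` is a face of the (rational polyhedral) cone `σ` if `τ = σ ∩ m^⊥` for some
`m ∈ σ^∨ ∩ M`. -/
def IsFace (τ σ : PointedCone ℝ (NR M)) : Prop :=
  ∃ m ∈ dualMonoid σ, ∀ u : NR M, u ∈ τ ↔ u ∈ σ ∧ u m = 0

variable (M) in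
/-- A fan on `N_ℝ`: a finite collection of strongly convex rational polyhedral cones, containing
the zero cone, closed under taking faces, and such that the intersection of any two of its cones
is a face of both. -/
structure Fan where
  /-- the cones of the fan -/
  cones : Finset (PointedCone ℝ (NR M))
  rational : ∀ σ ∈ cones, IsRationalPolyhedral σ
  stronglyConvex : ∀ σ ∈ cones, IsStronglyConvex σ
  bot_mem : ⊥ ∈ cones
  face_mem : ∀ σ ∈ cones, ∀ τ, IsFace τ σ → τ ∈ cones
  inter_isFace : ∀ σ ∈ cones, ∀ τ ∈ cones, IsFace (σ ⊓ τ) σ ∧ IsFace (σ ⊓ τ) τ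

/-- A fan is complete if its cones cover `N_ℝ`. -/
def Fan.IsComplete (Δ : Fan M) : Prop := ∀ u : NR M, ∃ σ ∈ Δ.cones, u ∈ σ

end Cones

/-! ### Laurent polynomials, Newton polytopes and their support functions -/

section Polytopes

variable {M : Type v} [AddCommGroup M]

/-- The Newton polytope of a Laurent polynomial: the convex hull in `M_ℝ` of its exponents. -/
def newtonPolytope {K : Type u} [Field K] (f : AddMonoidAlgebra K M) : Set (MR M) :=
  convexHull ℝ ((fun m : M => (1 : ℝ) ⊗ₜ[ℤ] m) '' (f.coeff.support : Set M))

/-- The support function `Ψ_P(u) = inf_{x ∈ P} ⟨u, x⟩` of a polytope `P ⊆ M_ℝ`. -/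
def supportFunction (P : Set (MR M)) (u : NR M) : ℝ := sInf (pairing u '' P)

/-- A fan is compatible with a polytope if the support function of the polytope is linear on each
cone of the fan. -/
def Fan.IsCompatible (Δ : Fan M) (P : Set (MR M)) : Prop :=
  ∀ σ ∈ Δ.cones, ∃ l : NR M →ₗ[ℝ] ℝ, ∀ u ∈ σ, supportFunction P u = l u

/-- The support function of the Newton polytope of `f` is the minimum over the exponents. -/
lemma isLeast_supportFunction {K : Type u} [Field K] {f : AddMonoidAlgebra K M} (hf : f ≠ 0)
    (u : NR M) : IsLeast ((fun m => u m) '' (f.coeff.support : Set M))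
      (supportFunction (newtonPolytope f) u) := by
  have hne : f.coeff.support.Nonempty := by
    rw [Finsupp.support_nonempty_iff]
    simpa using hf
  obtain ⟨m₀, hm₀, hmin⟩ := f.coeff.support.exists_min_image (fun m => u m) hne
  have key : supportFunction (newtonPolytope f) u = u m₀ := by
    apply IsLeast.csInf_eq
    refine ⟨⟨(1 : ℝ) ⊗ₜ[ℤ] m₀, subset_convexHull _ _ ⟨m₀, hm₀, rfl⟩, by simp⟩, ?_⟩
    rintro _ ⟨x, hx, rfl⟩
    have hconv : Convex ℝ {x : MR M | u m₀ ≤ pairing u x} :=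
      convex_halfSpace_ge (pairing u).isLinear _
    refine (convexHull_min ?_ hconv) hx
    rintro _ ⟨m, hm, rfl⟩
    simpa using hmin m hm
  rw [key]
  refine ⟨⟨m₀, hm₀, rfl⟩, ?_⟩
  rintro _ ⟨m, hm, rfl⟩
  exact hmin m hm

/-- On each cone of a compatible fan the support function of the Newton polytope of `f` has a
slope in the lattice `M`. -/
lemma Fan.IsCompatible.exists_slope {K : Type u} [Field K] {f : AddMonoidAlgebra K M} (hf : f ≠ 0)
    {Δ : Fan M} (hΔ : Δ.IsCompatible (newtonPolytope f)) :
    ∀ σ ∈ Δ.cones, ∃ m : M, ∀ u ∈ σ, supportFunction (newtonPolytope f) u = u m := by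
  intro σ hσ
  obtain ⟨l, hl⟩ := hΔ σ hσ
  obtain ⟨S, rfl⟩ := Δ.rational σ hσ
  set g : (M →ₗ[ℤ] ℤ) → NR M := latticeIncl with hg
  have hgen : ∀ w ∈ S, g w ∈ PointedCone.hull ℝ (g '' (S : Set (M →ₗ[ℤ] ℤ))) :=
    fun w hw => Submodule.subset_span ⟨w, hw, rfl⟩
  have hsum : ∑ w ∈ S, g w ∈ PointedCone.hull ℝ (g '' (S : Set (M →ₗ[ℤ] ℤ))) :=
    Submodule.sum_mem _ hgen
  obtain ⟨m, hm, hmu⟩ := (isLeast_supportFunction hf (∑ w ∈ S, g w)).1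
  refine ⟨m, ?_⟩
  have hle : ∀ w ∈ S, l (g w) ≤ g w m := fun w hw => by
    rw [← hl _ (hgen w hw)]
    exact (isLeast_supportFunction hf (g w)).2 ⟨m, hm, rfl⟩
  have heq : ∀ w ∈ S, l (g w) = g w m := by
    rw [← Finset.sum_eq_sum_iff_of_le hle, ← map_sum, ← hl _ hsum, ← hmu]
    simp
  intro u hu
  rw [hl u hu]
  induction hu using Submodule.span_induction with
  | mem x hx => obtain ⟨w, hw, rfl⟩ := hx; exact heq w hw
  | zero => simp
  | add x y _ _ hx hy => simp [hx, hy]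
  | smul a x _ hx =>
    have h1 : l (a • x) = (a : ℝ) * l x := by
      rw [← smul_eq_mul, ← map_smul]; rfl
    have h2 : (a • x) m = (a : ℝ) * x m := rfl
    rw [h1, h2, hx]

end Polytopes

/-! ### Semigroup algebras of cones -/

section Semigroup

variable {M : Type v} [AddCommGroup M]

/-- Gordan's lemma. -/
lemma dualMonoid_fg [Module.Free ℤ M] [Module.Finite ℤ M] {σ : PointedCone ℝ (NR M)}
    (hσ : IsRationalPolyhedral σ) : AddMonoid.FG (dualMonoid σ) := by
  obtain ⟨S, rfl⟩ := hσ
  let b := Module.finBasis ℤ M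
  let n := Module.finrank ℤ M
  let A := (Fin n → ℕ) × (Fin n → ℕ) × (S → ℕ)
  let p : A →+ M :=
    { toFun := fun a => ∑ i, ((a.1 i : ℤ) - (a.2.1 i : ℤ)) • b i
      map_zero' := by simp
      map_add' := by
        intro x y
        rw [← Finset.sum_add_distrib]
        refine Finset.sum_congr rfl fun i _ => ?_
        rw [← add_smul]
        congr 1
        change ((x.1 i + y.1 i : ℕ) : ℤ) - ((x.2.1 i + y.2.1 i : ℕ) : ℤ) = _
        push_cast
        ring }
  let f : A →+ (S → ℤ) :=
    { toFun := fun a w => w.1 (p a)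
      map_zero' := by ext; simp
      map_add' := by intro x y; ext; simp }
  let g : A →+ (S → ℤ) :=
    { toFun := fun a w => (a.2.2 w : ℤ)
      map_zero' := by ext; simp
      map_add' := by intro x y; ext w; exact Nat.cast_add (x.2.2 w) (y.2.2 w) }
  have hfg : (f.eqLocusM g).FG := AddSubmonoid.fg_eqLocusM f g
  have hmem : ∀ m : M, m ∈ dualMonoid (PointedCone.hull ℝ
      (latticeIncl '' (S : Set (M →ₗ[ℤ] ℤ)))) ↔ ∀ w ∈ S, 0 ≤ w m := by
    intro m
    constructor
    · intro h w hw
      have := h (latticeIncl w) (Submodule.subset_span ⟨w, hw, rfl⟩)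
      simpa using this
    · intro h u hu
      induction hu using Submodule.span_induction with
      | mem x hx =>
        obtain ⟨w, hw, rfl⟩ := hx
        simpa using h w hw
      | zero => simp
      | add x y _ _ hx hy => exact add_nonneg hx hy
      | smul a x _ hx => exact mul_nonneg a.2 hx
  have himg : dualMonoid (PointedCone.hull ℝ (latticeIncl '' (S : Set (M →ₗ[ℤ] ℤ)))) =
      (f.eqLocusM g).map p := by
    ext m
    rw [hmem, AddSubmonoid.mem_map]
    constructor
    · intro h
      have hp : p (fun i => (b.repr m i).toNat, fun i => (-(b.repr m i)).toNat,
          fun w => (w.1 m).toNat) = m := by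
        conv_rhs => rw [← b.sum_repr m]
        change ∑ i, (((b.repr m i).toNat : ℤ) - ((-(b.repr m i)).toNat : ℤ)) • b i = _
        refine Finset.sum_congr rfl fun i _ => ?_
        congr 1
        omega
      refine ⟨_, ?_, hp⟩
      ext w
      change w.1 (p _) = (((w.1 m).toNat : ℕ) : ℤ)
      rw [hp, Int.toNat_of_nonneg (h w.1 w.2)]
    · rintro ⟨a, ha, rfl⟩ w hw
      have : w (p a) = (a.2.2 ⟨w, hw⟩ : ℤ) := congrFun ha ⟨w, hw⟩
      rw [this]
      positivity
  rw [himg, AddMonoid.fg_iff_addSubmonoid_fg]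
  exact hfg.map p


variable (F : Type u) [Field F]

/-- The inclusion of semigroup algebras `F[S] → F[S']` for `S ≤ S'`. -/
def inclHom {S S' : AddSubmonoid M} (h : S ≤ S') :
    AddMonoidAlgebra F S →+* AddMonoidAlgebra F S' :=
  AddMonoidAlgebra.mapDomainRingHom F (AddSubmonoid.inclusion h)

@[simp] lemma inclHom_single {S S' : AddSubmonoid M} (h : S ≤ S') (m : S) (a : F) :
    inclHom F h (AddMonoidAlgebra.single m a) =
      AddMonoidAlgebra.single (AddSubmonoid.inclusion h m) a := by
  simp [inclHom]

/-- The inclusion `F[S] → F[M]`. -/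
def toLaurent (S : AddSubmonoid M) : AddMonoidAlgebra F S →+* AddMonoidAlgebra F M :=
  AddMonoidAlgebra.mapDomainRingHom F S.subtype

@[simp] lemma toLaurent_single (S : AddSubmonoid M) (m : S) (a : F) :
    toLaurent F S (AddMonoidAlgebra.single m a) = AddMonoidAlgebra.single (m : M) a := by
  simp [toLaurent]

lemma inclHom_injective {S S' : AddSubmonoid M} (h : S ≤ S') :
    Function.Injective (inclHom F h) :=
  AddMonoidAlgebra.mapDomain_injective (AddSubmonoid.inclusion_injective h)

lemma toLaurent_injective (S : AddSubmonoid M) : Function.Injective (toLaurent F S) :=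
  AddMonoidAlgebra.mapDomain_injective Subtype.val_injective

lemma mem_range_inclHom {S S' : AddSubmonoid M} (h : S ≤ S') (x : AddMonoidAlgebra F S')
    (hx : ∀ m ∈ x.coeff.support, (m : M) ∈ S) : x ∈ (inclHom F h).range := by
  rw [← AddMonoidAlgebra.ofCoeff_coeff x, ← Finsupp.sum_single x.coeff, Finsupp.sum,
    AddMonoidAlgebra.ofCoeff_sum]
  refine Subring.sum_mem _ fun m hm => ⟨AddMonoidAlgebra.single ⟨m, hx m hm⟩ (x.coeff m), ?_⟩
  simp
  rfl

lemma mem_range_toLaurent (S : AddSubmonoid M) (x : AddMonoidAlgebra F M)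
    (hx : ∀ m ∈ x.coeff.support, m ∈ S) : x ∈ (toLaurent F S).range := by
  rw [← AddMonoidAlgebra.ofCoeff_coeff x, ← Finsupp.sum_single x.coeff, Finsupp.sum,
    AddMonoidAlgebra.ofCoeff_sum]
  refine Subring.sum_mem _ fun m hm => ⟨AddMonoidAlgebra.single ⟨m, hx m hm⟩ (x.coeff m), ?_⟩
  simp

lemma inclHom_comp {S S' S'' : AddSubmonoid M} (h : S ≤ S') (h' : S' ≤ S'') :
    (inclHom F h').comp (inclHom F h) = inclHom F (h.trans h') := by
  apply AddMonoidAlgebra.ringHom_ext <;> intros <;> (simp; try rfl)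

lemma inclHom_refl (S : AddSubmonoid M) : inclHom F (le_refl S) = RingHom.id _ := by
  apply AddMonoidAlgebra.ringHom_ext <;> intros <;> (simp; try rfl)

lemma isDomain_laurent [Module.Free ℤ M] [Module.Finite ℤ M] :
    IsDomain (AddMonoidAlgebra F M) := by
  have : IsAddTorsionFree M := Module.isTorsionFree_int_iff_isAddTorsionFree.1 inferInstance
  have : AddMonoid.FG M :=
    (AddGroup.fg_iff_addMonoid_fg).1 (Module.Finite.iff_addGroup_fg.1 inferInstance)
  have : NoZeroDivisors (AddMonoidAlgebra F M) := by infer_instance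
  exact NoZeroDivisors.to_isDomain _

instance isDomain_semigroupAlgebra [Module.Free ℤ M] [Module.Finite ℤ M] (S : AddSubmonoid M) :
    IsDomain (AddMonoidAlgebra F S) := by
  have := isDomain_laurent (M := M) F
  exact (toLaurent_injective F S).isDomain (toLaurent F S)

/-- If `τ = σ ∩ m^⊥` is a face of `σ`, then `F[τ^∨ ∩ M]` is the localization of `F[σ^∨ ∩ M]`
at `χ^m`. -/
lemma isLocalization_of_face {σ τ : PointedCone ℝ (NR M)} (hσ : IsRationalPolyhedral σ)
    (hle : dualMonoid σ ≤ dualMonoid τ) (m : dualMonoid σ)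
    (hτ : ∀ u : NR M, u ∈ τ ↔ u ∈ σ ∧ u m = 0) :
    @IsLocalization.Away _ _ (AddMonoidAlgebra.single m (1 : F)) (AddMonoidAlgebra F (dualMonoid τ))
      _ (inclHom F hle).toAlgebra := by
  let _ := (inclHom F hle).toAlgebra
  have halg : ∀ x, algebraMap (AddMonoidAlgebra F (dualMonoid σ))
    (AddMonoidAlgebra F (dualMonoid τ)) x = inclHom F hle x := fun _ => rfl
  have hneg : -(m : M) ∈ dualMonoid τ := by
    intro u hu
    rw [map_neg, ((hτ u).1 hu).2, neg_zero]
  have hpow : ∀ N : ℕ, (AddMonoidAlgebra.single m (1 : F)) ^ N =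
      AddMonoidAlgebra.single (N • m) 1 := by
    intro N
    simp [AddMonoidAlgebra.single_pow]
  have hone : ∀ w : dualMonoid τ, ∃ N : ℕ, ∀ n ≥ N, (w : M) + n • (m : M) ∈ dualMonoid σ := by
    intro w
    obtain ⟨S, rfl⟩ := hσ
    have h1 : ∀ x : M →ₗ[ℤ] ℤ, ∃ N : ℕ, x ∈ S → ∀ n ≥ N, 0 ≤ x w + n * x m := by
      intro x
      by_cases hx : x ∈ S
      swap
      · exact ⟨0, fun h => absurd h hx⟩
      have hxσ := Submodule.subset_span (R := {c : ℝ // 0 ≤ c}) (s := latticeIncl '' (S : Set (M →ₗ[ℤ] ℤ))) ⟨x, hx, rfl⟩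
      have hxm : 0 ≤ x m := by
        have := m.2 _ hxσ
        simpa using this
      rcases hxm.eq_or_lt with h0 | h0
      · refine ⟨0, fun _ n _ => ?_⟩
        have := w.2 (latticeIncl x) ((hτ _).2 ⟨hxσ, by simp [← h0]⟩)
        rw [← h0]
        simpa using this
      · refine ⟨(-(x w)).toNat, fun _ n hn => ?_⟩
        have : -(x w) ≤ n := by omega
        nlinarith
    choose N hN using h1
    refine ⟨S.sup N, fun n hn u hu => ?_⟩
    induction hu using Submodule.span_induction with
    | mem y hy =>
      obtain ⟨x, hx, rfl⟩ := hy
      have := hN x hx n ((Finset.le_sup hx).trans hn)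
      simp only [latticeIncl_apply, map_add, map_nsmul, nsmul_eq_mul]
      exact_mod_cast this
    | zero => simp
    | add x y _ _ hx hy => exact add_nonneg hx hy
    | smul a x _ hx => exact mul_nonneg a.2 hx
  constructor
  refine ⟨?_, ?_, ?_⟩
  · rintro ⟨_, N, rfl⟩
    dsimp only
    rw [map_pow]
    refine IsUnit.pow _ ?_
    rw [halg, inclHom_single]
    refine IsUnit.of_mul_eq_one (AddMonoidAlgebra.single ⟨-(m : M), hneg⟩ 1) ?_
    rw [AddMonoidAlgebra.single_mul_single, AddMonoidAlgebra.one_def]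
    congr 1
    · ext
      simp
    · simp
  · intro z
    choose N hN using hone
    let n := z.coeff.support.sup N
    have : z * AddMonoidAlgebra.single (n • AddSubmonoid.inclusion hle m) 1 ∈
        (inclHom F hle).range := by
      apply mem_range_inclHom
      intro w hw
      rw [AddMonoidAlgebra.support_coeff_mul_single _ _ (by simp), Finset.mem_map] at hw
      obtain ⟨w', hw', rfl⟩ := hw
      simpa using hN w' n (Finset.le_sup hw')
    obtain ⟨y, hy⟩ := this
    refine ⟨⟨y, ⟨_, n, rfl⟩⟩, ?_⟩
    dsimp only
    rw [hpow, halg, halg, inclHom_single, hy, map_nsmul]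
  · intro x y hxy
    exact ⟨1, by rw [inclHom_injective F hle hxy]⟩

end Semigroup


/-! ### The toric variety of a fan -/

section ToricVariety

variable {M : Type v} [AddCommGroup M]

/-- The split torus with character lattice `L` over a field `F`. -/
abbrev torus (F : Type u) [Field F] (L : Type v) [AddCommGroup L] : Scheme.{max u v} :=
  Spec (CommRingCat.of (AddMonoidAlgebra F L))

variable (F : Type u) [Field F] (Δ : Fan M)

lemma Fan.isFace_of_le {σ τ : Δ.cones} (h : τ ≤ σ) : IsFace τ.1 σ.1 := by
  have h' : σ.1 ⊓ τ.1 = τ.1 := inf_eq_right.2 h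
  rw [← h']
  exact (Δ.inter_isFace σ.1 σ.2 τ.1 τ.2).1

/-- The diagram of the affine toric varieties `X_σ = Spec F[σ^∨ ∩ M]` for `σ` in the fan, with
the inclusions `X_τ ⊆ X_σ` for `τ ⊆ σ`. -/
def Fan.charts : Δ.cones ⥤ Scheme.{max u v} where
  obj σ := Spec (CommRingCat.of (AddMonoidAlgebra F (dualMonoid σ.1)))
  map {τ σ} h := Spec.map (CommRingCat.ofHom (inclHom F (dualMonoid_anti (leOfHom h))))
  map_id σ := by
    rw [inclHom_refl]
    exact Spec.map_id _
  map_comp h h' := by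
    rw [← Spec.map_comp, ← CommRingCat.ofHom_comp, inclHom_comp]

lemma Fan.charts_map_aux {τ σ : Δ.cones} (h : τ ⟶ σ) (m : dualMonoid σ.1)
    (hτ : ∀ u : NR M, u ∈ τ.1 ↔ u ∈ σ.1 ∧ u m = 0) :
    IsOpenImmersion ((Δ.charts F).map h) ∧
    ∀ x : PrimeSpectrum (AddMonoidAlgebra F (dualMonoid σ.1)),
      x ∈ Set.range ((Δ.charts F).map h) ↔ AddMonoidAlgebra.single m (1 : F) ∉ x.asIdeal := by
  have hle := dualMonoid_anti (leOfHom h : τ.1 ≤ σ.1)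
  algebraize [inclHom F hle]
  have := isLocalization_of_face F (Δ.rational σ.1 σ.2) hle m hτ
  refine ⟨IsOpenImmersion.of_isLocalization (R := AddMonoidAlgebra F (dualMonoid σ.1))
    (S := AddMonoidAlgebra F (dualMonoid τ.1)) (AddMonoidAlgebra.single m (1 : F)), fun x => ?_⟩
  have hr := PrimeSpectrum.localization_away_comap_range (AddMonoidAlgebra F (dualMonoid τ.1))
    (AddMonoidAlgebra.single m (1 : F))
  exact (Set.ext_iff.1 hr x)

instance {τ σ : Δ.cones} (h : τ ⟶ σ) : IsOpenImmersion ((Δ.charts F).map h) := by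
  obtain ⟨m, hm, hτ⟩ := Δ.isFace_of_le (leOfHom h)
  exact (Δ.charts_map_aux F h ⟨m, hm⟩ hτ).1

/-- The intersection of two cones of a fan, as a cone of the fan. -/
def Fan.inter (σ τ : Δ.cones) : Δ.cones :=
  ⟨σ.1 ⊓ τ.1, Δ.face_mem _ σ.2 _ (Δ.inter_isFace _ σ.2 _ τ.2).1⟩

lemma Fan.inter_le_left (σ τ : Δ.cones) : Δ.inter σ τ ≤ σ := (inf_le_left : σ.1 ⊓ τ.1 ≤ σ.1)

lemma Fan.inter_le_right (σ τ : Δ.cones) : Δ.inter σ τ ≤ τ := (inf_le_right : σ.1 ⊓ τ.1 ≤ τ.1)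

instance : (Δ.charts F ⋙ Scheme.forget).IsLocallyDirected where
  cond {i j k} fi fj xi xj hx := by
    change (Δ.charts F).map fi xi = (Δ.charts F).map fj xj at hx
    obtain ⟨m, hm, hmτ⟩ := Δ.isFace_of_le (leOfHom fi)
    obtain ⟨m', hm', hmτ'⟩ := Δ.isFace_of_le (leOfHom fj)
    have hr := (Δ.charts_map_aux F fi ⟨m, hm⟩ hmτ).2
    have hr' := (Δ.charts_map_aux F fj ⟨m', hm'⟩ hmτ').2
    let li : Δ.inter i j ⟶ i := homOfLE (Δ.inter_le_left i j)
    let lj : Δ.inter i j ⟶ j := homOfLE (Δ.inter_le_right i j)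
    have hmm : ∀ u : NR M, u ∈ (Δ.inter i j).1 ↔
        u ∈ k.1 ∧ u (⟨m, hm⟩ + ⟨m', hm'⟩ : dualMonoid k.1) = 0 := by
      intro u
      change u ∈ i.1 ∧ u ∈ j.1 ↔ u ∈ k.1 ∧ u (m + m') = 0
      rw [hmτ, hmτ', map_add]
      constructor
      · rintro ⟨⟨h1, h2⟩, -, h3⟩
        exact ⟨h1, by rw [h2, h3, add_zero]⟩
      · rintro ⟨h1, h2⟩
        have := hm u h1
        have := hm' u h1
        exact ⟨⟨h1, by linarith⟩, h1, by linarith⟩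
    have hr'' := (Δ.charts_map_aux F (li ≫ fi) _ hmm).2
    have hmem : ((Δ.charts F).map fi xi) ∈ Set.range ((Δ.charts F).map (li ≫ fi)) := by
      have h1 := (hr _).1 ⟨xi, rfl⟩
      have h2 := (hr' _).1 ⟨xj, rfl⟩
      rw [← hx] at h2
      refine (hr'' _).2 fun h3 => ?_
      rw [show (AddMonoidAlgebra.single (⟨m, hm⟩ + ⟨m', hm'⟩ : dualMonoid k.1) (1 : F)) =
        AddMonoidAlgebra.single ⟨m, hm⟩ 1 * AddMonoidAlgebra.single ⟨m', hm'⟩ 1 by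
          rw [AddMonoidAlgebra.single_mul_single, one_mul]] at h3
      rcases (PrimeSpectrum.isPrime _).mem_or_mem h3 with h | h
      · exact h1 h
      · exact h2 h
    obtain ⟨y, hy⟩ := hmem
    refine ⟨Δ.inter i j, li, lj, y, ?_, ?_⟩
    · apply ((Δ.charts F).map fi).isOpenEmbedding.injective
      rw [← hy, Functor.map_comp]
      rfl
    · apply ((Δ.charts F).map fj).isOpenEmbedding.injective
      rw [← hx, ← hy, Subsingleton.elim (li ≫ fi) (lj ≫ fj), Functor.map_comp]
      rfl

/-- The toric variety over `F` of a fan: the gluing of the affine toric varieties `X_σ` along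
the open subsets `X_{σ ∩ τ}`. -/
def Fan.toricVariety : Scheme.{max u v} := colimit (Δ.charts F)

/-- The affine toric variety `X_σ = Spec F[σ^∨ ∩ M]`. -/
abbrev Fan.affineChart (σ : Δ.cones) : Scheme.{max u v} :=
  Spec (CommRingCat.of (AddMonoidAlgebra F (dualMonoid σ.1)))

/-- The inclusion `X_τ → X_σ` for `τ ⊆ σ`. -/
def Fan.face {τ σ : Δ.cones} (h : τ ≤ σ) : Δ.affineChart F τ ⟶ Δ.affineChart F σ :=
  Spec.map (CommRingCat.ofHom (inclHom F (dualMonoid_anti h)))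

instance {τ σ : Δ.cones} (h : τ ≤ σ) : IsOpenImmersion (Δ.face F h) :=
  inferInstanceAs (IsOpenImmersion ((Δ.charts F).map (homOfLE h)))

/-- The open immersion `X_σ → X`. -/
def Fan.chart (σ : Δ.cones) : Δ.affineChart F σ ⟶ Δ.toricVariety F := colimit.ι (Δ.charts F) σ

instance (σ : Δ.cones) : IsOpenImmersion (Δ.chart F σ) :=
  inferInstanceAs (IsOpenImmersion (colimit.ι (Δ.charts F) σ))

lemma Fan.face_chart {τ σ : Δ.cones} (h : τ ≤ σ) :
    Δ.face F h ≫ Δ.chart F σ = Δ.chart F τ := colimit.w (Δ.charts F) (homOfLE h)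

lemma Fan.face_chart_apply {τ σ : Δ.cones} (h : τ ≤ σ) (y : Δ.affineChart F τ) :
    Δ.chart F σ (Δ.face F h y) = Δ.chart F τ y := by
  rw [← Scheme.Hom.comp_apply, Fan.face_chart]

lemma Fan.exists_chart (x : Δ.toricVariety F) :
    ∃ (σ : Δ.cones) (y : Δ.affineChart F σ), Δ.chart F σ y = x :=
  Scheme.IsLocallyDirected.ι_jointly_surjective (Δ.charts F) x

lemma Fan.chart_inter {σ τ : Δ.cones} {x : Δ.toricVariety F}
    (hσ : x ∈ (Δ.chart F σ).opensRange) (hτ : x ∈ (Δ.chart F τ).opensRange) :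
    x ∈ (Δ.chart F (Δ.inter σ τ)).opensRange := by
  obtain ⟨y, rfl⟩ := hσ
  obtain ⟨z, hz⟩ := hτ
  obtain ⟨k, fi, fj, w, rfl, -⟩ :=
    (Scheme.IsLocallyDirected.ι_eq_ι_iff (Δ.charts F)).1 hz.symm
  have hk : k.1 ≤ (Δ.inter σ τ).1 :=
    le_inf (show k.1 ≤ σ.1 from leOfHom fi) (show k.1 ≤ τ.1 from leOfHom fj)
  refine ⟨Δ.face F (show k ≤ Δ.inter σ τ from hk) w, ?_⟩
  exact (Δ.face_chart_apply F _ w).trans (Δ.face_chart_apply F (leOfHom fi) w).symm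

/-- The zero cone. -/
def Fan.zeroCone : Δ.cones := ⟨⊥, Δ.bot_mem⟩

lemma mem_dualMonoid_bot (m : M) : m ∈ dualMonoid (⊥ : PointedCone ℝ (NR M)) := by
  intro u hu
  rw [(Submodule.mem_bot _).1 hu]
  simp

/-- `F[0^∨ ∩ M] = F[M]`. -/
lemma Fan.toLaurent_bot_bijective :
    Function.Bijective (toLaurent F (dualMonoid Δ.zeroCone.1)) := by
  refine ⟨toLaurent_injective _ _, fun x => ?_⟩
  exact mem_range_toLaurent F _ x fun m _ => mem_dualMonoid_bot m

/-- The inclusion of the torus in the toric variety, as its principal open subset `X_0`. -/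
def Fan.torusIncl : torus F M ⟶ Δ.toricVariety F :=
  Spec.map (CommRingCat.ofHom (toLaurent F (dualMonoid Δ.zeroCone.1))) ≫
    Δ.chart F Δ.zeroCone

instance : IsOpenImmersion (Δ.torusIncl F) := by
  have : IsIso (CommRingCat.ofHom (toLaurent F (dualMonoid Δ.zeroCone.1))) :=
    (ConcreteCategory.isIso_iff_bijective _).2 (Δ.toLaurent_bot_bijective F)
  have h3 : IsOpenImmersion (Δ.chart F Δ.zeroCone) := inferInstance
  exact @IsOpenImmersion.comp _ _ _ _ _ inferInstance h3

lemma Fan.torusIncl_eq (σ : Δ.cones) : Δ.torusIncl F =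
    Spec.map (CommRingCat.ofHom (toLaurent F (dualMonoid σ.1))) ≫ Δ.chart F σ := by
  have h : Δ.zeroCone ≤ σ := (bot_le : (⊥ : PointedCone ℝ (NR M)) ≤ σ.1)
  rw [Fan.torusIncl, ← Δ.face_chart F h, Fan.face, ← Spec.map_comp_assoc,
    ← CommRingCat.ofHom_comp]
  congr 3
  apply AddMonoidAlgebra.ringHom_ext <;> intros <;> simp

section Integral

variable [Module.Free ℤ M] [Module.Finite ℤ M]

instance (σ : Δ.cones) : IsIntegral (Δ.affineChart F σ) :=
  inferInstanceAs (IsIntegral (Spec (CommRingCat.of (AddMonoidAlgebra F (dualMonoid σ.1)))))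

instance (σ : Δ.cones) : IsNoetherian (Δ.affineChart F σ) := by
  have := dualMonoid_fg (Δ.rational σ.1 σ.2)
  have : Algebra.FiniteType F (AddMonoidAlgebra F (dualMonoid σ.1)) := inferInstance
  have : IsNoetherianRing (AddMonoidAlgebra F (dualMonoid σ.1)) :=
    Algebra.FiniteType.isNoetherianRing F _
  exact inferInstanceAs
    (IsNoetherian (Spec (CommRingCat.of (AddMonoidAlgebra F (dualMonoid σ.1)))))

instance : IsNoetherian (Spec (CommRingCat.of (AddMonoidAlgebra F M))) := by
  have : AddMonoid.FG M :=
    (AddGroup.fg_iff_addMonoid_fg).1 (Module.Finite.iff_addGroup_fg.1 inferInstance)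
  have : Algebra.FiniteType F (AddMonoidAlgebra F M) := inferInstance
  have : IsNoetherianRing (AddMonoidAlgebra F M) := Algebra.FiniteType.isNoetherianRing F _
  infer_instance

instance : IsIntegral (Spec (CommRingCat.of (AddMonoidAlgebra F M))) := by
  have : IsDomain (AddMonoidAlgebra F M) := isDomain_laurent F
  infer_instance

instance : IsNoetherian (Δ.toricVariety F) := by
  have haff : ∀ σ : Δ.cones, IsAffine (Δ.affineChart F σ) := fun σ =>
    inferInstanceAs (IsAffine (Spec (CommRingCat.of (AddMonoidAlgebra F (dualMonoid σ.1)))))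
  let U : Δ.cones → (Δ.toricVariety F).affineOpens := fun σ =>
    ⟨(Δ.chart F σ).opensRange, isAffineOpen_opensRange (Δ.chart F σ)⟩
  have hU : (⨆ σ, U σ : (Δ.toricVariety F).Opens) = ⊤ := by
    refine top_le_iff.1 fun x _ => ?_
    obtain ⟨σ, y, rfl⟩ := Δ.exists_chart F x
    exact Opens.mem_iSup.2 ⟨σ, y, rfl⟩
  rw [isNoetherian_iff_of_finite_iSup_eq_top hU]
  intro σ
  have h1 : IsNoetherianRing Γ(Δ.affineChart F σ, ⊤) :=
    (isNoetherian_iff_of_finite_iSup_eq_top (ι := Unit)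
      (S := fun _ => ⟨⊤, isAffineOpen_top _⟩) (by simp)).1
      (inferInstanceAs (IsNoetherian (Δ.affineChart F σ))) ()
  exact isNoetherianRing_of_ringEquiv _
    (IsOpenImmersion.ΓIsoTop (Δ.chart F σ)).commRingCatIsoToRingEquiv

lemma Fan.chart_genericPoint (σ : Δ.cones) :
    Δ.chart F σ (genericPoint (Δ.affineChart F σ)) =
      Δ.chart F Δ.zeroCone (genericPoint (Δ.affineChart F Δ.zeroCone)) := by
  have h : Δ.zeroCone ≤ σ := (bot_le : (⊥ : PointedCone ℝ (NR M)) ≤ σ.1)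
  rw [← genericPoint_eq_of_isOpenImmersion (Δ.face F h), ← Scheme.Hom.comp_apply,
    Fan.face_chart]

lemma Fan.isGenericPoint : IsGenericPoint
    (Δ.chart F Δ.zeroCone (genericPoint (Δ.affineChart F Δ.zeroCone))) ⊤ := by
  rw [isGenericPoint_iff_specializes]
  intro x
  refine ⟨fun _ => trivial, fun _ => ?_⟩
  obtain ⟨σ, y, rfl⟩ := Δ.exists_chart F x
  rw [← Δ.chart_genericPoint F σ]
  exact (genericPoint_specializes y).map (Δ.chart F σ).continuous

instance : IsIntegral (Δ.toricVariety F) := by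
  have hred : IsReduced (Δ.toricVariety F) := by
    have h0 : ∀ i : Δ.cones, IsReduced (Δ.affineChart F i) := fun i => inferInstance
    have : ∀ i, IsReduced ((Scheme.IsLocallyDirected.openCover (Δ.charts F)).X i) := h0
    exact IsReduced.of_openCover _ (Scheme.IsLocallyDirected.openCover (Δ.charts F))
  have hirr : IrreducibleSpace (Δ.toricVariety F) := by
    have := (Δ.isGenericPoint F).isIrreducible
    exact (irreducibleSpace_def _).2 this
  exact isIntegral_of_irreducibleSpace_of_isReduced _

end Integral

end ToricVariety

/-! ### Cartier divisors, their sections, and intersection cycles -/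

section Divisors

/-- A Cartier divisor on an integral scheme `X`, given by local equations: an open cover `U i` and
nonzero rational functions `eqn i` such that on `U i ∩ U j` the quotient of `eqn i` and `eqn j` is
an invertible regular function. -/
structure CartierDivisor (X : Scheme.{u}) [IsIntegral X] where
  /-- the index set of the open cover -/
  ι : Type v
  /-- the open cover -/
  U : ι → X.Opens
  /-- the local equations -/
  eqn : ι → X.functionField
  cover : ∀ x : X, ∃ i, x ∈ U i
  eqn_ne_zero : ∀ i, eqn i ≠ 0
  compat : ∀ (i j : ι) (x : X), x ∈ U i → x ∈ U j →
    ∃ a : (X.presheaf.stalk x)ˣ, eqn i = algebraMap (X.presheaf.stalk x) X.functionField a * eqn j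

variable {X : Scheme.{u}} [IsIntegral X]

namespace CartierDivisor

variable (X) in
/-- The zero divisor, whose line bundle is the structure sheaf. -/
def trivial : CartierDivisor.{u, v} X where
  ι := PUnit
  U _ := ⊤
  eqn _ := 1
  cover _ := ⟨⟨⟩, Set.mem_univ _⟩
  eqn_ne_zero _ := one_ne_zero
  compat _ _ _ _ _ := ⟨1, by simp⟩

variable (D : CartierDivisor.{u, v} X)

/-- The sections over an open subset `W` of the line bundle `𝒪(D)`, the subsheaf of the constant
sheaf of rational functions of `X` that is generated by the inverse of `eqn i` over `U i`. The
rational sections of `𝒪(D)` are the elements of the function field of `X`, the canonical rational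
section being `1`. -/
def sections (W : X.Opens) : AddSubgroup X.functionField where
  carrier := {s | ∀ x ∈ W, ∀ i, x ∈ D.U i →
    s * D.eqn i ∈ (algebraMap (X.presheaf.stalk x) X.functionField).range}
  zero_mem' := by
    intro x _ i _
    rw [zero_mul]
    exact zero_mem _
  add_mem' := by
    intro s t hs ht x hx i hi
    rw [add_mul]
    exact add_mem (hs x hx i hi) (ht x hx i hi)
  neg_mem' := by
    intro s hs x hx i hi
    rw [neg_mul]
    exact neg_mem (hs x hx i hi)

/-- The ideal of the local ring at `x` that is generated by the local equation at `x` of a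
section `s` of `𝒪(D)` which is regular at `x`. -/
def localIdeal (s : X.functionField) (x : X) : Ideal (X.presheaf.stalk x) :=
  (Submodule.span (X.presheaf.stalk x) {s * D.eqn (D.cover x).choose}).comap
    (Algebra.linearMap (X.presheaf.stalk x) X.functionField)

lemma mem_localIdeal {s : X.functionField} {x : X} {i : D.ι} (hi : x ∈ D.U i)
    {a : X.presheaf.stalk x} : a ∈ D.localIdeal s x ↔ ∃ b : X.presheaf.stalk x,
      algebraMap (X.presheaf.stalk x) X.functionField a =
        algebraMap (X.presheaf.stalk x) X.functionField b * (s * D.eqn i) := by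
  obtain ⟨c, hc⟩ := D.compat _ i x (D.cover x).choose_spec hi
  rw [localIdeal, Submodule.mem_comap, Submodule.mem_span_singleton]
  simp only [Algebra.smul_def, Algebra.linearMap_apply]
  rw [hc]
  constructor
  · rintro ⟨b, hb⟩
    exact ⟨b * c, by rw [← hb, map_mul]; ring⟩
  · rintro ⟨b, hb⟩
    refine ⟨b * ↑c⁻¹, ?_⟩
    have : algebraMap (X.presheaf.stalk x) X.functionField ↑c⁻¹ *
        algebraMap (X.presheaf.stalk x) X.functionField c = 1 := by
      rw [← map_mul, Units.inv_mul, map_one]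
    rw [hb, map_mul]
    linear_combination (algebraMap (X.presheaf.stalk x) X.functionField b * s * D.eqn i) * this

/-- The zero set of a global section `s` of `𝒪(D)`. -/
def zeroSet (s : X.functionField) : Set X := {x | D.localIdeal s x ≠ ⊤}

lemma isClosed_zeroSet (s : X.functionField) : IsClosed (D.zeroSet s) := by
  rw [← isOpen_compl_iff, isOpen_iff_forall_mem_open]
  intro x hx
  obtain ⟨i, hi⟩ := D.cover x
  simp only [zeroSet, Set.mem_compl_iff, Set.mem_ofPred_eq, ne_eq, not_not,
    Ideal.eq_top_iff_one] at hx
  obtain ⟨b, hb⟩ := (D.mem_localIdeal hi).1 hx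
  obtain ⟨W, hxW, β, rfl⟩ := X.presheaf.exists_germ_eq b
  refine ⟨(W ⊓ D.U i : X.Opens), ?_, (W ⊓ D.U i).2, ⟨hxW, hi⟩⟩
  rintro y ⟨hyW, hyi⟩
  simp only [zeroSet, Set.mem_compl_iff, Set.mem_ofPred_eq, ne_eq, not_not,
    Ideal.eq_top_iff_one]
  have : Nonempty W := ⟨⟨x, hxW⟩⟩
  refine (D.mem_localIdeal hyi).2 ⟨X.presheaf.germ W y hyW β, ?_⟩
  rw [Scheme.algebraMap_germ_eq_germToFunctionField] at hb ⊢
  simpa using hb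

/-- For points `η ⤳ z`, the prime ideal of the local ring at `z` that defines the closure
of `η`. -/
def primeAt {η z : X} (h : η ⤳ z) : Ideal (X.presheaf.stalk z) :=
  (IsLocalRing.maximalIdeal (X.presheaf.stalk η)).comap (X.presheaf.stalkSpecializes h).hom

open scoped Classical in
/-- Let `W` be the subvariety with generic point `η` and `z` the generic point of a subvariety of
`W` of codimension one. For a global section `s` of `𝒪(D)` not vanishing identically on `W`, this
is the order of vanishing of the restriction of `s` to `W` along the closure of `z`: the length of
`𝒪_{W,z} / (g)`, with `𝒪_{W,z}` the quotient of `𝒪_{X,z}` by the prime ideal of `W`, and `g` a local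
equation of `s` at `z`. -/
def order (s : X.functionField) (η z : X) : ℤ :=
  if h : η ⤳ z then
    ((Module.length (X.presheaf.stalk z)
      (X.presheaf.stalk z ⧸ (primeAt h ⊔ D.localIdeal s z))).toNat : ℤ)
  else 0

lemma order_eq_zero {s : X.functionField} {η z : X} (hz : z ∉ D.zeroSet s) :
    D.order s η z = 0 := by
  unfold order
  split_ifs with h
  · simp only [zeroSet, Set.mem_ofPred_eq, ne_eq, not_not] at hz
    rw [hz, sup_top_eq]
    have : Subsingleton (X.presheaf.stalk z ⧸ (⊤ : Ideal (X.presheaf.stalk z))) :=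
      Ideal.Quotient.subsingleton_iff.2 rfl
    rw [Module.length_eq_zero]
    rfl
  · rfl

lemma finite_zeroSet_covBy [IsNoetherian X] (s : X.functionField) {η : X}
    (hη : η ∉ D.zeroSet s) : {z : X | z ⋖ η ∧ z ∈ D.zeroSet s}.Finite := by
  obtain ⟨S, hfin, hS, hS', hSU⟩ := NoetherianSpace.exists_finite_set_isClosed_irreducible
    ((D.isClosed_zeroSet s).inter (isClosed_closure (s := ({η} : Set X))))
  have hlt : ∀ {a b : X}, b ⤳ a → a ≠ b → a < b := fun {a b} h hne =>
    lt_of_le_not_ge h fun h' => hne (Specializes.antisymm h' h).eq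
  have hpt : ∀ T ∈ S, ∃ w : X, IsGenericPoint w T := fun T hT =>
    QuasiSober.sober (hS' T hT) (hS T hT)
  choose! p hp using hpt
  refine (hfin.image p).subset ?_
  rintro z ⟨hz, hzV⟩
  have hz' : z ∈ D.zeroSet s ∩ closure {η} := ⟨hzV, Specializes.mem_closure hz.1.le⟩
  rw [hSU] at hz'
  obtain ⟨T, hT, hzT⟩ := hz'
  refine ⟨T, hT, ?_⟩
  have hwz : p T ⤳ z := (hp T hT).specializes hzT
  have hw : p T ∈ D.zeroSet s ∩ closure {η} := by
    rw [hSU]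
    exact ⟨T, hT, (hp T hT).mem⟩
  have hηw : η ⤳ p T := specializes_iff_mem_closure.2 hw.2
  by_contra hne
  refine hz.2 (hlt hwz (Ne.symm hne)) (hlt hηw ?_)
  intro h
  exact hη (h ▸ hw.1)

end CartierDivisor

/-- A cycle on a Noetherian scheme: a finite formal sum of subvarieties with integer
coefficients, the subvarieties being given by their generic points. -/
abbrev Cycle (X : Scheme.{u}) : Type u := X →₀ ℤ

/-- The global sections `s_i` of the line bundles `𝒪(D_i)` meet properly: for every subset `I` of
the indices, each irreducible component of their common zero set has codimension `#I`. -/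
def MeetProperly {k : ℕ} (D : Fin k → CartierDivisor.{u, v} X)
    (s : Fin k → X.functionField) : Prop :=
  ∀ (I : Finset (Fin k)) (W : IrreducibleCloseds X),
    Maximal (fun W : IrreducibleCloseds X => (W : Set X) ⊆ ⋂ i ∈ I, (D i).zeroSet (s i)) W →
    Order.coheight W = I.card

variable [IsNoetherian X] (D : CartierDivisor.{u, v} X)

open scoped Classical in
/-- The intersection of the divisor of a global section `s` of `𝒪(D)` with the subvariety `W` with
generic point `η`: the Weil divisor on `W` of the restriction of `s` to `W`. It is only meaningful
if `s` does not vanish identically on `W`, and set to zero otherwise. The relation `z ⋖ η` says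
that the closure of `z` is a subvariety of `W` of codimension one. -/
def divOn (s : X.functionField) (η : X) : Cycle X :=
  Finsupp.ofSupportFinite
    (fun z => if z ⋖ η ∧ η ∉ D.zeroSet s then D.order s η z else 0) (by
      by_cases hη : η ∈ D.zeroSet s
      · simp [hη, Function.support_fun_zero]
      · refine (D.finite_zeroSet_covBy s hη).subset fun z hz => ?_
        by_contra hcon
        apply hz
        dsimp only
        by_cases hzη : z ⋖ η
        · rw [D.order_eq_zero fun h => hcon ⟨hzη, h⟩, ite_self]
        · exact if_neg fun h => hzη h.1)

/-- The intersection `div(s) · α` of the divisor of a global section of `𝒪(D)` with a cycle. -/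
def divInter (s : X.functionField) (α : Cycle X) : Cycle X :=
  α.sum fun η a => a • divOn D s η

variable (X) in
/-- The fundamental cycle of an integral scheme. -/
def fundamentalCycle : Cycle X := Finsupp.single (genericPoint X) 1

/-- The intersection cycle `Z_X(s_1, …, s_k) = div(s_1) ⋯ div(s_k) · X` of global sections `s_i` of
line bundles `𝒪(D_i)`. -/
def intersectionCycle {k : ℕ} (D : Fin k → CartierDivisor.{u, v} X)
    (s : Fin k → X.functionField) : Cycle X :=
  (List.ofFn fun i => (D i, s i)).foldr (fun p α => divInter p.1 p.2 α) (fundamentalCycle X)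

end Divisors

/-! ### Rational functions on the toric variety, and translations -/

section Restriction

lemma image_section_restrict {T U X : Scheme.{u}} (h : T ⟶ U) (i : U ⟶ X) (j : T ⟶ X)
    [IsOpenImmersion i] [IsOpenImmersion j] (hj : j = h ≫ i) :
    ∃ hle : j ''ᵁ ⊤ ≤ i ''ᵁ ⊤, (i.appIso ⊤).inv ≫ X.presheaf.map (homOfLE hle).op =
      h.appTop ≫ (j.appIso ⊤).inv := by
  have hle : j ''ᵁ ⊤ ≤ i ''ᵁ ⊤ := by
    rintro _ ⟨y, -, rfl⟩
    exact ⟨h y, trivial, by rw [hj]; rfl⟩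
  refine ⟨hle, ?_⟩
  have happ : h.appTop = h.appLE ⊤ ⊤ (by simp) := (Scheme.Hom.appLE_eq_app h).symm
  rw [Iso.inv_comp_eq, ← Category.assoc, Iso.eq_comp_inv, Scheme.Hom.appIso_hom',
    Scheme.Hom.appIso_hom', Scheme.Hom.map_appLE]
  subst hj
  rw [happ]
  exact (Scheme.Hom.appLE_comp_appLE h i (i ''ᵁ ⊤) ⊤ ⊤ _ _).symm

end Restriction

section Pullback

/-- The pullback of rational functions under a dominant morphism of integral schemes. -/
def pullbackRat {X Y : Scheme.{u}} [IsIntegral X] [IsIntegral Y] (φ : X ⟶ Y) [IsDominant φ] :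
    Y.functionField ⟶ X.functionField :=
  Y.presheaf.stalkSpecializes (specializes_iff_mem_closure.2 (by
    have h := φ.denseRange.closure_eq
    rw [← Set.image_univ, ← genericPoint_closure (α := X)] at h
    have h2 := image_closure_subset_closure_image φ.continuous (s := {genericPoint X})
    have h3 := closure_minimal h2 isClosed_closure
    rw [h, Set.image_singleton] at h3
    exact h3 (Set.mem_univ _)) : φ (genericPoint X) ⤳ genericPoint Y) ≫
  φ.stalkMap (genericPoint X)

end Pullback

section Twist

variable {F : Type u} [Field F]

/-- The twist `t^* f = ∑ α_m χ^m(t) χ^m` of `f = ∑ α_m χ^m` by a point `t` of the torus, the point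
being given by its values `χ^m(t)` at the characters. -/
def twist {A : Type v} [AddCommMonoid A] (t : Multiplicative A →* Fˣ) :
    AddMonoidAlgebra F A →ₐ[F] AddMonoidAlgebra F A :=
  AddMonoidAlgebra.lift F (AddMonoidAlgebra F A) A
    { toFun := fun m => AddMonoidAlgebra.single m.toAdd (t m : F)
      map_one' := by simp [AddMonoidAlgebra.one_def]
      map_mul' := fun a b => by simp [AddMonoidAlgebra.single_mul_single] }

@[simp] lemma twist_single {A : Type v} [AddCommMonoid A] (t : Multiplicative A →* Fˣ) (m : A)
    (a : F) : twist t (AddMonoidAlgebra.single m a) =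
      AddMonoidAlgebra.single m (a * t (Multiplicative.ofAdd m)) := by
  simp [twist]

lemma twist_bijective {A : Type v} [AddCommMonoid A] (t : Multiplicative A →* Fˣ) :
    Function.Bijective (twist t) := by
  have h : ∀ s s' : Multiplicative A →* Fˣ, (∀ m, s m * s' m = 1) →
      Function.LeftInverse (twist s) (twist s') := by
    intro s s' hs x
    have : (twist s).comp (twist s') = AlgHom.id F _ := by
      refine AddMonoidAlgebra.algHom_ext' (MonoidHom.ext fun m => ?_) (Subsingleton.elim _ _)
      have := congrArg Units.val (hs m)
      simp only [Units.val_mul, Units.val_one] at this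
      change twist s (twist s' (AddMonoidAlgebra.single m.toAdd 1)) =
        AddMonoidAlgebra.single m.toAdd 1
      rw [twist_single, twist_single, one_mul, mul_comm]
      exact congrArg _ this
    exact congr($this x)
  exact ⟨(h t⁻¹ t fun m => by simp).injective, (h t t⁻¹ fun m => by simp).surjective⟩

variable {M : Type v} [AddCommGroup M]

/-- The twist on the algebra of a submonoid of `M`. -/
def twistSub (t : Multiplicative M →* Fˣ) (S : AddSubmonoid M) :
    AddMonoidAlgebra F S →ₐ[F] AddMonoidAlgebra F S :=
  twist (t.comp (AddMonoidHom.toMultiplicative S.subtype))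

lemma twistSub_inclHom (t : Multiplicative M →* Fˣ) {S S' : AddSubmonoid M} (h : S ≤ S') :
    (twistSub t S' : AddMonoidAlgebra F S' →+* AddMonoidAlgebra F S').comp (inclHom F h) =
      (inclHom F h).comp (twistSub t S : AddMonoidAlgebra F S →+* AddMonoidAlgebra F S) := by
  apply AddMonoidAlgebra.ringHom_ext <;> intros <;> simp [twistSub]

variable (Δ : Fan M)

/-- The translation by `t` on the affine charts. -/
def Fan.chartsTranslation (t : Multiplicative M →* Fˣ) : Δ.charts F ⟶ Δ.charts F where
  app σ := Spec.map (CommRingCat.ofHom (twistSub t (dualMonoid σ.1) : _ →+* _))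
  naturality {τ σ} h := by
    change Spec.map _ ≫ Spec.map _ = Spec.map _ ≫ Spec.map _
    rw [← Spec.map_comp, ← Spec.map_comp, ← CommRingCat.ofHom_comp, ← CommRingCat.ofHom_comp,
      twistSub_inclHom]

/-- The translation-by-`t` map `τ_t : X → X` on the toric variety of a fan, for a point `t` of the
torus. On the affine charts it is given by `χ^m ↦ χ^m(t) χ^m`. -/
def Fan.translation (t : Multiplicative M →* Fˣ) : Δ.toricVariety F ⟶ Δ.toricVariety F :=
  colimMap (Δ.chartsTranslation t)

instance (t : Multiplicative M →* Fˣ) : IsIso (Δ.translation t) := by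
  have h : ∀ σ, IsIso ((Δ.chartsTranslation (F := F) t).app σ) := by
    intro σ
    have h1 : IsIso (CommRingCat.ofHom (twistSub t (dualMonoid σ.1) :
        AddMonoidAlgebra F (dualMonoid σ.1) →+* AddMonoidAlgebra F (dualMonoid σ.1))) := by
      rw [ConcreteCategory.isIso_iff_bijective]
      exact twist_bijective (t.comp (AddMonoidHom.toMultiplicative (dualMonoid σ.1).subtype))
    exact inferInstanceAs (IsIso (Spec.map (CommRingCat.ofHom (twistSub t (dualMonoid σ.1) :
        AddMonoidAlgebra F (dualMonoid σ.1) →+* AddMonoidAlgebra F (dualMonoid σ.1)))))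
  have : IsIso (Δ.chartsTranslation t) := NatIso.isIso_of_isIso_app _
  exact inferInstanceAs (IsIso (HasColimit.isoOfNatIso (asIso (Δ.chartsTranslation t))).hom)

end Twist

section ToricDivisors

variable {M : Type v} [AddCommGroup M] [Module.Free ℤ M] [Module.Finite ℤ M]
  (F : Type u) [Field F] (Δ : Fan M)

instance : Nonempty ((⊤ : (torus F M).Opens) : Type _) :=
  ⟨⟨genericPoint (torus F M), trivial⟩⟩

/-- Laurent polynomials as rational functions on the torus. -/
def torusFun : AddMonoidAlgebra F M →+* (torus F M).functionField :=
  ((Scheme.ΓSpecIso (CommRingCat.of (AddMonoidAlgebra F M))).inv ≫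
    (torus F M).germToFunctionField ⊤).hom

instance : Nonempty (Δ.torusIncl F ''ᵁ ⊤ : (Δ.toricVariety F).Opens) :=
  ⟨⟨_, genericPoint (torus F M), trivial, rfl⟩⟩

/-- Laurent polynomials as rational functions on the toric variety: the rational functions
that are given by them on the principal open subset. -/
def Fan.ratFun : AddMonoidAlgebra F M →+* (Δ.toricVariety F).functionField :=
  ((Scheme.ΓSpecIso (CommRingCat.of (AddMonoidAlgebra F M))).inv ≫
    ((Δ.torusIncl F).appIso ⊤).inv ≫
      (Δ.toricVariety F).germToFunctionField (Δ.torusIncl F ''ᵁ ⊤)).hom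

lemma Fan.ratFun_injective : Function.Injective (Δ.ratFun F) := by
  have h1 := (Δ.toricVariety F).germToFunctionField_injective (Δ.torusIncl F ''ᵁ ⊤)
  have h2 : Function.Injective (((Δ.torusIncl F).appIso ⊤).inv) :=
    ((ConcreteCategory.isIso_iff_bijective ((Δ.torusIncl F).appIso ⊤).inv).1 inferInstance).1
  have h3 : Function.Injective
      ((Scheme.ΓSpecIso (CommRingCat.of (AddMonoidAlgebra F M))).inv) :=
    ((ConcreteCategory.isIso_iff_bijective
      (Scheme.ΓSpecIso (CommRingCat.of (AddMonoidAlgebra F M))).inv).1 inferInstance).1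
  exact h1.comp (h2.comp h3)

/-- The elements of `F[σ^∨ ∩ M]` are regular on `X_σ`. -/
lemma Fan.ratFun_toLaurent (σ : Δ.cones) (x : Δ.toricVariety F)
    (hx : x ∈ (Δ.chart F σ).opensRange) : ∃ θ : AddMonoidAlgebra F (dualMonoid σ.1) →+*
      (Δ.toricVariety F).presheaf.stalk x, ∀ a, Δ.ratFun F (toLaurent F _ a) =
        algebraMap ((Δ.toricVariety F).presheaf.stalk x) (Δ.toricVariety F).functionField (θ a) := by
  have hx' : x ∈ Δ.chart F σ ''ᵁ ⊤ := by
    obtain ⟨y, rfl⟩ := hx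
    exact ⟨y, Set.mem_univ _, rfl⟩
  have : Nonempty (Δ.chart F σ ''ᵁ ⊤ : (Δ.toricVariety F).Opens) := ⟨⟨x, hx'⟩⟩
  have key := image_section_restrict (Spec.map (CommRingCat.ofHom (toLaurent F (dualMonoid σ.1))))
    (Δ.chart F σ) (Δ.torusIncl F) (Δ.torusIncl_eq F σ)
  obtain ⟨hle, key⟩ := key
  refine ⟨((Scheme.ΓSpecIso (CommRingCat.of (AddMonoidAlgebra F (dualMonoid σ.1)))).inv ≫
    ((Δ.chart F σ).appIso ⊤).inv ≫
      (Δ.toricVariety F).presheaf.germ (Δ.chart F σ ''ᵁ ⊤) x hx').hom, fun a => ?_⟩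
  change _ = algebraMap _ _ ((Δ.toricVariety F).presheaf.germ (Δ.chart F σ ''ᵁ ⊤) x hx' _)
  rw [Scheme.algebraMap_germ_eq_germToFunctionField]
  have e1 := congr($(Scheme.ΓSpecIso_inv_naturality
    (CommRingCat.ofHom (toLaurent F (dualMonoid σ.1)))) a)
  have e2 := congr($key ((Scheme.ΓSpecIso
    (CommRingCat.of (AddMonoidAlgebra F (dualMonoid σ.1)))).inv a))
  have e1' : (Scheme.ΓSpecIso (CommRingCat.of (AddMonoidAlgebra F M))).inv
      (toLaurent F (dualMonoid σ.1) a) = (Spec.map (CommRingCat.ofHom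
        (toLaurent F (dualMonoid σ.1)))).appTop ((Scheme.ΓSpecIso
          (CommRingCat.of (AddMonoidAlgebra F (dualMonoid σ.1)))).inv a) := e1
  have e3 := congrArg ((Δ.toricVariety F).germToFunctionField (Δ.torusIncl F ''ᵁ ⊤))
    (e2.trans (congrArg ((Δ.torusIncl F).appIso ⊤).inv e1'.symm))
  refine e3.symm.trans ?_
  exact TopCat.Presheaf.germ_res_apply _ _ _ _ _

/-- The toric divisor `(X_σ, χ^{-m_σ})_σ` of a function `Ψ` on `N_ℝ` that has on each cone `σ` of
the fan a slope `m_σ` in `M`. -/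
def Fan.toricDivisor (Ψ : NR M → ℝ)
    (hΨ : ∀ σ ∈ Δ.cones, ∃ m : M, ∀ u ∈ σ, Ψ u = u m) :
    CartierDivisor.{max u v, v} (Δ.toricVariety F) where
  ι := Δ.cones
  U σ := (Δ.chart F σ).opensRange
  eqn σ := Δ.ratFun F (AddMonoidAlgebra.single (-(hΨ σ.1 σ.2).choose) 1)
  cover x := by
    obtain ⟨σ, y, hy⟩ := Δ.exists_chart F x
    exact ⟨σ, y, hy⟩
  eqn_ne_zero σ := by
    rw [Ne, map_eq_zero_iff _ (Δ.ratFun_injective F)]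
    simp [← AddMonoidAlgebra.coeff_eq_zero]
  compat σ τ x hσ hτ := by
    obtain ⟨θ, hθ⟩ := Δ.ratFun_toLaurent F _ x (Δ.chart_inter F hσ hτ)
    have h1 := (hΨ σ.1 σ.2).choose_spec
    have h2 := (hΨ τ.1 τ.2).choose_spec
    generalize (hΨ σ.1 σ.2).choose = m at h1 ⊢
    generalize (hΨ τ.1 τ.2).choose = m' at h2 ⊢
    have hd : ∀ u ∈ (Δ.inter σ τ).1, u m = u m' := fun u hu => by
      rw [← h1 u hu.1, ← h2 u hu.2]
    let p : dualMonoid (Δ.inter σ τ).1 := ⟨m' - m, fun u hu => by simp [hd u hu]⟩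
    let q : dualMonoid (Δ.inter σ τ).1 := ⟨m - m', fun u hu => by simp [hd u hu]⟩
    have hpq : p + q = 0 := by ext; simp [p, q]
    have hmul : AddMonoidAlgebra.single p (1 : F) * AddMonoidAlgebra.single q 1 = 1 := by
      rw [AddMonoidAlgebra.single_mul_single, hpq, one_mul, AddMonoidAlgebra.one_def]
    refine ⟨⟨θ (AddMonoidAlgebra.single p 1), θ (AddMonoidAlgebra.single q 1), ?_, ?_⟩, ?_⟩
    · rw [← map_mul, hmul, map_one]
    · rw [← map_mul, mul_comm, hmul, map_one]
    · dsimp only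
      rw [← hθ, ← map_mul, toLaurent_single, AddMonoidAlgebra.single_mul_single, mul_one]
      congr 2
      simp [p]
      abel

/-- The nef toric divisor `D_f` on the toric variety over `F` of a fan compatible with the Newton
polytope of a nonzero Laurent polynomial `f`. The coefficient field `K` of `f` need not be `F`. -/
def Fan.newtonDivisor {K : Type u} [Field K] {f : AddMonoidAlgebra K M} (hf : f ≠ 0)
    (hΔ : Δ.IsCompatible (newtonPolytope f)) :
    CartierDivisor.{max u v, v} (Δ.toricVariety F) :=
  Δ.toricDivisor F (supportFunction (newtonPolytope f)) (hΔ.exists_slope hf)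

variable {F}

/-- The twist `t^* s_f = τ_t^* s_f` of the section `s_f` of `L_f = 𝒪(D_f)`. As a rational section,
`s_f` is the rational function `f`. -/
def Fan.twistedSection (t : Multiplicative M →* Fˣ) (f : AddMonoidAlgebra F M) :
    (Δ.toricVariety F).functionField :=
  pullbackRat (Δ.translation t) (Δ.ratFun F f)

end ToricDivisors

section Points

variable {K : Type u} [Field K] {Kbar : Type u} [Field Kbar] [Algebra K Kbar]

/-- The point of the torus over `K` underlying one of its `Kbar`-points. -/
def underlyingPoint {L : Type v} [AddCommGroup L] (t : AddMonoidAlgebra K L →ₐ[K] Kbar) :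
    torus K L :=
  (⟨RingHom.ker t, RingHom.ker_isPrime t⟩ : PrimeSpectrum (AddMonoidAlgebra K L))

/-- The `i`-th component `t_i` of a `Kbar`-point `t` of the `k`-th power of the torus with character
lattice `M`, which is the torus with character lattice `M^k`. The point `t_i` is given by its values
`χ^m(t_i)` at the characters `m` of `M`. -/
def component {M : Type v} [AddCommGroup M] {k : ℕ}
    (t : AddMonoidAlgebra K (Fin k → M) →ₐ[K] Kbar) (i : Fin k) : Multiplicative M →* Kbarˣ :=
  MonoidHom.toHomUnits (((t : AddMonoidAlgebra K (Fin k → M) →* Kbar).comp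
    (AddMonoidAlgebra.of K (Fin k → M))).comp
      (AddMonoidHom.toMultiplicative (AddMonoidHom.single (fun _ : Fin k => M) i)))

/-- The base change of a Laurent polynomial. -/
def baseChange (Kbar : Type u) [Field Kbar] [Algebra K Kbar] {M : Type v} [AddCommGroup M]
    (f : AddMonoidAlgebra K M) : AddMonoidAlgebra Kbar M :=
  AddMonoidAlgebra.mapRingHom M (algebraMap K Kbar) f

end Points

end

end ToricCycles

open ToricCycles

-- Everything follows from one estimate: for generic `t`, the common zeros of the twists indexed by
-- `I` have codimension at least `#I` on `X`, and at least `#I + 1` outside the torus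
-- (`Fan.exists_generic_twist`). Krull's height theorem bounds the codimension of each component
-- above by `#I` (`Fan.coheight_le_card`), so the intersection is proper on `X` and, by restriction
-- to an open subscheme, on the torus. The extra one in the boundary leaves no room there for a
-- component of any of the successive intersection products, so that passing to the closure commutes
-- with each intersection by a divisor (`mapDomain_intersectionCycle`).
--
-- The estimate is proved orbit by orbit. Along the orbit of a cone `σ`, the characters outside
-- `σ^⊥` vanish, and the local equation of `t_i^* s_{f_i}` becomes, up to a nonzero constant, the
-- twist of an initial form of `f_i`, a Laurent polynomial on the torus with character lattice `σ^⊥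
-- ∩ M` (`restrictTo_twist`, `exists_algHom_quotient`). It is nonzero because some exponent of `f_i`
-- attains the minimum on all of `σ` (`exists_exponent`). It is therefore enough to treat twists of
-- nonzero Laurent polynomials `g_i` on a torus of dimension `n` and then to use that the orbit of a
-- nonzero cone has smaller dimension than `X`.
--
-- On a torus, the automorphism `(t, x) ↦ (t_1 x, …, t_k x, x)` of the product of the parameter
-- torus and the torus separates the variables: the `i`-th twist becomes `g_i(y_i)` with `y_i = t_i
-- x`. Each equation lowers the transcendence degree of its own block of variables, so a subvariety
-- of the total space on which the equations in `I` hold has dimension at most `kn + n - #I`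
-- (`trdeg_add_card_le_of_universalTwist_eq_zero`). Consequently any set `S` of coordinates of `x`
-- with `#S + #I > n` satisfies a nontrivial relation over `K[T^k]` modulo the universal twists.
-- Finitely many such relations stay nontrivial wherever the product of one nonzero coefficient of
-- each does not vanish, and this gives the bound on the fibers (`exists_generic_twist`).
--
-- Transcendence degrees and codimensions are exchanged by the dimension formula for finitely
-- generated domains over a field (`height_add_trdeg_quotient`), which also shows that a subvariety
-- of codimension one in a subvariety of codimension `c` has codimension at most `c + 1`.

universe w

namespace ToricCycles

/-! ### The dimension formula for finitely generated domains over a field -/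

section DimensionFormula

open MvPolynomial in
/-- An element of a prime of an integral extension `A` of a polynomial ring whose radical ideal is
that prime: the quotient loses at most one dimension. -/
lemma trdeg_le_trdeg_quotient_add_one_of_le_radical {F : Type u} {A : Type v} [Field F]
    [CommRing A] [IsDomain A] [Algebra F A] [Algebra.FiniteType F A] (q : Ideal A) [q.IsPrime]
    {f : A} (hf : f ≠ 0) (hfq : f ∈ q) (hq : q ≤ (Ideal.span {f}).radical) :
    Algebra.trdeg F A ≤ Algebra.trdeg F (A ⧸ q) + 1 := by
  -- Noether normalization; as `A` is integral over the polynomial ring, its transcendence degree is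
  -- `s`.
  obtain ⟨s, g, hg, hint⟩ := exists_integral_inj_algHom_of_fg F A
  let _ := g.toRingHom.toAlgebra
  have htow : IsScalarTower F (MvPolynomial (Fin s) F) A :=
    IsScalarTower.of_algebraMap_eq' g.comp_algebraMap.symm
  have hAint : Algebra.IsIntegral (MvPolynomial (Fin s) F) A := ⟨hint⟩
  have hinj : Function.Injective (algebraMap (MvPolynomial (Fin s) F) A) := hg
  have hfs : FaithfulSMul (MvPolynomial (Fin s) F) A :=
    (faithfulSMul_iff_algebraMap_injective _ _).2 hinj
  have htf : Module.IsTorsionFree (MvPolynomial (Fin s) F) A := inferInstance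
  have hA : Algebra.trdeg F A = s := by
    have h1 := lift_trdeg_add_eq F (MvPolynomial (Fin s) F) A
    rw [trdeg_eq_zero (R := MvPolynomial (Fin s) F)] at h1
    simpa [Cardinal.lift_eq_nat_iff] using h1.symm
  set P := minpoly (MvPolynomial (Fin s) F) f with hP
  have hfint : IsIntegral (MvPolynomial (Fin s) F) f := hAint.isIntegral f
  -- The constant coefficient of the minimal polynomial plays the role of the norm of `f`: it lies
  -- in `q`, and every element of the contraction of `q` has a power divisible by it.
  set a := P.coeff 0 with ha
  have ha0 : a ≠ 0 := by
    intro h0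
    have hX : P = Polynomial.X * P.divX := by
      conv_lhs => rw [← Polynomial.X_mul_divX_add P]
      rw [← ha, h0, map_zero, add_zero]
    have h1 : Polynomial.aeval f P.divX = 0 := by
      have := minpoly.aeval (MvPolynomial (Fin s) F) f
      rw [← hP, hX, map_mul, Polynomial.aeval_X] at this
      exact (mul_eq_zero.1 this).resolve_left hf
    have hmon : P.Monic := minpoly.monic hfint
    have hd0 : P.divX ≠ 0 := by
      intro h
      rw [h, mul_zero] at hX
      exact hmon.ne_zero hX
    have h2 := Polynomial.degree_le_of_dvd (minpoly.isIntegrallyClosed_dvd hfint h1) hd0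
    exact absurd h2 (not_le.2 (Polynomial.degree_divX_lt hmon.ne_zero))
  have haq : algebraMap _ A a ∈ q := by
    have h1 := minpoly.aeval (MvPolynomial (Fin s) F) f
    rw [← hP, ← Polynomial.X_mul_divX_add P, map_add, map_mul, Polynomial.aeval_X,
      Polynomial.aeval_C, ← ha] at h1
    rw [eq_neg_of_add_eq_zero_right h1]
    exact neg_mem (Ideal.mul_mem_right _ _ hfq)
  -- Some power is `b ^ m = r * f`. Multiplying an integral equation `Q` of `r` by `f ^ Q.natDegree`
  -- turns it into an equation `G` of `f` whose constant coefficient is `b ^ (m * Q.natDegree)`. The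
  -- minimal polynomial of `f` divides `G`, since the polynomial ring is integrally closed.
  have key : ∀ b : MvPolynomial (Fin s) F, algebraMap _ A b ∈ q → ∃ N, a ∣ b ^ N := by
    intro b hb
    obtain ⟨m, hm⟩ := hq hb
    obtain ⟨r, hr⟩ := Ideal.mem_span_singleton'.1 hm
    obtain ⟨Q, hQ, hQr⟩ := hAint.isIntegral r
    let G : Polynomial (MvPolynomial (Fin s) F) :=
      ∑ j ∈ Finset.range (Q.natDegree + 1),
        Polynomial.C (Q.coeff j * (b ^ m) ^ j) * Polynomial.X ^ (Q.natDegree - j)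
    have hG : Polynomial.aeval f G = 0 := by
      have h1 : Polynomial.aeval f G = f ^ Q.natDegree * Polynomial.eval₂ (algebraMap _ A) r Q := by
        rw [Polynomial.eval₂_eq_sum_range, Finset.mul_sum, map_sum]
        refine Finset.sum_congr rfl fun j hj => ?_
        have hj' : j ≤ Q.natDegree := by simpa [Nat.lt_succ_iff] using hj
        rw [map_mul, map_pow, Polynomial.aeval_X, Polynomial.aeval_C, map_mul, map_pow, map_pow,
          ← hr, mul_pow]
        calc _ = (algebraMap (MvPolynomial (Fin s) F) A) (Q.coeff j) * r ^ j *
            (f ^ j * f ^ (Q.natDegree - j)) := by ring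
          _ = _ := by rw [← pow_add, Nat.add_sub_cancel' hj']; ring
      rw [h1, hQr, mul_zero]
    refine ⟨m * Q.natDegree, ?_⟩
    obtain ⟨G', hG'⟩ := minpoly.isIntegrallyClosed_dvd hfint hG
    have hc : G.coeff 0 = b ^ (m * Q.natDegree) := by
      have h0 : G.coeff 0 = G.eval 0 := Polynomial.coeff_zero_eq_eval_zero G
      rw [h0, Polynomial.eval_finsetSum, Finset.sum_eq_single Q.natDegree]
      · simp [hQ.coeff_natDegree, pow_mul]
      · intro j hj hne
        have : Q.natDegree - j ≠ 0 := by
          have := Finset.mem_range.1 hj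
          omega
        simp [this]
      · simp
    rw [← hc, hG', Polynomial.mul_coeff_zero]
    exact Dvd.intro _ rfl
  -- A nonzero constant in `q` would be a unit, so `a` involves some variable.
  have hi : ∃ i, degreeOf i a ≠ 0 := by
    by_contra! hcon
    have h1 : a.totalDegree = 0 := by
      rw [totalDegree_eq_zero_iff]
      intro m hm i
      have := monomial_le_degreeOf i hm
      rw [hcon i] at this
      omega
    rw [totalDegree_eq_zero_iff_eq_C] at h1
    have h2 : IsUnit a := by
      rw [h1]
      refine (IsUnit.mk0 _ fun h => ha0 ?_).map C
      rw [h1, h, map_zero]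
    exact (inferInstance : q.IsPrime).ne_top (Ideal.eq_top_of_isUnit_mem _ haq (h2.map _))
  obtain ⟨i, hi⟩ := hi
  -- A power of a polynomial without the variable `i` is not a nonzero multiple of `a`. Hence the
  -- other `s - 1` variables stay algebraically independent modulo `q`.
  have hzero : ∀ p : MvPolynomial (Fin s) F, algebraMap _ A p ∈ q → degreeOf i p = 0 → p = 0 := by
    intro p hp hdeg
    by_contra hp0
    obtain ⟨N, c, hc⟩ := key p hp
    have h0 := degreeOf_pow_eq i p N hp0
    have hc0 : c ≠ 0 := by
      rintro rfl
      rw [mul_zero] at hc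
      exact pow_ne_zero N hp0 hc
    rw [hdeg, mul_zero, hc, degreeOf_mul_eq ha0 hc0] at h0
    omega
  have hind : AlgebraicIndependent F
      (fun j : {j : Fin s // j ≠ i} => Ideal.Quotient.mk q (g (X j.1))) := by
    rw [algebraicIndependent_iff]
    intro p hp
    have h1 : aeval (fun j : {j : Fin s // j ≠ i} => Ideal.Quotient.mk q (g (X j.1))) p =
        Ideal.Quotient.mk q (g (rename Subtype.val p)) := by
      have : aeval (fun j : {j : Fin s // j ≠ i} => Ideal.Quotient.mk q (g (X j.1))) =
          ((Ideal.Quotient.mkₐ F q).comp g).comp (rename Subtype.val) := by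
        apply algHom_ext
        intro j
        simp
      rw [this]
      rfl
    rw [h1, Ideal.Quotient.eq_zero_iff_mem] at hp
    have h2 := hzero _ hp (by
      classical
      by_contra hne
      have h3 : i ∈ (rename Subtype.val p).vars := by
        rw [vars_def, Multiset.mem_toFinset, ← Multiset.count_ne_zero, ← degreeOf_def]
        exact hne
      obtain ⟨j, -, hj⟩ := Finset.mem_image.1 (vars_rename _ _ h3)
      exact j.2 hj)
    exact rename_injective _ Subtype.val_injective (h2.trans (map_zero _).symm)
  have h3 := hind.lift_cardinalMk_le_trdeg
  rw [hA]
  have hs : 0 < s := i.pos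
  have h4 : ((s - 1 : ℕ) : Cardinal) ≤ Algebra.trdeg F (A ⧸ q) := by
    simpa using h3
  calc (s : Cardinal) = ((s - 1 : ℕ) : Cardinal) + 1 := by
        have : s = (s - 1) + 1 := by omega
        conv_lhs => rw [this]
        push_cast
        rfl
    _ ≤ _ := by gcongr

/-- A prime of height one of a finitely generated domain: the quotient loses at most one
dimension. -/
lemma trdeg_le_trdeg_quotient_add_one {F : Type u} {A : Type v} [Field F]
    [CommRing A] [IsDomain A] [Algebra F A] [Algebra.FiniteType F A] (q : Ideal A) [q.IsPrime]
    (hq : ∀ p : Ideal A, p.IsPrime → p < q → p = ⊥) :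
    Algebra.trdeg F A ≤ Algebra.trdeg F (A ⧸ q) + 1 := by
  by_cases hq0 : q = ⊥
  · subst hq0
    exact (AlgEquiv.quotientBot F A).trdeg_eq.ge.trans le_self_add
  have : IsNoetherianRing A := Algebra.FiniteType.isNoetherianRing F A
  obtain ⟨f, hfq, hf⟩ := Submodule.exists_mem_ne_zero_of_ne_bot hq0
  have hfin := Ideal.finite_minimalPrimes_of_isNoetherianRing A (Ideal.span {f})
  have hmin : ∀ P ∈ (Ideal.span {f}).minimalPrimes, P ≠ q → ¬ P ≤ q := by
    intro P hP hne hle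
    have h0 := hq P hP.1.1 (lt_of_le_of_ne hle hne)
    have : f ∈ P := hP.1.2 (Ideal.mem_span_singleton_self f)
    rw [h0] at this
    exact hf this
  -- Inverting such a `g` removes all components of the zero locus of `f` other than that of `q`, so
  -- `q` lies in the radical of `f` in the localization. It exists because `q` contains none of the
  -- other minimal primes and hence not their intersection.
  have hg : ∃ g, g ∉ q ∧ ∀ P ∈ (Ideal.span {f}).minimalPrimes, P ≠ q → g ∈ P := by
    have h1 := mt (Ideal.IsPrime.inf_le' (s := hfin.toFinset.filter (· ≠ q)) (f := id)
      (inferInstance : q.IsPrime)).1 (by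
        rintro ⟨P, hP, hle⟩
        rw [Finset.mem_filter, Set.Finite.mem_toFinset] at hP
        exact hmin P hP.1 hP.2 hle)
    obtain ⟨g, hg, hgq⟩ := SetLike.not_le_iff_exists.1 h1
    refine ⟨g, hgq, fun P hP hne => ?_⟩
    exact (Finset.inf_le (f := id) (by simp [hP, hne]) : _ ≤ P) hg
  obtain ⟨g, hgq, hg⟩ := hg
  let B := Localization.Away g
  have hg0 : g ≠ 0 := fun h => hgq (h ▸ q.zero_mem)
  have hdisj : Disjoint (Submonoid.powers g : Set A) (q : Set A) := by
    rw [Set.disjoint_left]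
    rintro _ ⟨n, rfl⟩ hn
    exact hgq (Ideal.IsPrime.mem_of_pow_mem inferInstance n hn)
  have hpow : Submonoid.powers g ≤ nonZeroDivisors A :=
    powers_le_nonZeroDivisors_of_noZeroDivisors hg0
  have hBdom : IsDomain B := IsLocalization.isDomain_localization hpow
  have hBinj : Function.Injective (algebraMap A B) := IsLocalization.injective B hpow
  have hprime := IsLocalization.isPrime_of_isPrime_disjoint (Submonoid.powers g) B q inferInstance
    hdisj
  have hcomap := IsLocalization.under_map_of_isPrime_disjoint (Submonoid.powers g) B
    (I := q) inferInstance hdisj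
  have hBfin' : Algebra.FiniteType F B := inferInstance
  have hrad : q.map (algebraMap A B) ≤ (Ideal.span {algebraMap A B f}).radical := by
    rw [Ideal.radical_eq_sInf]
    refine le_sInf fun Q hQ => ?_
    obtain ⟨hfQ, hQp⟩ := hQ
    rw [Ideal.map_le_iff_le_comap]
    have h1 : Ideal.span {f} ≤ Q.comap (algebraMap A B) := by
      rw [Ideal.span_singleton_le_iff_mem, Ideal.mem_comap]
      exact hfQ (Ideal.mem_span_singleton_self _)
    obtain ⟨P, hP, hPQ⟩ := Ideal.exists_minimalPrimes_le h1
    by_cases hPq : P = q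
    · exact hPq ▸ hPQ
    · exfalso
      have h2 : algebraMap A B g ∈ Q := hPQ (hg P hP hPq)
      exact hQp.ne_top (Ideal.eq_top_of_isUnit_mem _ h2
        (IsLocalization.Away.algebraMap_isUnit g))
  have h1 := trdeg_le_trdeg_quotient_add_one_of_le_radical (F := F) (q.map (algebraMap A B))
    (f := algebraMap A B f) (by rwa [Ne, map_eq_zero_iff _ hBinj]) (Ideal.mem_map_of_mem _ hfq) hrad
  have h2 : Algebra.trdeg F A ≤ Algebra.trdeg F B :=
    trdeg_le_of_injective (IsScalarTower.toAlgHom F A B) hBinj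
  refine h2.trans (h1.trans ?_)
  gcongr
  let φ : (A ⧸ q) →ₐ[F] (B ⧸ q.map (algebraMap A B)) :=
    Ideal.quotientMapₐ _ (IsScalarTower.toAlgHom F A B) Ideal.le_comap_map
  have hφ : Function.Injective φ := by
    refine Ideal.quotientMap_injective' (f := algebraMap A B) (H := Ideal.le_comap_map) ?_
    exact hcomap.le
  let _ := φ.toRingHom.toAlgebra
  have htow : IsScalarTower F (A ⧸ q) (B ⧸ q.map (algebraMap A B)) :=
    IsScalarTower.of_algebraMap_eq' φ.comp_algebraMap.symm
  have hfs : FaithfulSMul (A ⧸ q) (B ⧸ q.map (algebraMap A B)) :=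
    (faithfulSMul_iff_algebraMap_injective _ _).2 hφ
  -- A fraction `a / g ^ n` is a root of `g ^ n X - a`, which is nonzero modulo `q`.
  have halg : Algebra.IsAlgebraic (A ⧸ q) (B ⧸ q.map (algebraMap A B)) := by
    refine ⟨fun x => ?_⟩
    obtain ⟨x, rfl⟩ := Ideal.Quotient.mk_surjective x
    obtain ⟨⟨a, ⟨_, n, rfl⟩⟩, ha⟩ := IsLocalization.surj (Submonoid.powers g) x
    refine ⟨Polynomial.C (Ideal.Quotient.mk q (g ^ n)) * Polynomial.X -
      Polynomial.C (Ideal.Quotient.mk q a), fun h0 => ?_, ?_⟩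
    · have := congrArg (fun p => Polynomial.coeff p 1) h0
      simp only [Polynomial.coeff_sub, Polynomial.coeff_C_mul, Polynomial.coeff_X_one, mul_one,
        Polynomial.coeff_C_succ, sub_zero, Polynomial.coeff_zero,
        Ideal.Quotient.eq_zero_iff_mem] at this
      exact hgq (Ideal.IsPrime.mem_of_pow_mem inferInstance n this)
    · have hmk : ∀ c : A, algebraMap (A ⧸ q) (B ⧸ q.map (algebraMap A B)) (Ideal.Quotient.mk q c) =
          Ideal.Quotient.mk _ (algebraMap A B c) := fun _ => rfl
      rw [map_sub, map_mul, Polynomial.aeval_X, Polynomial.aeval_C, Polynomial.aeval_C, hmk, hmk,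
        ← map_mul, ← ha, mul_comm, sub_self]
  have h3 := trdeg_add_eq (A := B ⧸ q.map (algebraMap A B)) F (A ⧸ q)
  rw [trdeg_eq_zero (R := A ⧸ q), add_zero] at h3
  exact h3.ge

/-- A non-injective surjection between domains lowers the transcendence degree. -/
lemma trdeg_add_one_le_of_surjective {F : Type u} {A B : Type v} [Field F]
    [CommRing A] [IsDomain A] [Algebra F A] [Algebra.FiniteType F A]
    [CommRing B] [IsDomain B] [Algebra F B] (f : A →ₐ[F] B) (hf : Function.Surjective f)
    {a : A} (ha : a ≠ 0) (hfa : f a = 0) :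
    Algebra.trdeg F B + 1 ≤ Algebra.trdeg F A := by
  refine Cardinal.add_one_le_of_lt ?_
  -- If the degrees were equal, lifts `y` of a transcendence basis of `B` would form a transcendence
  -- basis of `A`. The nonzero element `a` of the kernel would be algebraic over the algebra
  -- generated by `y`, which would then meet the kernel nontrivially, although `f` is injective on
  -- it.
  · refine lt_of_le_of_ne (trdeg_le_of_surjective f hf) fun heq => ?_
    obtain ⟨s, hs⟩ := exists_isTranscendenceBasis F B
    choose y hy using fun b : s => hf b
    have hcomp : f ∘ y = ((↑) : s → B) := funext hy
    have hyind : AlgebraicIndependent F y := .of_comp f (by rw [hcomp]; exact hs.1)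
    have hbas := hyind.isTranscendenceBasis_of_trdeg_le trdeg_lt_aleph0_of_finiteType
      (by rw [← heq, ← hs.cardinalMk_eq_trdeg])
    have halg := hbas.isAlgebraic
    have h1 := Ideal.comap_ne_bot_of_algebraic_mem (I := RingHom.ker f) ha hfa (halg.isAlgebraic a)
    refine h1 (eq_bot_iff.2 fun c hc => ?_)
    obtain ⟨c, hcy⟩ := c
    rw [Algebra.adjoin_range_eq_range_aeval] at hcy
    obtain ⟨p, rfl⟩ := hcy
    have h2 : f (MvPolynomial.aeval y p) = 0 := hc
    have h3 : MvPolynomial.aeval ((↑) : s → B) p = 0 := by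
      rw [← hcomp, ← h2]
      exact (MvPolynomial.comp_aeval_apply y f p).symm
    have h4 : p = 0 := hs.1.eq_zero_of_aeval_eq_zero _ h3
    subst h4
    exact Subtype.ext (map_zero _)

section Primes

variable {F : Type u} {A : Type v} [Field F] [CommRing A] [Algebra F A] [Algebra.FiniteType F A]

lemma trdeg_quotient_add_one_le {p q : Ideal A} [p.IsPrime] [q.IsPrime] (h : p < q) :
    Algebra.trdeg F (A ⧸ q) + 1 ≤ Algebra.trdeg F (A ⧸ p) := by
  obtain ⟨a, haq, hap⟩ := SetLike.exists_of_lt h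
  refine trdeg_add_one_le_of_surjective (Ideal.Quotient.factorₐ F h.le)
    (Ideal.Quotient.factor_surjective h.le) (a := Ideal.Quotient.mk p a) ?_ ?_
  · rwa [Ne, Ideal.Quotient.eq_zero_iff_mem]
  · exact Ideal.Quotient.eq_zero_iff_mem.2 haq

/-- Reduction to the case of a domain: in `A ⧸ p` the image of `q` has no nonzero prime strictly
below it. -/
lemma trdeg_quotient_le_of_covBy {p q : Ideal A} [p.IsPrime] [q.IsPrime] (hpq : p ≤ q)
    (h : ∀ r : Ideal A, r.IsPrime → p < r → ¬ r < q) :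
    Algebra.trdeg F (A ⧸ p) ≤ Algebra.trdeg F (A ⧸ q) + 1 := by
  have hker : RingHom.ker (Ideal.Quotient.mk p) ≤ q := by rwa [Ideal.mk_ker]
  have hqp : (q.map (Ideal.Quotient.mk p)).IsPrime :=
    Ideal.map_isPrime_of_surjective Ideal.Quotient.mk_surjective hker
  have hcm : (q.map (Ideal.Quotient.mk p)).comap (Ideal.Quotient.mk p) = q := by
    rw [Ideal.comap_map_of_surjective' _ Ideal.Quotient.mk_surjective, sup_eq_left.2 hker]
  have h1 := trdeg_le_trdeg_quotient_add_one (F := F) (q.map (Ideal.Quotient.mk p)) (by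
    intro r hr hrq
    by_contra hr0
    refine h (r.comap (Ideal.Quotient.mk p)) inferInstance ?_ ?_
    · refine lt_of_le_of_ne (fun x hx => ?_) fun heq => hr0 ?_
      · rw [Ideal.mem_comap, Ideal.Quotient.eq_zero_iff_mem.2 hx]
        exact r.zero_mem
      · rw [← Ideal.map_comap_of_surjective _ Ideal.Quotient.mk_surjective r, ← heq,
          Ideal.map_quotient_self]
    · rw [← hcm]
      exact lt_of_le_of_ne (Ideal.comap_mono hrq.le) fun heq =>
        hrq.ne (Ideal.comap_injective_of_surjective _ Ideal.Quotient.mk_surjective heq))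
  exact h1.trans_eq (congrArg (· + 1) (DoubleQuot.quotQuotEquivQuotOfLEₐ F hpq).trdeg_eq)

/-- The dimension formula. -/
lemma height_add_trdeg_quotient [IsDomain A] (q : Ideal A) [hq : q.IsPrime] :
    (q.height : ℕ∞) + Cardinal.toENat (Algebra.trdeg F (A ⧸ q)) =
      Cardinal.toENat (Algebra.trdeg F A) := by
  have : IsNoetherianRing A := Algebra.FiniteType.isNoetherianRing F A
  have hlt : ∀ p : Ideal A, p.IsPrime → Algebra.trdeg F (A ⧸ p) < Cardinal.aleph0 := fun p hp =>
    (trdeg_le_of_surjective (Ideal.Quotient.mkₐ F p)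
      Ideal.Quotient.mk_surjective).trans_lt trdeg_lt_aleph0_of_finiteType
  obtain ⟨N, hN⟩ := Cardinal.lt_aleph0.1 (trdeg_lt_aleph0_of_finiteType (R := F) (S := A))
  have hd : ∀ p : Ideal A, p.IsPrime → ∃ d : ℕ, Algebra.trdeg F (A ⧸ p) = d := fun p hp =>
    Cardinal.lt_aleph0.1 (hlt p hp)
  choose! d hd using hd
  have hbot : d ⊥ = N := by
    have := (AlgEquiv.quotientBot F A).trdeg_eq
    rw [hN, hd ⊥ Ideal.isPrime_bot] at this
    exact_mod_cast this
  have hstep : ∀ p q : Ideal A, p.IsPrime → q.IsPrime → p < q → d q + 1 ≤ d p := by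
    intro p q hp hq hpq
    have := trdeg_quotient_add_one_le (F := F) hpq
    rw [hd p hp, hd q hq] at this
    exact_mod_cast this
  have hcov : ∀ p q : Ideal A, p.IsPrime → q.IsPrime → p < q →
      (∀ r : Ideal A, r.IsPrime → p < r → ¬ r < q) → d p = d q + 1 := by
    intro p q hp hq hpq h
    have h1 := trdeg_quotient_le_of_covBy (F := F) hpq.le h
    rw [hd p hp, hd q hq] at h1
    exact le_antisymm (by exact_mod_cast h1) (hstep p q hp hq hpq)
  have hle : ∀ p : Ideal A, p.IsPrime → d p ≤ N := by
    intro p hp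
    rcases eq_or_ne p ⊥ with rfl | hne
    · exact hbot.le
    · have := hstep ⊥ p Ideal.isPrime_bot hp (bot_lt_iff_ne_bot.2 hne)
      omega
  -- Induction on the defect `N - d q`. By `hcov` the value of `d` changes by exactly one between a
  -- prime and a prime immediately below it; the upper bound looks at all primes immediately below
  -- `q`, the lower bound at one of them.
  have main : ∀ h : ℕ, ∀ q : Ideal A, q.IsPrime → d q + h = N → q.height = h := by
    intro h
    induction h using Nat.strong_induction_on with
    | _ h ih =>
      intro q hq hdq
      refine le_antisymm ?_ ?_
      · rw [Ideal.height_le_iff_covBy]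
        intro p hp hpq hnb
        have h1 := hcov p q hp hq hpq hnb
        have h2 := hle p hp
        rw [ih (h - 1) (by omega) p hp (by omega)]
        exact_mod_cast (by omega : h - 1 < h)
      · rcases Nat.eq_zero_or_pos h with rfl | hpos
        · simp
        have hqb : q ≠ ⊥ := by
          rintro rfl
          omega
        obtain ⟨p, ⟨hp, hpq⟩, hmax⟩ := set_has_maximal_iff_noetherian.2
          (inferInstance : IsNoetherian A A) {p : Ideal A | p.IsPrime ∧ p < q}
          ⟨⊥, Ideal.isPrime_bot, bot_lt_iff_ne_bot.2 hqb⟩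
        have h1 := hcov p q hp hq hpq fun r hr hpr hrq => hmax r ⟨hr, hrq⟩ hpr
        have h3 := ih (h - 1) (by omega) p hp (by omega)
        have h4 := Ideal.height_add_one_le_of_lt_of_isPrime hpq
        rw [h3] at h4
        have : ((h - 1 : ℕ) : ℕ∞) + 1 = h := by
          exact_mod_cast (by omega : h - 1 + 1 = h)
        rwa [this] at h4
  have h1 := main (N - d q) q hq (by have := hle q hq; omega)
  rw [h1, hd q hq, hN]
  simp only [Cardinal.toENat_nat]
  exact_mod_cast (by have := hle q hq; omega : N - d q + d q = N)

end Primes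

end DimensionFormula

/-! ### Algebraic independence of monomials -/

section Monomials

/-- Monomials with linearly independent exponents are algebraically independent. -/
lemma algebraicIndependent_single (R : Type u) [CommRing R] {Γ : Type v} [AddCommGroup Γ]
    {ι : Type w} {b : ι → Γ} (hb : LinearIndependent ℤ b) :
    AlgebraicIndependent R (fun i => (AddMonoidAlgebra.single (b i) 1 : AddMonoidAlgebra R Γ)) := by
  let φ : (ι →₀ ℕ) →+ Γ := Finsupp.liftAddHom fun i => (AddMonoidHom.flip (smulAddHom ℕ Γ)) (b i)
  have hφ : ∀ d, φ d = d.sum fun i n => n • b i := fun d => rfl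
  have hinj : Function.Injective φ := by
    intro d e hde
    have hZ : ∀ d : ι →₀ ℕ, φ d =
        Finsupp.linearCombination ℤ b (d.mapRange (fun n : ℕ => (n : ℤ)) rfl) := by
      intro d
      rw [hφ, Finsupp.linearCombination_apply, Finsupp.sum_mapRange_index (by simp)]
      simp
    rw [hZ, hZ] at hde
    have := hb hde
    ext i
    have h1 := DFunLike.congr_fun this i
    simpa using h1
  -- Evaluation at the monomials is the map of monoid algebras induced by `φ` on exponents, so it
  -- inherits injectivity from `φ`.
  have h : MvPolynomial.aeval
      (fun i => (AddMonoidAlgebra.single (b i) 1 : AddMonoidAlgebra R Γ)) =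
        AddMonoidAlgebra.mapDomainAlgHom R R φ := by
    apply MvPolynomial.algHom_ext
    intro i
    rw [MvPolynomial.aeval_X, MvPolynomial.X, ← MvPolynomial.single_eq_monomial]
    change _ = AddMonoidAlgebra.mapDomain _ _
    rw [AddMonoidAlgebra.mapDomain_single, hφ]
    simp
  rw [algebraicIndependent_iff_injective_aeval, h]
  exact AddMonoidAlgebra.mapDomain_injective hinj

/-- A homomorphism from Laurent polynomials that keeps the coordinate functions algebraically
independent is injective. -/
lemma eq_zero_of_algebraicIndependent_comp {R : Type u} [CommRing R] {Γ : Type v} [AddCommGroup Γ]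
    {ι : Type w} [Fintype ι] (b : Module.Basis ι ℤ Γ) {D : Type*} [CommRing D] [Algebra R D]
    (ψ : AddMonoidAlgebra R Γ →ₐ[R] D)
    (hψ : AlgebraicIndependent R fun i => ψ (AddMonoidAlgebra.single (b i) 1))
    {g : AddMonoidAlgebra R Γ} (hg : ψ g = 0) : g = 0 := by
  classical
  set z : ι → AddMonoidAlgebra R Γ := fun i => AddMonoidAlgebra.single (b i) 1 with hz
  have hzu : ∀ i, IsUnit (z i) := fun i => IsUnit.of_mul_eq_one (AddMonoidAlgebra.single (-b i) 1)
    (by simp [hz, AddMonoidAlgebra.single_mul_single, AddMonoidAlgebra.one_def])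
  have hpow : ∀ (i : ι) (n : ℕ), z i ^ n = AddMonoidAlgebra.single (n • b i) 1 := by
    intro i n
    simp [hz, AddMonoidAlgebra.single_pow]
  have hprod : ∀ v : ι → ℕ, ∏ i, z i ^ v i = AddMonoidAlgebra.single (∑ i, v i • b i) 1 := by
    intro v
    simp_rw [hpow]
    rw [AddMonoidAlgebra.prod_single]
    simp
  -- Multiplication by a monomial, which is a unit, clears the negative exponents.
  have hex : ∀ g : AddMonoidAlgebra R Γ, ∃ (v : ι → ℕ) (p : MvPolynomial ι R),
      g * ∏ i, z i ^ v i = MvPolynomial.aeval z p := by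
    intro g
    induction g using AddMonoidAlgebra.induction_linear with
    | zero => exact ⟨0, 0, by simp⟩
    | add f g hf hg =>
      obtain ⟨v, p, hp⟩ := hf
      obtain ⟨v', p', hp'⟩ := hg
      refine ⟨v + v', p * ∏ i, MvPolynomial.X i ^ v' i + p' * ∏ i, MvPolynomial.X i ^ v i, ?_⟩
      simp only [map_add, map_mul, map_prod, map_pow, MvPolynomial.aeval_X, ← hp, ← hp',
        Pi.add_apply, pow_add, Finset.prod_mul_distrib]
      ring
    | single m r =>
      refine ⟨fun i => (-(b.repr m i)).toNat,
        MvPolynomial.C r * ∏ i, MvPolynomial.X i ^ (b.repr m i).toNat, ?_⟩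
      simp only [map_mul, map_prod, map_pow, MvPolynomial.aeval_X, MvPolynomial.aeval_C]
      rw [hprod, hprod, AddMonoidAlgebra.single_mul_single, mul_one, ← Algebra.smul_def,
        AddMonoidAlgebra.smul_single, smul_eq_mul, mul_one]
      congr 1
      refine (congrArg (· + _) (b.sum_repr m).symm).trans ?_
      rw [← Finset.sum_add_distrib]
      refine Finset.sum_congr rfl fun i _ => ?_
      rw [← natCast_zsmul, ← natCast_zsmul, ← add_smul]
      congr 1
      omega
  obtain ⟨v, p, hp⟩ := hex g
  have h1 : MvPolynomial.aeval (fun i => ψ (z i)) p = 0 := by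
    have : ψ (MvPolynomial.aeval z p) = MvPolynomial.aeval (fun i => ψ (z i)) p :=
      MvPolynomial.comp_aeval_apply z ψ p
    rw [← this, ← hp, map_mul, hg, zero_mul]
  rw [hψ.eq_zero_of_aeval_eq_zero _ h1, map_zero] at hp
  have hu : IsUnit (∏ i, z i ^ v i) := by
    rw [IsUnit.prod_univ_iff]
    exact fun i => (hzu i).pow _
  exact hu.mul_left_eq_zero.1 hp

/-- A maximal algebraically independent subfamily of a finite family. -/
lemma exists_finset_algebraicIndepOn {K : Type u} [Field K] {D : Type v} [CommRing D] [IsDomain D]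
    [Algebra K D] {ι : Type w} [Fintype ι] (y : ι → D) :
    ∃ J : Finset ι, AlgebraicIndepOn K y (J : Set ι) ∧
      ∀ j, IsAlgebraic (Algebra.adjoin K (y '' (J : Set ι))) (y j) := by
  classical
  obtain ⟨J, hJ⟩ := (Set.toFinite {J : Finset ι | AlgebraicIndepOn K y (J : Set ι)}).exists_maximal
    ⟨∅, by
      have : IsEmpty ((∅ : Finset ι) : Set ι) := by simp
      rw [Set.mem_ofPred_eq, AlgebraicIndepOn, algebraicIndependent_empty_type_iff]
      exact FaithfulSMul.algebraMap_injective K D⟩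
  refine ⟨J, hJ.1, fun j => ?_⟩
  by_cases hj : j ∈ J
  · exact isAlgebraic_algebraMap (⟨y j, Algebra.subset_adjoin ⟨j, hj, rfl⟩⟩ :
      Algebra.adjoin K (y '' (J : Set ι)))
  · by_contra hcon
    have h1 : AlgebraicIndepOn K y (insert j (J : Set ι)) := AlgebraicIndepOn.insert hJ.1 hcon
    have h2 := hJ.2 (y := insert j J) (by simpa using h1) (Finset.subset_insert j J)
    exact hj (h2 (Finset.mem_insert_self j J))

/-- If the coordinate functions of a torus are algebraic over a subalgebra, then so are all
characters. -/
lemma isAlgebraic_character {E : Type u} {D : Type v} [CommRing E] [IsDomain E] [CommRing D]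
    [Algebra E D] {Γ : Type*} [AddCommGroup Γ] {ι : Type*} [Fintype ι] (b : Module.Basis ι ℤ Γ)
    (χ : Multiplicative Γ →* D) (h : ∀ i, IsAlgebraic E (χ (Multiplicative.ofAdd (b i)))) (m : Γ) :
    IsAlgebraic E (χ (Multiplicative.ofAdd m)) := by
  let T := Subalgebra.algebraicClosure E D
  have hinv : ∀ m, χ (Multiplicative.ofAdd m) ∈ T → χ (Multiplicative.ofAdd (-m)) ∈ T := by
    intro m hm
    let _ : Invertible (χ (Multiplicative.ofAdd m)) :=
      ⟨χ (Multiplicative.ofAdd (-m)), by rw [← map_mul, ← ofAdd_add]; simp,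
        by rw [← map_mul, ← ofAdd_add]; simp⟩
    exact IsAlgebraic.invOf (x := χ (Multiplicative.ofAdd m)) hm
  let G : AddSubgroup Γ :=
    { carrier := {m | χ (Multiplicative.ofAdd m) ∈ T}
      zero_mem' := by
        simp only [Set.mem_ofPred_eq, ofAdd_zero, map_one]
        exact T.one_mem
      add_mem' := by
        intro a c ha hc
        simp only [Set.mem_ofPred_eq, ofAdd_add, map_mul] at *
        exact T.mul_mem ha hc
      neg_mem' := fun {a} ha => hinv a ha }
  have : m ∈ G := by
    rw [← b.sum_repr m]
    exact G.sum_mem fun i _ => G.zsmul_mem (h i) _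
  exact this

end Monomials

/-! ### Generic twists -/

section GenericTwist

/-- The twist of a Laurent polynomial by the `i`-th component of the universal point of the `k`-th
power of the torus. -/
noncomputable def universalTwist (K : Type u) [Field K] {Γ : Type v} [AddCommGroup Γ] {k : ℕ}
    (i : Fin k) :
    AddMonoidAlgebra K Γ →ₐ[K] AddMonoidAlgebra (AddMonoidAlgebra K (Fin k → Γ)) Γ :=
  AddMonoidAlgebra.lift K _ Γ
    { toFun := fun m => AddMonoidAlgebra.single m.toAdd
        (AddMonoidAlgebra.single (Pi.single i m.toAdd) 1)
      map_one' := by simp [AddMonoidAlgebra.one_def]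
      map_mul' := fun a b => by simp [AddMonoidAlgebra.single_mul_single, Pi.single_add] }

@[simp] lemma universalTwist_single (K : Type u) [Field K] {Γ : Type v} [AddCommGroup Γ] {k : ℕ}
    (i : Fin k) (m : Γ) (c : K) : universalTwist K i (AddMonoidAlgebra.single m c) =
      AddMonoidAlgebra.single m (AddMonoidAlgebra.single (Pi.single i m) c) := by
  simp [universalTwist, AddMonoidAlgebra.smul_single]

variable {K : Type u} [Field K] {Γ : Type v} [AddCommGroup Γ] {ι : Type w} [Fintype ι] {k : ℕ}

/-- A domain generated by the universal point and a point of the torus, on which twists of nonzero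
Laurent polynomials indexed by `I` vanish, has transcendence degree smaller by `#I`. -/
lemma trdeg_add_card_le_of_universalTwist_eq_zero (b : Module.Basis ι ℤ Γ)
    (g : Fin k → AddMonoidAlgebra K Γ) (hg : ∀ i, g i ≠ 0) (I : Finset (Fin k))
    {D : Type*} [CommRing D] [IsDomain D] [Algebra K D]
    (π : AddMonoidAlgebra (AddMonoidAlgebra K (Fin k → Γ)) Γ →ₐ[K] D)
    (hπ : Function.Surjective π) (hI : ∀ i ∈ I, π (universalTwist K i (g i)) = 0) :
    Algebra.trdeg K D + I.card ≤ ((k * Fintype.card ι + Fintype.card ι : ℕ) : Cardinal) := by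
  classical
  -- Change of coordinates on the product of the parameter torus and the torus: `x` is the point and
  -- `y i` is `t_i x`. The equation with index `i` involves only the block `y i`.
  let y : Fin k → ι → D := fun i j =>
    π (universalTwist K i (AddMonoidAlgebra.single (b j) 1))
  let x : ι → D := fun j => π (AddMonoidAlgebra.single (b j) 1)
  choose J hJ1 hJ2 using fun i => exists_finset_algebraicIndepOn (K := K) (y i)
  -- The coordinates of a block with `i ∈ I` cannot all be independent: the characters of this block
  -- would then satisfy no relation, but `g i` is one.
  have hJcard : ∀ i, (J i).card + (if i ∈ I then 1 else 0) ≤ Fintype.card ι := by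
    intro i
    split_ifs with hi
    · have hne : J i ≠ Finset.univ := by
        intro h
        apply hg i
        refine eq_zero_of_algebraicIndependent_comp b (π.comp (universalTwist K i)) ?_ (hI i hi)
        have h1 := hJ1 i
        rw [h, Finset.coe_univ, AlgebraicIndepOn] at h1
        exact h1.comp (fun j : ι => (⟨j, trivial⟩ : (Set.univ : Set ι)))
          (fun a c h => congrArg Subtype.val h)
      exact Nat.succ_le_of_lt (Finset.card_lt_iff_ne_univ _ |>.2 hne)
    · exact Finset.card_le_univ _
  let s : Finset D := (Finset.univ.biUnion fun i => (J i).image (y i)) ∪ Finset.univ.image x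
  let E := Algebra.adjoin K (s : Set D)
  have hys : ∀ i j, IsAlgebraic E (y i j) := by
    intro i j
    refine IsAlgebraic.adjoin_of_forall_isAlgebraic (s := y i '' (J i : Set ι)) ?_ (hJ2 i j)
    rintro _ ⟨⟨j', hj', rfl⟩, hn⟩
    refine (hn ?_).elim
    simp only [s, Finset.coe_union, Set.mem_union, Finset.mem_coe, Finset.mem_biUnion,
      Finset.mem_image]
    exact Or.inl ⟨i, Finset.mem_univ _, j', hj', rfl⟩
  have hxs : ∀ j, IsAlgebraic E (x j) := by
    intro j
    have hj : x j ∈ s := by simp [s]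
    exact isAlgebraic_algebraMap (⟨x j, Algebra.subset_adjoin hj⟩ : E)
  let T := (Subalgebra.algebraicClosure E D).restrictScalars K
  have hxT : ∀ m : Γ, π (AddMonoidAlgebra.single m 1) ∈ T := by
    intro m
    exact isAlgebraic_character b ((π : _ →* D).comp
      (AddMonoidAlgebra.of (AddMonoidAlgebra K (Fin k → Γ)) Γ)) hxs m
  have hyT : ∀ (i : Fin k) (m : Γ), π (universalTwist K i (AddMonoidAlgebra.single m 1)) ∈ T := by
    intro i m
    exact isAlgebraic_character b (((π.comp (universalTwist K i)) : _ →* D).comp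
      (AddMonoidAlgebra.of K Γ)) (hys i) m
  have htT : ∀ (i : Fin k) (m : Γ), π (AddMonoidAlgebra.single 0
      (AddMonoidAlgebra.single (Pi.single i m) 1)) ∈ T := by
    intro i m
    -- The coordinates of the parameters are recovered from `t_i = (t_i x) x⁻¹`.
    have h1 : (AddMonoidAlgebra.single 0 (AddMonoidAlgebra.single (Pi.single i m) 1) :
        AddMonoidAlgebra (AddMonoidAlgebra K (Fin k → Γ)) Γ) =
        universalTwist K i (AddMonoidAlgebra.single m 1) * AddMonoidAlgebra.single (-m) 1 := by
      rw [universalTwist_single, AddMonoidAlgebra.single_mul_single, mul_one, add_neg_cancel]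
    rw [h1, map_mul]
    exact T.mul_mem (hyT i m) (hxT _)
  have hvT : ∀ v : Fin k → Γ, π (AddMonoidAlgebra.single 0 (AddMonoidAlgebra.single v 1)) ∈ T := by
    intro v
    have h1 : (AddMonoidAlgebra.single 0 (AddMonoidAlgebra.single v 1) :
        AddMonoidAlgebra (AddMonoidAlgebra K (Fin k → Γ)) Γ) =
        ∏ i, AddMonoidAlgebra.single 0 (AddMonoidAlgebra.single (Pi.single i (v i)) 1) := by
      rw [AddMonoidAlgebra.prod_single, AddMonoidAlgebra.prod_single, Finset.univ_sum_single]
      simp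
    rw [h1, map_prod]
    exact T.prod_mem fun i _ => htT i (v i)
  have hall : ∀ d, d ∈ T := by
    intro d
    obtain ⟨a, rfl⟩ := hπ d
    induction a using AddMonoidAlgebra.induction_linear with
    | zero => rw [map_zero]; exact T.zero_mem
    | add a c ha hc => rw [map_add]; exact T.add_mem ha hc
    | single m a =>
      have h1 : (AddMonoidAlgebra.single m a :
          AddMonoidAlgebra (AddMonoidAlgebra K (Fin k → Γ)) Γ) =
          AddMonoidAlgebra.single 0 a * AddMonoidAlgebra.single m 1 := by
        rw [AddMonoidAlgebra.single_mul_single, mul_one, zero_add]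
      rw [h1, map_mul]
      refine T.mul_mem ?_ (hxT m)
      induction a using AddMonoidAlgebra.induction_linear with
      | zero => rw [AddMonoidAlgebra.single_zero, map_zero]; exact T.zero_mem
      | add a c ha hc =>
        rw [AddMonoidAlgebra.single_add, map_add]
        refine T.add_mem (ha ?_) (hc ?_)
        · rw [AddMonoidAlgebra.single_mul_single, mul_one, zero_add]
        · rw [AddMonoidAlgebra.single_mul_single, mul_one, zero_add]
      | single v c =>
        have h2 : (AddMonoidAlgebra.single 0 (AddMonoidAlgebra.single v c) :
            AddMonoidAlgebra (AddMonoidAlgebra K (Fin k → Γ)) Γ) =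
            c • AddMonoidAlgebra.single 0 (AddMonoidAlgebra.single v 1) := by
          rw [AddMonoidAlgebra.smul_single, AddMonoidAlgebra.smul_single, smul_eq_mul, mul_one]
        rw [h2, map_smul]
        exact T.smul_mem (hvT v) c
  have halg : Algebra.IsAlgebraic (Algebra.adjoin K (s : Set D)) D := ⟨fun d => hall d⟩
  have h1 := Algebra.IsAlgebraic.trdeg_le_cardinalMk K (s : Set D)
  have h2 : Cardinal.mk (s : Set D) = s.card := by simp
  rw [h2] at h1
  have h3 : s.card + I.card ≤ k * Fintype.card ι + Fintype.card ι := by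
    have h4 : s.card ≤ ∑ i, (J i).card + Fintype.card ι := by
      refine (Finset.card_union_le _ _).trans (add_le_add ?_ Finset.card_image_le)
      exact Finset.card_biUnion_le.trans (Finset.sum_le_sum fun i _ => Finset.card_image_le)
    have h5 := Finset.sum_le_sum (s := Finset.univ) fun i _ => hJcard i
    rw [Finset.sum_add_distrib] at h5
    simp only [Finset.sum_ite_mem, Finset.univ_inter, Finset.sum_const, smul_eq_mul, mul_one,
      Finset.card_univ, Fintype.card_fin] at h5
    omega
  calc _ ≤ (s.card : Cardinal) + I.card := by gcongr
    _ ≤ _ := by exact_mod_cast h3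

/-- If `#S + #I` exceeds the dimension of the torus, then the ideal generated by the universal
twists of the Laurent polynomials indexed by `I` contains a nonzero polynomial in the coordinates
indexed by `S`. -/
lemma exists_relation_mem_span_universalTwist (b : Module.Basis ι ℤ Γ)
    (g : Fin k → AddMonoidAlgebra K Γ) (hg : ∀ i, g i ≠ 0) (I : Finset (Fin k)) (S : Finset ι)
    (hS : Fintype.card ι < S.card + I.card) :
    ∃ G : MvPolynomial S (AddMonoidAlgebra K (Fin k → Γ)), G ≠ 0 ∧
      MvPolynomial.aeval (fun s : S => (AddMonoidAlgebra.single (b s) 1 :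
        AddMonoidAlgebra (AddMonoidAlgebra K (Fin k → Γ)) Γ)) G ∈
      Ideal.span ((fun i => universalTwist K i (g i)) '' (I : Set (Fin k))) := by
  classical
  have hfree : Module.Free ℤ Γ := .of_basis b
  have hfin : Module.Finite ℤ Γ := .of_basis b
  have hdomA : IsDomain (AddMonoidAlgebra K (Fin k → Γ)) := isDomain_laurent K
  by_contra! hcon
  set J := Ideal.span ((fun i => universalTwist K i (g i)) '' (I : Set (Fin k))) with hJ
  let z : S → AddMonoidAlgebra (AddMonoidAlgebra K (Fin k → Γ)) Γ :=
    fun s => AddMonoidAlgebra.single (b s) 1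
  -- Without a relation, `J` avoids all nonzero polynomials in the coordinates in `S`, hence so does
  -- some prime `P ⊇ J`. Modulo `P` these coordinates are independent over `K[T^k]`, which makes the
  -- transcendence degree at least `k n + #S` for a torus of dimension `n`, more than the upper
  -- bound `k n + n - #I` allows.
  let W : Submonoid (AddMonoidAlgebra (AddMonoidAlgebra K (Fin k → Γ)) Γ) :=
    (nonZeroDivisors (MvPolynomial S (AddMonoidAlgebra K (Fin k → Γ)))).map (MvPolynomial.aeval z)
  have hdisj : Disjoint (J : Set (AddMonoidAlgebra (AddMonoidAlgebra K (Fin k → Γ)) Γ)) W := by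
    rw [Set.disjoint_left]
    rintro _ ha ⟨G, hG, rfl⟩
    exact hcon G (nonZeroDivisors.ne_zero hG) ha
  obtain ⟨P, hP, hJP, hPW⟩ := Ideal.exists_le_prime_disjoint J W hdisj
  let D := AddMonoidAlgebra (AddMonoidAlgebra K (Fin k → Γ)) Γ ⧸ P
  have hind : AlgebraicIndependent (AddMonoidAlgebra K (Fin k → Γ))
      (fun s : S => Ideal.Quotient.mkₐ (AddMonoidAlgebra K (Fin k → Γ)) P (z s)) := by
    rw [algebraicIndependent_iff]
    intro G hG
    by_contra hG0
    have h1 : MvPolynomial.aeval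
        (fun s : S => Ideal.Quotient.mkₐ (AddMonoidAlgebra K (Fin k → Γ)) P (z s)) G =
        Ideal.Quotient.mkₐ (AddMonoidAlgebra K (Fin k → Γ)) P (MvPolynomial.aeval z G) :=
      (MvPolynomial.comp_aeval_apply z _ G).symm
    rw [h1, Ideal.Quotient.mkₐ_eq_mk, Ideal.Quotient.eq_zero_iff_mem] at hG
    exact Set.disjoint_left.1 hPW hG ⟨G, mem_nonZeroDivisors_of_ne_zero hG0, rfl⟩
  have hfs : FaithfulSMul (AddMonoidAlgebra K (Fin k → Γ)) D :=
    (faithfulSMul_iff_algebraMap_injective _ _).2 hind.algebraMap_injective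
  have h1 := trdeg_add_eq (A := D) K (AddMonoidAlgebra K (Fin k → Γ))
  have h2 : (S.card : Cardinal) ≤ Algebra.trdeg (AddMonoidAlgebra K (Fin k → Γ)) D := by
    have := hind.lift_cardinalMk_le_trdeg
    simpa using this
  have h3 : ((k * Fintype.card ι : ℕ) : Cardinal) ≤
      Algebra.trdeg K (AddMonoidAlgebra K (Fin k → Γ)) := by
    have := (algebraicIndependent_single K
      (Pi.basis fun _ : Fin k => b).linearIndependent).lift_cardinalMk_le_trdeg
    rw [Cardinal.mk_fintype, Fintype.card_sigma] at this
    exact Cardinal.nat_le_lift_iff.1 (by simpa using this)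
  have h4 := trdeg_add_card_le_of_universalTwist_eq_zero b g hg I (D := D)
    (Ideal.Quotient.mkₐ K P) Ideal.Quotient.mk_surjective (fun i hi => by
      rw [Ideal.Quotient.mkₐ_eq_mk, Ideal.Quotient.eq_zero_iff_mem]
      exact hJP (Ideal.subset_span ⟨i, hi, rfl⟩))
  rw [← h1] at h4
  have h5 : ((k * Fintype.card ι : ℕ) : Cardinal) + S.card + I.card ≤
      ((k * Fintype.card ι + Fintype.card ι : ℕ) : Cardinal) := by
    refine le_trans ?_ h4
    gcongr
  have h6 : k * Fintype.card ι + S.card + I.card ≤ k * Fintype.card ι + Fintype.card ι := by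
    exact_mod_cast h5
  omega

/-- Evaluating the coefficients at `t` specializes the universal point to `t`; relations among the
universal twists thereby become relations among the twists by `t`. -/
lemma mapRingHom_universalTwist {Kbar : Type u} [Field Kbar] [Algebra K Kbar]
    (t : AddMonoidAlgebra K (Fin k → Γ) →ₐ[K] Kbar) (i : Fin k) (g : AddMonoidAlgebra K Γ) :
    AddMonoidAlgebra.mapRingHom Γ (t : AddMonoidAlgebra K (Fin k → Γ) →+* Kbar)
      (universalTwist K i g) = twist (component t i) (baseChange Kbar g) := by
  induction g using AddMonoidAlgebra.induction_linear with
  | zero => simp [baseChange]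
  | add f g hf hg =>
    simp only [baseChange, map_add] at *
    rw [hf, hg]
  | single m c =>
    have h1 : (AddMonoidAlgebra.single (Pi.single i m) c : AddMonoidAlgebra K (Fin k → Γ)) =
        c • AddMonoidAlgebra.single (Pi.single i m) 1 := by
      rw [AddMonoidAlgebra.smul_single, smul_eq_mul, mul_one]
    simp only [baseChange, universalTwist_single, AddMonoidAlgebra.mapRingHom_single, twist_single]
    congr 1
    rw [h1]
    change t (c • _) = algebraMap K Kbar c * t _
    rw [map_smul, Algebra.smul_def]
    rfl

/-- For a generic point `t` of the `k`-th power of a torus, the twists of nonzero Laurent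
polynomials indexed by `I` cut out subvarieties of codimension at least `#I`. -/
theorem exists_generic_twist (Γ : Type v) [AddCommGroup Γ] [Module.Free ℤ Γ] [Module.Finite ℤ Γ]
    (Kbar : Type u) [Field Kbar] [Algebra K Kbar]
    (g : Fin k → AddMonoidAlgebra K Γ) (hg : ∀ i, g i ≠ 0) :
    ∃ h : AddMonoidAlgebra K (Fin k → Γ), h ≠ 0 ∧
      ∀ t : AddMonoidAlgebra K (Fin k → Γ) →ₐ[K] Kbar, t h ≠ 0 →
      ∀ (I : Finset (Fin k)) (B : Type (max u v)) [CommRing B] [IsDomain B] [Algebra Kbar B]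
        (Ψ : AddMonoidAlgebra Kbar Γ →ₐ[Kbar] B), Function.Surjective Ψ →
        (∀ i ∈ I, Ψ (twist (component t i) (baseChange Kbar (g i))) = 0) →
        Algebra.trdeg Kbar B + I.card ≤ Module.finrank ℤ Γ := by
  classical
  let n := Module.finrank ℤ Γ
  let b : Module.Basis (Fin n) ℤ Γ := Module.finBasis ℤ Γ
  have hdomA : IsDomain (AddMonoidAlgebra K (Fin k → Γ)) := isDomain_laurent K
  have hrel := exists_relation_mem_span_universalTwist b g hg
  choose! G hG0 hG using hrel
  -- One nonzero coefficient of each relation. Pairs without a relation get the value `1`, so that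
  -- the product can run over all pairs.
  have hcoeff : ∀ (I : Finset (Fin k)) (S : Finset (Fin n)), ∃ c : AddMonoidAlgebra K (Fin k → Γ),
      c ≠ 0 ∧ (Fintype.card (Fin n) < S.card + I.card → ∃ d, (G I S).coeff d = c) := by
    intro I S
    by_cases h : Fintype.card (Fin n) < S.card + I.card
    · obtain ⟨d, hd⟩ := MvPolynomial.exists_coeff_ne_zero (hG0 I S h)
      exact ⟨_, hd, fun _ => ⟨d, rfl⟩⟩
    · exact ⟨1, one_ne_zero, fun h' => (h h').elim⟩
  choose c hc0 hc using hcoeff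
  refine ⟨∏ I, ∏ S, c I S, Finset.prod_ne_zero_iff.2 fun I _ =>
    Finset.prod_ne_zero_iff.2 fun S _ => hc0 I S, ?_⟩
  intro t ht I B _ _ _ Ψ hΨ hI
  let z : Fin n → B := fun j => Ψ (AddMonoidAlgebra.single (b j) 1)
  obtain ⟨S, hS1, hS2⟩ := exists_finset_algebraicIndepOn (K := Kbar) z
  -- Otherwise the relation of the pair `I`, `S` specializes at `t` to a relation between the
  -- independent coordinates in `S`. All its coefficients then vanish at `t`, among them the factor
  -- `c I S` of the chosen product.
  have hle : S.card + I.card ≤ n := by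
    by_contra! hlt
    replace hlt : Fintype.card (Fin n) < S.card + I.card := by rwa [Fintype.card_fin]
    obtain ⟨d, hd⟩ := hc I S hlt
    have htc : t (c I S) ≠ 0 := by
      intro h0
      apply ht
      rw [map_prod]
      refine Finset.prod_eq_zero (Finset.mem_univ I) ?_
      rw [map_prod]
      exact Finset.prod_eq_zero (Finset.mem_univ S) h0
    let t' : AddMonoidAlgebra K (Fin k → Γ) →+* Kbar := t
    let Θ : AddMonoidAlgebra (AddMonoidAlgebra K (Fin k → Γ)) Γ →+* B :=
      (Ψ : AddMonoidAlgebra Kbar Γ →+* B).comp (AddMonoidAlgebra.mapRingHom Γ t')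
    have hΘ : Ideal.span ((fun i => universalTwist K i (g i)) '' (I : Set (Fin k))) ≤
        RingHom.ker Θ := by
      rw [Ideal.span_le]
      rintro _ ⟨i, hi, rfl⟩
      change Ψ (AddMonoidAlgebra.mapRingHom Γ t' (universalTwist K i (g i))) = 0
      rw [mapRingHom_universalTwist]
      exact hI i hi
    have h1 : Θ _ = 0 := hΘ (hG I S hlt)
    have h2 : MvPolynomial.aeval (fun s : S => z s) (MvPolynomial.map t' (G I S)) = 0 := by
      rw [← h1, MvPolynomial.aeval_def, MvPolynomial.eval₂_map, MvPolynomial.aeval_def,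
        MvPolynomial.hom_eval₂]
      congr 1
      · refine RingHom.ext fun a => ?_
        change algebraMap Kbar B (t' a) =
          Ψ (AddMonoidAlgebra.mapRingHom Γ t' (AddMonoidAlgebra.single 0 a))
        rw [AddMonoidAlgebra.mapRingHom_single, ← AlgHom.commutes Ψ]
        rfl
      · funext s
        change Ψ _ = Ψ (AddMonoidAlgebra.mapRingHom Γ t' _)
        rw [AddMonoidAlgebra.mapRingHom_single, map_one]
    have h3 : MvPolynomial.map t' (G I S) = 0 := AlgebraicIndependent.eq_zero_of_aeval_eq_zero
      (x := fun s : S => z s) hS1 _ h2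
    have h4 : t' ((G I S).coeff d) = 0 := by
      have := congrArg (MvPolynomial.coeff d) h3
      rwa [MvPolynomial.coeff_map, MvPolynomial.coeff_zero] at this
    rw [hd] at h4
    exact htc h4
  -- By the maximality of `S` all coordinates, hence all characters, are algebraic over the
  -- coordinates in `S`.
  let E := Algebra.adjoin Kbar (z '' (S : Set (Fin n)))
  have halg : Algebra.IsAlgebraic E B := by
    refine ⟨fun x => ?_⟩
    obtain ⟨a, rfl⟩ := hΨ x
    let T := (Subalgebra.algebraicClosure E B).restrictScalars Kbar
    change Ψ a ∈ T
    induction a using AddMonoidAlgebra.induction_linear with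
    | zero => rw [map_zero]; exact T.zero_mem
    | add a c ha hc => rw [map_add]; exact T.add_mem ha hc
    | single m r =>
      have h1 : (AddMonoidAlgebra.single m r : AddMonoidAlgebra Kbar Γ) =
          r • AddMonoidAlgebra.single m 1 := by
        rw [AddMonoidAlgebra.smul_single, smul_eq_mul, mul_one]
      rw [h1, map_smul]
      exact T.smul_mem (isAlgebraic_character b
        ((Ψ : _ →* B).comp (AddMonoidAlgebra.of Kbar Γ)) hS2 m) r
  have h5 := Algebra.IsAlgebraic.trdeg_le_cardinalMk Kbar (z '' (S : Set (Fin n)))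
  have h6 : Cardinal.mk (z '' (S : Set (Fin n))) ≤ S.card := by
    rw [← Finset.coe_image]
    simp only [Finset.coe_sort_coe, Cardinal.mk_coe_finset]
    exact_mod_cast Finset.card_image_le
  calc _ ≤ (S.card : Cardinal) + I.card := by
        gcongr
        exact h5.trans h6
    _ ≤ _ := by exact_mod_cast hle

end GenericTwist

/-! ### Rational functions under dominant morphisms -/

section PullbackRat

variable {X Y : Scheme.{u}} [IsIntegral X] [IsIntegral Y]

lemma pullbackRat_germToFunctionField (φ : X ⟶ Y) [IsDominant φ] (U : Y.Opens) [Nonempty U]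
    [Nonempty (φ ⁻¹ᵁ U)] (s : Γ(Y, U)) : pullbackRat φ (Y.germToFunctionField U s) =
      X.germToFunctionField (φ ⁻¹ᵁ U) (φ.app U s) := by
  have hU : genericPoint X ∈ φ ⁻¹ᵁ U :=
    ((genericPoint_spec X).mem_open_set_iff (φ ⁻¹ᵁ U).isOpen).mpr
      (by simpa using (inferInstance : Nonempty (φ ⁻¹ᵁ U)))
  refine Eq.trans ?_ (Scheme.Hom.germ_stalkMap_apply φ U (genericPoint X) hU s)
  exact congrArg (φ.stalkMap (genericPoint X))
    (TopCat.Presheaf.germ_stalkSpecializes_apply _ _ _ s)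

/-- This allows identities of pulled back germs to be checked between rational functions. -/
lemma algebraMap_stalkMap (φ : X ⟶ Y) [IsDominant φ] (x : X) (a : Y.presheaf.stalk (φ x)) :
    algebraMap (X.presheaf.stalk x) X.functionField (φ.stalkMap x a) =
      pullbackRat φ (algebraMap (Y.presheaf.stalk (φ x)) Y.functionField a) := by
  obtain ⟨U, hU, s, rfl⟩ := Y.presheaf.exists_germ_eq a
  have : Nonempty U := ⟨⟨_, hU⟩⟩
  have : Nonempty (φ ⁻¹ᵁ U) := ⟨⟨x, hU⟩⟩
  have hx : x ∈ φ ⁻¹ᵁ U := hU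
  have e1 : φ.stalkMap x (Y.presheaf.germ U (φ x) hU s) =
      X.presheaf.germ (φ ⁻¹ᵁ U) x hx (φ.app U s) := Scheme.Hom.germ_stalkMap_apply φ U x hx s
  rw [e1, Scheme.algebraMap_germ_eq_germToFunctionField,
    Scheme.algebraMap_germ_eq_germToFunctionField, pullbackRat_germToFunctionField]

/-- Rational functions given by sections on open subschemes are pulled back by pulling back the
sections. -/
lemma pullbackRat_appIso_inv {U V : Scheme.{u}} (φ : X ⟶ Y) [IsDominant φ] (i : U ⟶ Y)
    [IsOpenImmersion i] (j : V ⟶ X) [IsOpenImmersion j] (ψ : V ⟶ U) (h : j ≫ φ = ψ ≫ i)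
    [Nonempty (i ''ᵁ ⊤ : Y.Opens)] [Nonempty (j ''ᵁ ⊤ : X.Opens)] (s : Γ(U, ⊤)) :
    pullbackRat φ (Y.germToFunctionField (i ''ᵁ ⊤) ((i.appIso ⊤).inv s)) =
      X.germToFunctionField (j ''ᵁ ⊤) ((j.appIso ⊤).inv (ψ.appTop s)) := by
  have hle : j ''ᵁ ⊤ ≤ φ ⁻¹ᵁ (i ''ᵁ ⊤) := by
    rintro _ ⟨y, -, rfl⟩
    refine ⟨ψ y, trivial, ?_⟩
    exact (congr($h y)).symm
  have : Nonempty (φ ⁻¹ᵁ (i ''ᵁ ⊤)) := by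
    obtain ⟨x, hx⟩ := (inferInstance : Nonempty (j ''ᵁ ⊤ : X.Opens))
    exact ⟨⟨x, hle hx⟩⟩
  have key : (i.appIso ⊤).inv ≫ φ.appLE (i ''ᵁ ⊤) (j ''ᵁ ⊤) hle =
      ψ.appTop ≫ (j.appIso ⊤).inv := by
    have happ : ψ.appTop = ψ.appLE ⊤ ⊤ (by simp) := (Scheme.Hom.appLE_eq_app ψ).symm
    rw [Iso.inv_comp_eq, ← Category.assoc, Iso.eq_comp_inv, Scheme.Hom.appIso_hom',
      Scheme.Hom.appIso_hom', happ]
    refine (Scheme.Hom.appLE_comp_appLE j φ (i ''ᵁ ⊤) (j ''ᵁ ⊤) ⊤ _ _).trans ?_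
    refine Eq.trans ?_ (Scheme.Hom.appLE_comp_appLE ψ i (i ''ᵁ ⊤) ⊤ ⊤ _ _).symm
    congr 1
  rw [pullbackRat_germToFunctionField]
  have h1 := congr($key s)
  rw [ConcreteCategory.comp_apply, ConcreteCategory.comp_apply] at h1
  rw [← h1]
  exact (TopCat.Presheaf.germ_res_apply _ _ _ _ _).symm

end PullbackRat

/-! ### Laurent polynomials as rational functions -/

section RatFun

variable {F : Type u} [Field F] {M : Type v} [AddCommGroup M] (Δ : Fan M)

lemma Fan.torusIncl_translation (t : Multiplicative M →* Fˣ) :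
    Δ.torusIncl F ≫ Δ.translation t =
      Spec.map (CommRingCat.ofHom (twist t : AddMonoidAlgebra F M →+* AddMonoidAlgebra F M)) ≫
        Δ.torusIncl F := by
  have h1 : Δ.chart F Δ.zeroCone ≫ Δ.translation t = Spec.map (CommRingCat.ofHom
      (twistSub t (dualMonoid Δ.zeroCone.1) : _ →+* _)) ≫ Δ.chart F Δ.zeroCone :=
    ι_colimMap (Δ.chartsTranslation t) Δ.zeroCone
  rw [Fan.torusIncl, Category.assoc, h1, ← Spec.map_comp_assoc, ← Spec.map_comp_assoc,
    ← CommRingCat.ofHom_comp, ← CommRingCat.ofHom_comp]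
  congr 3
  apply AddMonoidAlgebra.ringHom_ext <;> intros <;> simp [twistSub]

variable [Module.Free ℤ M] [Module.Finite ℤ M]

/-- The twist of `s_f` is the rational function `t^* f`. -/
lemma Fan.twistedSection_eq (t : Multiplicative M →* Fˣ) (f : AddMonoidAlgebra F M) :
    Δ.twistedSection t f = Δ.ratFun F (twist t f) := by
  refine (pullbackRat_appIso_inv (Δ.translation t) (Δ.torusIncl F) (Δ.torusIncl F) _
    (Δ.torusIncl_translation t) _).trans ?_
  have e1 := congr($(Scheme.ΓSpecIso_inv_naturality
    (CommRingCat.ofHom (twist t : AddMonoidAlgebra F M →+* AddMonoidAlgebra F M))) f)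
  exact congrArg (fun x => (Δ.toricVariety F).germToFunctionField (Δ.torusIncl F ''ᵁ ⊤)
    (((Δ.torusIncl F).appIso ⊤).inv x)) e1.symm

lemma Fan.pullbackRat_torusIncl_ratFun [IsDominant (Δ.torusIncl F)] (f : AddMonoidAlgebra F M) :
    pullbackRat (Δ.torusIncl F) (Δ.ratFun F f) = torusFun F f := by
  have hle : (⊤ : (torus F M).Opens) ≤ Δ.torusIncl F ⁻¹ᵁ (Δ.torusIncl F ''ᵁ ⊤) :=
    fun y _ => ⟨y, trivial, rfl⟩
  have : Nonempty (Δ.torusIncl F ⁻¹ᵁ (Δ.torusIncl F ''ᵁ ⊤)) :=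
    ⟨⟨genericPoint (torus F M), hle trivial⟩⟩
  set s := (Scheme.ΓSpecIso (CommRingCat.of (AddMonoidAlgebra F M))).inv f with hs
  refine (pullbackRat_germToFunctionField (Δ.torusIncl F) (Δ.torusIncl F ''ᵁ ⊤)
    (((Δ.torusIncl F).appIso ⊤).inv s)).trans ?_
  have h1 : (Δ.torusIncl F).app (Δ.torusIncl F ''ᵁ ⊤) (((Δ.torusIncl F).appIso ⊤).inv s) =
      (torus F M).presheaf.map (eqToHom ((Δ.torusIncl F).preimage_image_eq ⊤)).op s :=
    congr($(Scheme.Hom.appIso_inv_app (Δ.torusIncl F) ⊤) s)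
  rw [h1]
  exact TopCat.Presheaf.germ_res_apply _ _ _ _ _

instance : IsDominant (Δ.torusIncl F) := by
  refine ⟨?_⟩
  rw [denseRange_iff_closure_range]
  refine Set.eq_univ_of_univ_subset ?_
  rw [← genericPoint_closure (α := Δ.toricVariety F)]
  refine closure_mono ?_
  rw [Set.singleton_subset_iff, ← genericPoint_eq_of_isOpenImmersion (Δ.torusIncl F)]
  exact ⟨_, rfl⟩

/-- The elements of `F[σ^∨ ∩ M]` as germs at the points of `X_σ`. -/
lemma Fan.exists_germ (σ : Δ.cones) (y : Δ.affineChart F σ) :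
    ∃ θ : AddMonoidAlgebra F (dualMonoid σ.1) →+*
      (Δ.toricVariety F).presheaf.stalk (Δ.chart F σ y),
      (∀ a, Δ.ratFun F (toLaurent F _ a) = algebraMap _ (Δ.toricVariety F).functionField (θ a)) ∧
      ∀ a, IsUnit (θ a) ↔
        a ∉ (y : PrimeSpectrum (AddMonoidAlgebra F (dualMonoid σ.1))).asIdeal := by
  have hx' : Δ.chart F σ y ∈ Δ.chart F σ ''ᵁ ⊤ := ⟨y, Set.mem_univ _, rfl⟩
  have : Nonempty (Δ.chart F σ ''ᵁ ⊤ : (Δ.toricVariety F).Opens) := ⟨⟨_, hx'⟩⟩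
  obtain ⟨hle, key⟩ := image_section_restrict
    (Spec.map (CommRingCat.ofHom (toLaurent F (dualMonoid σ.1)))) (Δ.chart F σ) (Δ.torusIncl F)
    (Δ.torusIncl_eq F σ)
  refine ⟨((Scheme.ΓSpecIso (CommRingCat.of (AddMonoidAlgebra F (dualMonoid σ.1)))).inv ≫
    ((Δ.chart F σ).appIso ⊤).inv ≫
      (Δ.toricVariety F).presheaf.germ (Δ.chart F σ ''ᵁ ⊤) _ hx').hom, fun a => ?_, fun a => ?_⟩
  · change _ = algebraMap _ _ ((Δ.toricVariety F).presheaf.germ (Δ.chart F σ ''ᵁ ⊤) _ hx' _)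
    rw [Scheme.algebraMap_germ_eq_germToFunctionField]
    have e1 : (Scheme.ΓSpecIso (CommRingCat.of (AddMonoidAlgebra F M))).inv
        (toLaurent F (dualMonoid σ.1) a) = (Spec.map (CommRingCat.ofHom
          (toLaurent F (dualMonoid σ.1)))).appTop ((Scheme.ΓSpecIso
            (CommRingCat.of (AddMonoidAlgebra F (dualMonoid σ.1)))).inv a) :=
      congr($(Scheme.ΓSpecIso_inv_naturality (CommRingCat.ofHom (toLaurent F (dualMonoid σ.1)))) a)
    have e2 := congr($key ((Scheme.ΓSpecIso
      (CommRingCat.of (AddMonoidAlgebra F (dualMonoid σ.1)))).inv a))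
    have e3 := congrArg ((Δ.toricVariety F).germToFunctionField (Δ.torusIncl F ''ᵁ ⊤))
      (e2.trans (congrArg ((Δ.torusIncl F).appIso ⊤).inv e1.symm))
    exact e3.symm.trans (TopCat.Presheaf.germ_res_apply _ _ _ _ _)
  · set s := (Scheme.ΓSpecIso (CommRingCat.of (AddMonoidAlgebra F (dualMonoid σ.1)))).inv a with hs
    change IsUnit ((Δ.toricVariety F).presheaf.germ (Δ.chart F σ ''ᵁ ⊤) _ hx'
      (((Δ.chart F σ).appIso ⊤).inv s)) ↔ _
    rw [← Scheme.mem_basicOpen, ← Scheme.image_basicOpen]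
    have h1 : Δ.chart F σ y ∈ Δ.chart F σ ''ᵁ (Δ.affineChart F σ).basicOpen s ↔
        y ∈ (Δ.affineChart F σ).basicOpen s := by
      constructor
      · rintro ⟨y', hy', he⟩
        rwa [← (Δ.chart F σ).isOpenEmbedding.injective he]
      · exact fun h => ⟨y, h, rfl⟩
    rw [h1, hs]
    have h2 := basicOpen_eq_of_affine (R := CommRingCat.of (AddMonoidAlgebra F (dualMonoid σ.1))) a
    exact (Set.ext_iff.1 (congrArg (fun U : Opens _ => (U : Set _)) h2) y)

/-- Laurent polynomials as germs at the points of the torus. -/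
lemma exists_germ_torus (y : torus F M) :
    ∃ θ : AddMonoidAlgebra F M →+* (torus F M).presheaf.stalk y,
      ∀ a, torusFun F a = algebraMap _ (torus F M).functionField (θ a) := by
  have hy : y ∈ (⊤ : (torus F M).Opens) := trivial
  exact ⟨((Scheme.ΓSpecIso (CommRingCat.of (AddMonoidAlgebra F M))).inv ≫
    (torus F M).presheaf.germ ⊤ y hy).hom, fun a =>
      (Scheme.algebraMap_germ_eq_germToFunctionField (torus F M) hy _).symm⟩

end RatFun

/-! ### Zero sets and local ideals -/

namespace CartierDivisor

section LocalIdeal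

variable {X : Scheme.{u}} [IsIntegral X] (D : CartierDivisor.{u, v} X)

lemma localIdeal_eq_span {s : X.functionField} {x : X} {i : D.ι} (hi : x ∈ D.U i)
    {e : X.presheaf.stalk x} (he : s * D.eqn i = algebraMap _ X.functionField e) :
    D.localIdeal s x = Ideal.span {e} := by
  ext a
  rw [D.mem_localIdeal hi, Ideal.mem_span_singleton']
  refine exists_congr fun c => ?_
  rw [he, ← map_mul, (IsFractionRing.injective (X.presheaf.stalk x) X.functionField).eq_iff]
  exact eq_comm

lemma mem_zeroSet_iff {s : X.functionField} {x : X} {i : D.ι} (hi : x ∈ D.U i)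
    {e : X.presheaf.stalk x} (he : s * D.eqn i = algebraMap _ X.functionField e) :
    x ∈ D.zeroSet s ↔ ¬ IsUnit e := by
  rw [zeroSet, Set.mem_ofPred_eq, D.localIdeal_eq_span hi he, Ne, Ideal.span_singleton_eq_top]

end LocalIdeal

/-! ### Local rings under open immersions -/

section Stalk

variable {X Y : Scheme.{u}} (j : Y ⟶ X) [IsOpenImmersion j]

/-- The isomorphism of local rings at corresponding points under an open immersion. -/
noncomputable def stalkEquiv (y : Y) : X.presheaf.stalk (j y) ≃+* Y.presheaf.stalk y :=
  (asIso (j.stalkMap y)).commRingCatIsoToRingEquiv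

variable {j}

/-- Stalk maps commute with specialization maps, and ring isomorphisms preserve nonunits. -/
lemma map_primeAt {η z : Y} (h : η ⤳ z) :
    (primeAt (h.map j.continuous)).map (stalkEquiv j z) = primeAt h := by
  rw [← Ideal.comap_symm]
  ext a
  obtain ⟨a, rfl⟩ := (stalkEquiv j z).surjective a
  rw [Ideal.mem_comap, RingEquiv.symm_apply_apply, primeAt, primeAt, Ideal.mem_comap,
    Ideal.mem_comap]
  have h1 : j.stalkMap η (X.presheaf.stalkSpecializes (h.map j.continuous) a) =
      Y.presheaf.stalkSpecializes h (j.stalkMap z a) :=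
    Scheme.Hom.stalkSpecializes_stalkMap_apply j η z h a
  have h2 : Y.presheaf.stalkSpecializes h (stalkEquiv j z a) =
      stalkEquiv j η (X.presheaf.stalkSpecializes (h.map j.continuous) a) := h1.symm
  change _ ↔ Y.presheaf.stalkSpecializes h (stalkEquiv j z a) ∈ _
  rw [h2, IsLocalRing.mem_maximalIdeal, IsLocalRing.mem_maximalIdeal, mem_nonunits_iff,
    mem_nonunits_iff, MulEquiv.isUnit_map]

end Stalk

section OpenImmersion

variable {X Y : Scheme.{u}} [IsIntegral X] [IsIntegral Y] {j : Y ⟶ X} [IsOpenImmersion j]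
  {D : CartierDivisor.{u, v} X} {D' : CartierDivisor.{u, v} Y}
  {s : X.functionField} {s' : Y.functionField}

lemma mem_zeroSet_iff_of_map_localIdeal {y : Y}
    (h : (D.localIdeal s (j y)).map (stalkEquiv j y) = D'.localIdeal s' y) :
    j y ∈ D.zeroSet s ↔ y ∈ D'.zeroSet s' := by
  simp only [zeroSet, Set.mem_ofPred_eq]
  rw [← h, Ne, Ne, ← Ideal.comap_symm, Ideal.comap_eq_top_iff]

/-- Orders of vanishing are preserved by open immersions. -/
lemma order_eq_of_map_localIdeal {η z : Y}
    (h : (D.localIdeal s (j z)).map (stalkEquiv j z) = D'.localIdeal s' z) :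
    D.order s (j η) (j z) = D'.order s' η z := by
  unfold order
  by_cases hz : η ⤳ z
  · have hz' : j η ⤳ j z := hz.map j.continuous
    rw [dif_pos hz, dif_pos hz']
    have hI : ((primeAt hz' ⊔ D.localIdeal s (j z)).map (stalkEquiv j z)) =
        primeAt hz ⊔ D'.localIdeal s' z := by
      rw [Ideal.map_sup, h, map_primeAt hz]
    -- The lengths are over different rings. Each is the coheight of an ideal in its lattice of
    -- ideals, and the isomorphism of local rings identifies the two lattices.
    rw [Module.length_quotient, Module.length_quotient, ← hI,
      ← Order.coheight_orderIso (stalkEquiv j z).idealComapOrderIso.symm]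
    rfl
  · have hz' : ¬ j η ⤳ j z := fun h' => hz (j.isOpenEmbedding.isInducing.specializes_iff.1 h')
    rw [dif_neg hz, dif_neg hz']

end OpenImmersion

end CartierDivisor

/-! ### Twists and initial forms -/

section InitialForm

variable {F : Type u} [Field F]

lemma coeff_twist {A : Type v} [AddCommMonoid A] (t : Multiplicative A →* Fˣ)
    (x : AddMonoidAlgebra F A) (m : A) :
    (twist t x).coeff m = x.coeff m * t (Multiplicative.ofAdd m) := by
  classical
  induction x using AddMonoidAlgebra.induction_linear with
  | zero => simp
  | add f g hf hg => simp [hf, hg, add_mul]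
  | single a c =>
    rw [twist_single]
    simp only [AddMonoidAlgebra.coeff_single, Finsupp.single_apply]
    split_ifs with h
    · rw [h]
    · simp

lemma coeff_baseChange {K : Type u} [Field K] [Algebra K F] {M : Type v} [AddCommGroup M]
    (f : AddMonoidAlgebra K M) (m : M) :
    (baseChange F f).coeff m = algebraMap K F (f.coeff m) :=
  AddMonoidAlgebra.coeff_mapRingHom _ _ _

lemma component_apply {K : Type u} [Field K] [Algebra K F] {M : Type v} [AddCommGroup M] {k : ℕ}
    (t : AddMonoidAlgebra K (Fin k → M) →ₐ[K] F) (i : Fin k) (m : M) :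
    (component t i (Multiplicative.ofAdd m) : F) =
      t (AddMonoidAlgebra.single (Pi.single i m) 1) := rfl

variable {M : Type v} [AddCommGroup M]

/-- The part of a Laurent polynomial with exponents in a subgroup. -/
noncomputable def restrictTo (Γ : Submodule ℤ M) : AddMonoidAlgebra F M →+ AddMonoidAlgebra F Γ :=
  AddMonoidAlgebra.comapDomainAddMonoidHom Γ.subtype Subtype.val_injective

lemma coeff_restrictTo (Γ : Submodule ℤ M) (x : AddMonoidAlgebra F M) (m : Γ) :
    (restrictTo Γ x).coeff m = x.coeff m := by
  simp [restrictTo]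

/-- The point of `Hom(Γ, 𝔾_m)^k` under a point of `Hom(M, 𝔾_m)^k` for a subgroup `Γ` of `M`. -/
noncomputable def powerIncl (K : Type u) [Field K] (k : ℕ) (Γ : Submodule ℤ M) :
    AddMonoidAlgebra K (Fin k → Γ) →ₐ[K] AddMonoidAlgebra K (Fin k → M) :=
  AddMonoidAlgebra.mapDomainAlgHom K K (AddMonoidHom.compLeft Γ.subtype.toAddMonoidHom (Fin k))

lemma powerIncl_injective (K : Type u) [Field K] (k : ℕ) (Γ : Submodule ℤ M) :
    Function.Injective (powerIncl K k Γ) :=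
  AddMonoidAlgebra.mapDomain_injective fun _ _ h => funext fun i => Subtype.ext (congrFun h i)

lemma component_powerIncl {K : Type u} [Field K] [Algebra K F] {k : ℕ} (Γ : Submodule ℤ M)
    (t : AddMonoidAlgebra K (Fin k → M) →ₐ[K] F) (i : Fin k) (m : Γ) :
    component (t.comp (powerIncl K k Γ)) i (Multiplicative.ofAdd m) =
      component t i (Multiplicative.ofAdd (m : M)) := by
  ext
  rw [component_apply, component_apply, AlgHom.comp_apply, powerIncl]
  simp only [AddMonoidAlgebra.mapDomainAlgHom_apply, AddMonoidAlgebra.mapDomain_single]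
  congr 3
  funext j
  by_cases h : j = i
  · subst h; simp
  · simp [h]

/-- Taking initial forms commutes with twisting up to a unit: the coefficient at `γ` comes from the
exponent `m + γ` of `f`, and `χ^{m+γ}(t_i) = χ^m(t_i) χ^γ(t_i)`. -/
lemma restrictTo_twist {K : Type u} [Field K] [Algebra K F] {k : ℕ} (Γ : Submodule ℤ M)
    (t : AddMonoidAlgebra K (Fin k → M) →ₐ[K] F) (i : Fin k) (m : M) (f : AddMonoidAlgebra K M) :
    restrictTo Γ (AddMonoidAlgebra.single (-m) 1 * twist (component t i) (baseChange F f)) =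
      (component t i (Multiplicative.ofAdd m) : F) • twist (component (t.comp (powerIncl K k Γ)) i)
        (baseChange F (restrictTo Γ (AddMonoidAlgebra.single (-m) 1 * f))) := by
  ext γ
  rw [coeff_restrictTo, AddMonoidAlgebra.coeff_single_mul_apply, coeff_twist, coeff_baseChange,
    AddMonoidAlgebra.coeff_smul, Finsupp.smul_apply, coeff_twist, coeff_baseChange,
    coeff_restrictTo, AddMonoidAlgebra.coeff_single_mul_apply, component_powerIncl, neg_neg,
    one_mul, one_mul, ofAdd_add, map_mul, Units.val_mul, smul_eq_mul]
  ring

/-- Modulo a prime containing the characters outside a subgroup `Γ`, elements of a semigroup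
algebra are given by their restrictions to `Γ`. -/
lemma exists_algHom_quotient (S : AddSubmonoid M) (Γ : Submodule ℤ M) (hΓ : ∀ m ∈ Γ, m ∈ S)
    (q : Ideal (AddMonoidAlgebra F S))
    (hq : ∀ m : S, (m : M) ∉ Γ → AddMonoidAlgebra.single m 1 ∈ q) :
    ∃ Ψ : AddMonoidAlgebra F Γ →ₐ[F] (AddMonoidAlgebra F S ⧸ q), Function.Surjective Ψ ∧
      ∀ a, Ψ (restrictTo Γ (toLaurent F S a)) = Ideal.Quotient.mk q a := by
  let ι : Γ →+ S := { toFun := fun m => ⟨m, hΓ m m.2⟩, map_zero' := rfl, map_add' := fun _ _ => rfl }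
  let Ψ : AddMonoidAlgebra F Γ →ₐ[F] (AddMonoidAlgebra F S ⧸ q) :=
    (Ideal.Quotient.mkₐ F q).comp (AddMonoidAlgebra.mapDomainAlgHom F F ι)
  have hΨ : ∀ a, Ψ (restrictTo Γ (toLaurent F S a)) = Ideal.Quotient.mk q a := by
    intro a
    induction a using AddMonoidAlgebra.induction_linear with
    | zero => simp
    | add f g hf hg => simp only [map_add, hf, hg]
    | single m c =>
      rw [toLaurent_single]
      by_cases hm : (m : M) ∈ Γ
      · have h1 : restrictTo Γ (AddMonoidAlgebra.single (m : M) c) =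
            AddMonoidAlgebra.single (⟨m, hm⟩ : Γ) c :=
          AddMonoidAlgebra.comapDomain_single_map Γ.subtype Subtype.val_injective ⟨m, hm⟩ c
        rw [h1]
        change Ideal.Quotient.mk q (AddMonoidAlgebra.mapDomainAlgHom F F ι _) = _
        simp only [AddMonoidAlgebra.mapDomainAlgHom_apply, AddMonoidAlgebra.mapDomain_single]
        rfl
      · have h1 : restrictTo Γ (AddMonoidAlgebra.single (m : M) c) = 0 := by
          ext γ
          rw [coeff_restrictTo, AddMonoidAlgebra.coeff_single, Finsupp.single_eq_of_ne]
          · rfl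
          · exact fun h => hm (h ▸ γ.2)
        rw [h1, map_zero, eq_comm, Ideal.Quotient.eq_zero_iff_mem]
        have h2 : (AddMonoidAlgebra.single m c : AddMonoidAlgebra F S) =
            c • AddMonoidAlgebra.single m 1 := by
          rw [AddMonoidAlgebra.smul_single, smul_eq_mul, mul_one]
        rw [h2]
        exact Submodule.smul_of_tower_mem q c (hq m hm)
  refine ⟨Ψ, fun x => ?_, hΨ⟩
  obtain ⟨a, rfl⟩ := Ideal.Quotient.mk_surjective x
  exact ⟨_, hΨ a⟩

end InitialForm

/-! ### The lattice of a face -/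

section Perp

variable {M : Type v} [AddCommGroup M]

/-- The sublattice `σ^⊥ ∩ M`. -/
def perp (σ : PointedCone ℝ (NR M)) : Submodule ℤ M where
  carrier := {m | ∀ u ∈ σ, u m = 0}
  zero_mem' := by simp
  add_mem' := by
    intro a b ha hb u hu
    rw [map_add, ha u hu, hb u hu, add_zero]
  smul_mem' := by
    intro c a ha u hu
    rw [map_smul, ha u hu, smul_zero]

lemma perp_le_dualMonoid (σ : PointedCone ℝ (NR M)) : ∀ m ∈ perp σ, m ∈ dualMonoid σ :=
  fun _ hm u hu => (hm u hu).ge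

/-- A nonzero vector of `σ` is a nonzero functional on `M` that kills `perp σ`. As `perp σ` is the
character lattice of the orbit of `σ`, every orbit of a nonzero cone has smaller dimension than the
torus. -/
lemma finrank_perp_add_one_le [Module.Free ℤ M] [Module.Finite ℤ M] {σ : PointedCone ℝ (NR M)}
    (hσ : σ ≠ ⊥) : Module.finrank ℤ (perp σ) + 1 ≤ Module.finrank ℤ M := by
  obtain ⟨u, hu, hu0⟩ := (Submodule.ne_bot_iff σ).1 hσ
  have h1 : Module.finrank ℤ (perp σ) ≤ Module.finrank ℤ (LinearMap.ker u) :=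
    Submodule.finrank_mono fun m hm => hm u hu
  have h2 := Submodule.finrank_quotient_add_finrank (LinearMap.ker u)
  rw [u.quotKerEquivRange.finrank_eq] at h2
  have h3 : 0 < Module.finrank ℤ (LinearMap.range u) := by
    have : Module.Finite ℤ (LinearMap.range u) := Module.Finite.range u
    have : Nontrivial (LinearMap.range u) := by
      rw [Submodule.nontrivial_iff_ne_bot, Ne, LinearMap.range_eq_bot]
      exact hu0
    exact Module.finrank_pos
  omega

/-- If the support function of the Newton polytope of `f` has slope `m` on a rational polyhedral
cone, then some exponent of `f` agrees with `m` on that cone. -/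
lemma exists_exponent {K : Type u} [Field K] {f : AddMonoidAlgebra K M} (hf : f ≠ 0)
    {σ : PointedCone ℝ (NR M)} (hσ : IsRationalPolyhedral σ) {m : M}
    (hm : ∀ u ∈ σ, supportFunction (newtonPolytope f) u = u m) :
    ∃ m' ∈ f.coeff.support, m' - m ∈ perp σ := by
  obtain ⟨S, rfl⟩ := hσ
  set g : (M →ₗ[ℤ] ℤ) → NR M := latticeIncl with hg
  have hgen : ∀ w ∈ S, g w ∈ PointedCone.hull ℝ (g '' (S : Set (M →ₗ[ℤ] ℤ))) :=
    fun w hw => Submodule.subset_span ⟨w, hw, rfl⟩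
  have hsum : ∑ w ∈ S, g w ∈ PointedCone.hull ℝ (g '' (S : Set (M →ₗ[ℤ] ℤ))) :=
    Submodule.sum_mem _ hgen
  -- The sum of the generators detects all of them at once: an exponent that attains the minimum
  -- there attains it at each generator.
  obtain ⟨m', hm', hmu⟩ := (isLeast_supportFunction hf (∑ w ∈ S, g w)).1
  have hle : ∀ w ∈ S, g w m ≤ g w m' := fun w hw => by
    rw [← hm _ (hgen w hw)]
    exact (isLeast_supportFunction hf (g w)).2 ⟨m', hm', rfl⟩
  have heq : ∀ w ∈ S, g w m = g w m' := by
    rw [← Finset.sum_eq_sum_iff_of_le hle]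
    have := hmu.trans (hm _ hsum)
    simpa using this.symm
  refine ⟨m', hm', fun u hu => ?_⟩
  induction hu using Submodule.span_induction with
  | mem x hx => obtain ⟨w, hw, rfl⟩ := hx; rw [map_sub, heq w hw, sub_self]
  | zero => simp
  | add x y _ _ hx hy => rw [LinearMap.add_apply, hx, hy, add_zero]
  | smul a x _ hx =>
    have h2 : (a • x) (m' - m) = (a : ℝ) * x (m' - m) := rfl
    rw [h2, hx, mul_zero]

/-- The local equation of a twist of `s_f` on a chart. -/
lemma exists_localEquation {K : Type u} [Field K] {F : Type u} [Field F] [Algebra K F]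
    {f : AddMonoidAlgebra K M} (hf : f ≠ 0) {σ : PointedCone ℝ (NR M)} {m : M}
    (hm : ∀ u ∈ σ, supportFunction (newtonPolytope f) u = u m) (t : Multiplicative M →* Fˣ) :
    ∃ a : AddMonoidAlgebra F (dualMonoid σ), toLaurent F (dualMonoid σ) a =
      AddMonoidAlgebra.single (-m) 1 * twist t (baseChange F f) := by
  refine mem_range_toLaurent F (dualMonoid σ) _ fun m' hm' u hu => ?_
  rw [Finsupp.mem_support_iff, AddMonoidAlgebra.coeff_single_mul_apply, coeff_twist,
    coeff_baseChange, neg_neg] at hm'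
  -- The exponent `m'` of the product comes from the exponent `m + m'` of `f`, whose value at `u` is
  -- at least the minimum `u m`.
  have h1 : m + m' ∈ f.coeff.support := by
    rw [Finsupp.mem_support_iff]
    intro h
    simp [h] at hm'
  have h2 := (isLeast_supportFunction hf u).2 ⟨_, h1, rfl⟩
  rw [hm u hu] at h2
  simp only [map_add] at h2
  linarith

end Perp

/-! ### Generic twists along the orbit of a cone -/

section GenericChart

variable {K : Type u} [Field K] {M : Type v} [AddCommGroup M] [Module.Free ℤ M] [Module.Finite ℤ M]

/-- For generic `t`, the twists by `t` meet each torus orbit in codimension at least their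
number. -/
theorem exists_generic_twist_cone (Kbar : Type u) [Field Kbar] [Algebra K Kbar] {k : ℕ}
    {f : Fin k → AddMonoidAlgebra K M} (hf : ∀ i, f i ≠ 0) {σ : PointedCone ℝ (NR M)}
    (hσ : IsRationalPolyhedral σ) {m : Fin k → M}
    (hm : ∀ i, ∀ u ∈ σ, supportFunction (newtonPolytope (f i)) u = u (m i)) :
    ∃ h : AddMonoidAlgebra K (Fin k → M), h ≠ 0 ∧
      ∀ t : AddMonoidAlgebra K (Fin k → M) →ₐ[K] Kbar, t h ≠ 0 →
      ∀ (I : Finset (Fin k)) (a : Fin k → AddMonoidAlgebra Kbar (dualMonoid σ)),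
        (∀ i, toLaurent Kbar (dualMonoid σ) (a i) =
          AddMonoidAlgebra.single (-m i) 1 * twist (component t i) (baseChange Kbar (f i))) →
      ∀ (q : Ideal (AddMonoidAlgebra Kbar (dualMonoid σ))) [q.IsPrime],
        (∀ m : dualMonoid σ, (m : M) ∉ perp σ → AddMonoidAlgebra.single m 1 ∈ q) →
        (∀ i ∈ I, a i ∈ q) →
        Algebra.trdeg Kbar (AddMonoidAlgebra Kbar (dualMonoid σ) ⧸ q) + I.card ≤
          Module.finrank ℤ (perp σ) := by
  -- The initial forms along the orbit are nonzero, so the theorem on tori applies to the lattice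
  -- `perp σ`; its genericity condition is pulled back by `powerIncl`.
  have hg : ∀ i, restrictTo (perp σ) (AddMonoidAlgebra.single (-m i) 1 * f i) ≠ 0 := by
    intro i h0
    obtain ⟨m', hm', hp⟩ := exists_exponent (hf i) hσ (hm i)
    have h1 := congrArg (fun x => x.coeff ⟨m' - m i, hp⟩) h0
    simp only [coeff_restrictTo, AddMonoidAlgebra.coeff_single_mul_apply, neg_neg,
      add_sub_cancel, one_mul] at h1
    exact Finsupp.mem_support_iff.1 hm' (by simpa using h1)
  obtain ⟨h, h0, H⟩ := exists_generic_twist (perp σ) Kbar _ hg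
  refine ⟨powerIncl K k (perp σ) h, ?_, ?_⟩
  · rwa [Ne, map_eq_zero_iff _ (powerIncl_injective K k (perp σ))]
  intro t ht I a ha q _ hq hI
  obtain ⟨Ψ, hΨ, hΨa⟩ := exists_algHom_quotient (dualMonoid σ) (perp σ) (perp_le_dualMonoid σ) q hq
  refine H (t.comp (powerIncl K k (perp σ))) ht I _ Ψ hΨ fun i hi => ?_
  have h1 := hΨa (a i)
  rw [ha, restrictTo_twist, map_smul, Ideal.Quotient.eq_zero_iff_mem.2 (hI i hi)] at h1
  exact (Units.isUnit _).smul_eq_zero.1 h1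

end GenericChart

/-! ### Codimension of points of toric varieties -/

/-- Comparison of the dimension formulas for `p` and `q`, whose residue rings differ by at most one
in transcendence degree. -/
lemma height_le_height_add_one {F : Type u} {A : Type v} [Field F] [CommRing A] [IsDomain A]
    [Algebra F A] [Algebra.FiniteType F A] {p q : Ideal A} [p.IsPrime] [q.IsPrime] (hpq : p ≤ q)
    (h : ∀ r : Ideal A, r.IsPrime → p < r → ¬ r < q) : q.height ≤ p.height + 1 := by
  have h1 := height_add_trdeg_quotient (F := F) p
  have h2 := height_add_trdeg_quotient (F := F) q
  have h3 := trdeg_quotient_le_of_covBy (F := F) hpq h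
  have hlt : ∀ p : Ideal A, p.IsPrime → ∃ d : ℕ, Algebra.trdeg F (A ⧸ p) = d := fun p hp =>
    Cardinal.lt_aleph0.1 ((trdeg_le_of_surjective (Ideal.Quotient.mkₐ F p)
      Ideal.Quotient.mk_surjective).trans_lt trdeg_lt_aleph0_of_finiteType)
  obtain ⟨a, ha⟩ := hlt p inferInstance
  obtain ⟨b, hb⟩ := hlt q inferInstance
  rw [ha, hb] at h3
  rw [ha, ← h2, hb, Cardinal.toENat_nat, Cardinal.toENat_nat] at h1
  have h4 : a ≤ b + 1 := by exact_mod_cast h3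
  have h5 : q.height + b ≤ p.height + 1 + b := by
    rw [← h1, add_assoc]
    gcongr
    rw [add_comm]
    exact_mod_cast h4
  exact (ENat.add_le_add_iff_right (ENat.natCast_ne_top b)).1 h5

section Charts

variable {F : Type u} [Field F] {M : Type v} [AddCommGroup M] (Δ : Fan M)

/-- The prime ideal of a point of a chart. -/
abbrev Fan.chartIdeal {σ : Δ.cones} (y : Δ.affineChart F σ) :
    Ideal (AddMonoidAlgebra F (dualMonoid σ.1)) :=
  PrimeSpectrum.asIdeal (R := AddMonoidAlgebra F (dualMonoid σ.1)) y

/-- In the specialization order the generic point is the top element, so the coheight of a point is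
the codimension of its closure. -/
lemma Fan.coheight_chart (σ : Δ.cones) (y : Δ.affineChart F σ) :
    Order.coheight (Δ.chart F σ y) = (Δ.chartIdeal y).height := by
  rw [coheight_eq_of_isOpenImmersion]
  exact (idealHeight_eq_coheight (CommRingCat.of (AddMonoidAlgebra F (dualMonoid σ.1))) y).symm

instance {σ : Δ.cones} (y : Δ.affineChart F σ) : (Δ.chartIdeal y).IsPrime :=
  PrimeSpectrum.isPrime (R := AddMonoidAlgebra F (dualMonoid σ.1)) y

/-- The face `σ ∩ m^⊥`. -/
def faceOf (σ : PointedCone ℝ (NR M)) (m : M) : PointedCone ℝ (NR M) where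
  carrier := {u | u ∈ σ ∧ u m = 0}
  zero_mem' := ⟨σ.zero_mem, rfl⟩
  add_mem' := fun {a b} ha hb => ⟨σ.add_mem ha.1 hb.1, by rw [LinearMap.add_apply, ha.2, hb.2,
    add_zero]⟩
  smul_mem' := fun c a ha => ⟨Submodule.smul_mem σ c ha.1, by
    have h : (c • a) m = (c : ℝ) * a m := rfl
    rw [h, ha.2, mul_zero]⟩

/-- Every point lies in a torus orbit of some chart. -/
lemma Fan.exists_chart_orbit (x : Δ.toricVariety F) :
    ∃ (σ : Δ.cones) (y : Δ.affineChart F σ), Δ.chart F σ y = x ∧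
      ∀ m : dualMonoid σ.1, (m : M) ∉ perp σ.1 →
        (AddMonoidAlgebra.single m 1) ∈ Δ.chartIdeal y := by
  -- A minimal cone whose chart contains `x`. If a character `m` of the chart that is not in `perp
  -- σ` did not vanish at `x`, then `x` would lie in the chart of the smaller cone `σ ∩ m^⊥`.
  obtain ⟨σ, ⟨y, rfl⟩, hmin⟩ := (Set.toFinite
    {σ : Δ.cones | ∃ y : Δ.affineChart F σ, Δ.chart F σ y = x}).exists_minimal (Δ.exists_chart F x)
  refine ⟨σ, y, rfl, fun m hm => ?_⟩
  by_contra hmem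
  have hface : IsFace (faceOf σ.1 (m : M)) σ.1 := ⟨m, m.2, fun u => Iff.rfl⟩
  let τ : Δ.cones := ⟨faceOf σ.1 (m : M), Δ.face_mem _ σ.2 _ hface⟩
  have hle : τ ≤ σ := fun u hu => hu.1
  obtain ⟨w, hw⟩ := ((Δ.charts_map_aux F (homOfLE hle) m fun u => Iff.rfl).2 y).2 hmem
  have h1 : σ ≤ τ := hmin (y := τ) ⟨w, (Δ.face_chart_apply F hle w).symm.trans
    (congrArg (Δ.chart F σ) hw)⟩ hle
  exact hm fun u hu => (h1 hu).2

lemma Fan.chart_zeroCone_mem_range (y : Δ.affineChart F Δ.zeroCone) :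
    Δ.chart F Δ.zeroCone y ∈ Set.range (Δ.torusIncl F) := by
  have : IsIso (CommRingCat.ofHom (toLaurent F (dualMonoid Δ.zeroCone.1))) :=
    (ConcreteCategory.isIso_iff_bijective _).2 (Δ.toLaurent_bot_bijective F)
  obtain ⟨z, hz⟩ := (Spec.map (CommRingCat.ofHom
    (toLaurent F (dualMonoid Δ.zeroCone.1)))).surjective y
  exact ⟨z, congrArg (Δ.chart F Δ.zeroCone) hz⟩

/-- A chart containing a point contains its generizations. -/
lemma Fan.exists_chart_of_specializes {σ : Δ.cones} {y : Δ.affineChart F σ} {η : Δ.toricVariety F}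
    (h : η ⤳ Δ.chart F σ y) : ∃ w, Δ.chart F σ w = η ∧ Δ.chartIdeal w ≤ Δ.chartIdeal y := by
  obtain ⟨w, rfl⟩ := h.mem_open (Δ.chart F σ).opensRange.isOpen ⟨y, rfl⟩
  refine ⟨w, rfl, ?_⟩
  have h1 : w ⤳ y := (Δ.chart F σ).isOpenEmbedding.isInducing.specializes_iff.1 h
  exact (PrimeSpectrum.le_iff_specializes
    (R := AddMonoidAlgebra F (dualMonoid σ.1)) w y).2 h1

lemma Fan.chart_lt_chart_iff {σ : Δ.cones} {y w : Δ.affineChart F σ} :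
    Δ.chart F σ y < Δ.chart F σ w ↔ Δ.chartIdeal w < Δ.chartIdeal y := by
  have h1 : ∀ y w : Δ.affineChart F σ, Δ.chart F σ y ≤ Δ.chart F σ w ↔
      Δ.chartIdeal w ≤ Δ.chartIdeal y := fun y w =>
    (Δ.chart F σ).isOpenEmbedding.isInducing.specializes_iff.trans (PrimeSpectrum.le_iff_specializes
      (R := AddMonoidAlgebra F (dualMonoid σ.1)) w y).symm
  rw [lt_iff_le_not_ge, lt_iff_le_not_ge, h1, h1]

end Charts

/-! ### Dimension of the affine charts -/

section Dimension

variable {F : Type u} [Field F] {M : Type v} [AddCommGroup M] [Module.Free ℤ M] [Module.Finite ℤ M]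
  (Δ : Fan M)

lemma finrank_le_trdeg_laurent (F : Type u) [Field F] (M : Type v) [AddCommGroup M]
    [Module.Free ℤ M] [Module.Finite ℤ M] :
    (Module.finrank ℤ M : Cardinal) ≤ Algebra.trdeg F (AddMonoidAlgebra F M) := by
  have h := (algebraicIndependent_single F
    (Module.finBasis ℤ M).linearIndependent).lift_cardinalMk_le_trdeg
  simpa using h

/-- The ring of an affine toric variety has transcendence degree at least the rank of the
lattice. -/
lemma Fan.finrank_le_trdeg (σ : Δ.cones) :
    (Module.finrank ℤ M : Cardinal) ≤ Algebra.trdeg F (AddMonoidAlgebra F (dualMonoid σ.1)) := by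
  have hle : Δ.zeroCone ≤ σ := (bot_le : (⊥ : PointedCone ℝ (NR M)) ≤ σ.1)
  obtain ⟨m, hm, hτ⟩ := Δ.isFace_of_le hle
  let φ : AddMonoidAlgebra F (dualMonoid σ.1) →ₐ[F] AddMonoidAlgebra F (dualMonoid Δ.zeroCone.1) :=
    AddMonoidAlgebra.mapDomainAlgHom F F (AddSubmonoid.inclusion (dualMonoid_anti hle))
  algebraize [inclHom F (dualMonoid_anti hle)]
  -- The ring of the torus is a localization of the ring of the chart, so both have the same
  -- transcendence degree.
  have hloc := isLocalization_of_face F (Δ.rational σ.1 σ.2) (dualMonoid_anti hle) ⟨m, hm⟩ hτ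
  have : IsScalarTower F (AddMonoidAlgebra F (dualMonoid σ.1))
      (AddMonoidAlgebra F (dualMonoid Δ.zeroCone.1)) :=
    IsScalarTower.of_algebraMap_eq fun x => (φ.commutes x).symm
  have : FaithfulSMul (AddMonoidAlgebra F (dualMonoid σ.1))
      (AddMonoidAlgebra F (dualMonoid Δ.zeroCone.1)) :=
    (faithfulSMul_iff_algebraMap_injective _ _).2 (inclHom_injective F (dualMonoid_anti hle))
  have : Algebra.IsAlgebraic (AddMonoidAlgebra F (dualMonoid σ.1))
      (AddMonoidAlgebra F (dualMonoid Δ.zeroCone.1)) :=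
    IsLocalization.isAlgebraic _ (Submonoid.powers (AddMonoidAlgebra.single ⟨m, hm⟩ (1 : F)))
  have h1 := trdeg_add_eq F (AddMonoidAlgebra F (dualMonoid σ.1))
    (A := AddMonoidAlgebra F (dualMonoid Δ.zeroCone.1))
  rw [trdeg_eq_zero (R := AddMonoidAlgebra F (dualMonoid σ.1)), add_zero] at h1
  rw [h1]
  refine (finrank_le_trdeg_laurent F M).trans ?_
  exact trdeg_le_of_surjective
    (AddMonoidAlgebra.mapDomainAlgHom F F (dualMonoid Δ.zeroCone.1).subtype)
    (Δ.toLaurent_bot_bijective F).2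

lemma Fan.finiteType (σ : Δ.cones) :
    Algebra.FiniteType F (AddMonoidAlgebra F (dualMonoid σ.1)) := by
  have := dualMonoid_fg (Δ.rational σ.1 σ.2)
  infer_instance

/-- Subvarieties of codimension one in a subvariety have codimension at most one more. -/
lemma Fan.coheight_le_of_covBy {z η : Δ.toricVariety F} (h : z ⋖ η) :
    Order.coheight z ≤ Order.coheight η + 1 := by
  obtain ⟨σ, y, rfl⟩ := Δ.exists_chart F z
  obtain ⟨w, rfl, hle⟩ := Δ.exists_chart_of_specializes h.1.le
  have := Δ.finiteType (F := F) σ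
  rw [Δ.coheight_chart, Δ.coheight_chart]
  refine height_le_height_add_one (F := F) hle fun r hr h1 h2 => ?_
  exact h.2 (c := Δ.chart F σ (⟨r, hr⟩ : PrimeSpectrum (AddMonoidAlgebra F (dualMonoid σ.1))))
    (Δ.chart_lt_chart_iff.2 h2) (Δ.chart_lt_chart_iff.2 h1)

end Dimension

/-! ### Proper intersection and intersection cycles -/

section Points

attribute [local instance] specializationOrder in
/-- Proper intersection in terms of the generic points of the components. -/
lemma meetProperly_of_points {X : Scheme.{u}} [IsIntegral X] {k : ℕ}
    {D : Fin k → CartierDivisor.{u, v} X} {s : Fin k → X.functionField}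
    (h : ∀ (I : Finset (Fin k)) (z : X), (∀ i ∈ I, z ∈ (D i).zeroSet (s i)) →
      (∀ w : X, w ⤳ z → (∀ i ∈ I, w ∈ (D i).zeroSet (s i)) → w = z) →
      Order.coheight z = I.card) : MeetProperly D s := by
  intro I W hW
  -- Irreducible closed subsets correspond to their generic points, and maximality of the subset
  -- means that no proper generization of its generic point is a common zero.
  obtain ⟨z, rfl⟩ := (irreducibleSetEquivPoints (α := X)).symm.surjective W
  have hclosed : IsClosed (⋂ i ∈ I, (D i).zeroSet (s i)) :=
    isClosed_biInter fun i _ => (D i).isClosed_zeroSet (s i)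
  have h1 : ∀ w : X, w ∈ ⋂ i ∈ I, (D i).zeroSet (s i) → ∀ i ∈ I, w ∈ (D i).zeroSet (s i) :=
    fun w hw => by simpa using hw
  rw [Order.coheight_orderIso]
  refine h I z (h1 z (hW.1 (subset_closure rfl))) fun w hw hwI => ?_
  have h2 : (irreducibleSetEquivPoints.symm z : IrreducibleCloseds X) ≤
      irreducibleSetEquivPoints.symm w := by
    change closure {z} ⊆ closure {w}
    exact specializes_iff_closure_subset.1 hw
  have h3 := hW.2 (y := irreducibleSetEquivPoints.symm w)
    (closure_minimal (by simpa using hwI) hclosed) h2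
  have h4 : z ⤳ w := specializes_iff_closure_subset.2 h3
  exact (hw.antisymm h4).eq

end Points

/-! ### Intersection cycles and open subschemes -/

section OpenImmersion

variable {X T : Scheme.{u}} (j : T ⟶ X) [IsOpenImmersion j]

lemma map_covBy_map_iff {z η : T} : j z ⋖ j η ↔ z ⋖ η := by
  have hle : ∀ a b : T, j a ≤ j b ↔ a ≤ b := fun a b =>
    j.isOpenEmbedding.isInducing.specializes_iff
  have hlt : ∀ a b : T, j a < j b ↔ a < b := fun a b => by
    rw [lt_iff_le_not_ge, lt_iff_le_not_ge, hle, hle]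
  refine ⟨fun h => ⟨(hlt _ _).1 h.1, fun c h1 h2 => h.2 ((hlt _ _).2 h1) ((hlt _ _).2 h2)⟩,
    fun h => ⟨(hlt _ _).2 h.1, fun c h1 h2 => ?_⟩⟩
  have h3 : c ⤳ j z := h1.le
  obtain ⟨c, rfl⟩ := h3.mem_open j.opensRange.isOpen ⟨z, rfl⟩
  exact h.2 ((hlt _ _).1 h1) ((hlt _ _).1 h2)

variable [IsIntegral X] [IsIntegral T] {k : ℕ}
  {D : Fin k → CartierDivisor.{u, v} X} {s : Fin k → X.functionField}
  {D₀ : Fin k → CartierDivisor.{u, v} T} {s₀ : Fin k → T.functionField}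

/-- Proper intersection is inherited by open subschemes. -/
lemma meetProperly_restrict
    (hloc : ∀ i z, ((D i).localIdeal (s i) (j z)).map (CartierDivisor.stalkEquiv j z) =
      (D₀ i).localIdeal (s₀ i) z)
    (h : ∀ (I : Finset (Fin k)) (z : X), (∀ i ∈ I, z ∈ (D i).zeroSet (s i)) →
      (∀ w : X, w ⤳ z → (∀ i ∈ I, w ∈ (D i).zeroSet (s i)) → w = z) →
      Order.coheight z = I.card) : MeetProperly D₀ s₀ := by
  have hz : ∀ i z, j z ∈ (D i).zeroSet (s i) ↔ z ∈ (D₀ i).zeroSet (s₀ i) := fun i z =>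
    CartierDivisor.mem_zeroSet_iff_of_map_localIdeal (hloc i z)
  refine meetProperly_of_points fun I z hzI hmax => ?_
  rw [← coheight_eq_of_isOpenImmersion j]
  refine h I _ (fun i hi => (hz i z).2 (hzI i hi)) fun w hw hwI => ?_
  obtain ⟨w, rfl⟩ := hw.mem_open j.opensRange.isOpen ⟨z, rfl⟩
  exact congrArg j (hmax w (j.isOpenEmbedding.isInducing.specializes_iff.1 hw)
    fun i hi => (hz i w).1 (hwI i hi))

variable [IsNoetherian X] [IsNoetherian T]

lemma divOn_apply {Y : Scheme.{u}} [IsIntegral Y] [IsNoetherian Y] (D : CartierDivisor.{u, v} Y)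
    (s : Y.functionField) (η z : Y) [Decidable (z ⋖ η ∧ η ∉ D.zeroSet s)] :
    divOn D s η z = if z ⋖ η ∧ η ∉ D.zeroSet s then D.order s η z else 0 := by
  rw [divOn, Finsupp.ofSupportFinite_coe]
  congr

/-- The multiplicities agree at the points of `T`; the condition `h` makes those at the other points
vanish. -/
lemma mapDomain_divOn {D : CartierDivisor.{u, v} X} {s : X.functionField}
    {D₀ : CartierDivisor.{u, v} T} {s₀ : T.functionField}
    (hloc : ∀ z, (D.localIdeal s (j z)).map (CartierDivisor.stalkEquiv j z) =
      D₀.localIdeal s₀ z) (η : T) (h : ∀ z ∉ Set.range j, z ⋖ j η → z ∉ D.zeroSet s) :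
    (divOn D₀ s₀ η).mapDomain j = divOn D s (j η) := by
  classical
  have hinj : Function.Injective j := j.isOpenEmbedding.injective
  ext z
  by_cases hz : z ∈ Set.range j
  · obtain ⟨z, rfl⟩ := hz
    rw [Finsupp.mapDomain_apply hinj, divOn_apply, divOn_apply, map_covBy_map_iff,
      CartierDivisor.mem_zeroSet_iff_of_map_localIdeal (hloc η),
      CartierDivisor.order_eq_of_map_localIdeal (hloc z)]
  · rw [Finsupp.mapDomain_of_notMem_range _ _ hz, divOn_apply]
    split_ifs with h1
    · exact (D.order_eq_zero (h z hz h1.1)).symm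
    · rfl

/-- If the common zero sets of the sections have sufficiently large codimension outside an open
subscheme, then the intersection cycle is the closure of the intersection cycle on it. -/
theorem mapDomain_intersectionCycle
    (hloc : ∀ i z, ((D i).localIdeal (s i) (j z)).map (CartierDivisor.stalkEquiv j z) =
      (D₀ i).localIdeal (s₀ i) z)
    (hcov : ∀ z η : X, z ⋖ η → Order.coheight z ≤ Order.coheight η + 1)
    (hout : ∀ (I : Finset (Fin k)) (z : X), z ∉ Set.range j →
      (∀ i ∈ I, z ∈ (D i).zeroSet (s i)) → ((I.card + 1 : ℕ) : ℕ∞) ≤ Order.coheight z) :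
    (intersectionCycle D₀ s₀).mapDomain j = intersectionCycle D s := by
  classical
  have hzero : ∀ i z, j z ∈ (D i).zeroSet (s i) ↔ z ∈ (D₀ i).zeroSet (s₀ i) := fun i z =>
    CartierDivisor.mem_zeroSet_iff_of_map_localIdeal (hloc i z)
  -- The induction also records that the components of the cycle obtained so far lie in the zero
  -- sets of all the sections used and have codimension at most the number of these sections.
  have key : ∀ L : List (Fin k), L.Nodup →
      (L.foldr (fun i α => divInter (D₀ i) (s₀ i) α) (fundamentalCycle T)).mapDomain j =
        L.foldr (fun i α => divInter (D i) (s i) α) (fundamentalCycle X) ∧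
      ∀ η ∈ (L.foldr (fun i α => divInter (D₀ i) (s₀ i) α) (fundamentalCycle T)).support,
        (∀ i ∈ L, j η ∈ (D i).zeroSet (s i)) ∧ Order.coheight (j η) ≤ L.length := by
    intro L
    induction L with
    | nil =>
      refine fun _ => ⟨?_, fun η hη => ⟨by simp, ?_⟩⟩
      · simp only [List.foldr_nil, fundamentalCycle, Finsupp.mapDomain_single]
        rw [genericPoint_eq_of_isOpenImmersion]
      · have h1 : η = genericPoint T := by
          simpa using Finsupp.support_single_subset hη
        rw [h1, genericPoint_eq_of_isOpenImmersion]
        exact (Order.coheight_top (α := X)).le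
    | cons i L ih =>
      intro hL
      obtain ⟨hi, hL⟩ := List.nodup_cons.1 hL
      obtain ⟨ih1, ih2⟩ := ih hL
      simp only [List.foldr_cons]
      rw [← ih1]
      generalize (L.foldr (fun i α => divInter (D₀ i) (s₀ i) α) (fundamentalCycle T)) = α at ih2
      have hspec : ∀ η ∈ α.support, ∀ z : X, z ⋖ j η → ∀ i ∈ L, z ∈ (D i).zeroSet (s i) :=
        fun η hη z hz i hi => by
          have h1 : j η ⤳ z := hz.1.le
          exact h1.mem_closed ((D i).isClosed_zeroSet (s i)) ((ih2 η hη).1 i hi)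
      refine ⟨?_, fun z hz => ?_⟩
      · unfold divInter
        rw [Finsupp.sum_mapDomain_index (h := fun η (a : ℤ) => a • divOn (D i) (s i) η)
          (fun _ => zero_smul _ _) (fun _ _ _ => add_smul _ _ _),
          ← Finsupp.mapDomain.addMonoidHom_apply, map_finsuppSum]
        refine Finsupp.sum_congr fun η hη => ?_
        rw [map_zsmul, Finsupp.mapDomain.addMonoidHom_apply, mapDomain_divOn j (hloc i) η]
        intro z hz hzη hzi
        -- A component `z` outside `T` would be a common zero of `L.length + 1` sections and so have
        -- codimension at least `L.length + 2`. But it has codimension one in a component of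
        -- codimension at most `L.length`.
        have h1 := hout (i :: L).toFinset z hz (by
          intro i' hi'
          rcases List.mem_cons.1 (List.mem_toFinset.1 hi') with rfl | h
          · exact hzi
          · exact hspec η hη z hzη i' h)
        rw [List.toFinset_card_of_nodup (List.nodup_cons.2 ⟨hi, hL⟩), List.length_cons] at h1
        have h2 := h1.trans ((hcov z _ hzη).trans (add_le_add_left (ih2 η hη).2 1))
        have h3 : L.length + 1 + 1 ≤ L.length + 1 := by exact_mod_cast h2
        omega
      · obtain ⟨η, hη, hzη⟩ : ∃ η ∈ α.support, divOn (D₀ i) (s₀ i) η z ≠ 0 := by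
          by_contra! hcon
          refine Finsupp.mem_support_iff.1 hz ?_
          rw [divInter, Finsupp.sum_apply]
          refine Finset.sum_eq_zero fun η hη => ?_
          change (α η • divOn (D₀ i) (s₀ i) η) z = 0
          rw [Finsupp.smul_apply, hcon η hη, smul_zero]
        rw [divOn_apply] at hzη
        obtain ⟨⟨h1, -⟩, h2⟩ : (z ⋖ η ∧ η ∉ (D₀ i).zeroSet (s₀ i)) ∧
            (D₀ i).order (s₀ i) η z ≠ 0 := by
          by_contra hcon
          refine hzη ?_
          split_ifs with h
          · by_contra h'
            exact hcon ⟨h, h'⟩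
          · rfl
        have h3 : j z ⋖ j η := (map_covBy_map_iff j).2 h1
        refine ⟨fun i' hi' => ?_, ?_⟩
        · rcases List.mem_cons.1 hi' with rfl | h
          · rw [hzero]
            by_contra h4
            exact h2 ((D₀ i').order_eq_zero h4)
          · exact hspec η hη _ h3 i' h
        · refine (hcov _ _ h3).trans ?_
          rw [List.length_cons, Nat.cast_add, Nat.cast_one]
          exact add_le_add_left (ih2 η hη).2 1
  have h := (key (List.finRange k) (List.nodup_finRange k)).1
  unfold intersectionCycle
  rw [List.ofFn_eq_map, List.ofFn_eq_map, List.foldr_map, List.foldr_map]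
  exact h

end OpenImmersion

/-! ### Twists of the sections of the Newton divisors -/

section Newton

variable {K : Type u} [Field K] {M : Type v} [AddCommGroup M]

/-- A slope of the support function of the Newton polytope on a cone. -/
noncomputable def Fan.IsCompatible.slope {f : AddMonoidAlgebra K M} (hf : f ≠ 0) {Δ : Fan M}
    (hΔ : Δ.IsCompatible (newtonPolytope f)) (σ : Δ.cones) : M :=
  (hΔ.exists_slope hf σ.1 σ.2).choose

lemma Fan.IsCompatible.slope_spec {f : AddMonoidAlgebra K M} (hf : f ≠ 0) {Δ : Fan M}
    (hΔ : Δ.IsCompatible (newtonPolytope f)) (σ : Δ.cones) :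
    ∀ u ∈ σ.1, supportFunction (newtonPolytope f) u = u (hΔ.slope hf σ) :=
  (hΔ.exists_slope hf σ.1 σ.2).choose_spec

variable {F : Type u} [Field F] [Algebra K F]
  {f : AddMonoidAlgebra K M} (hf : f ≠ 0) {Δ : Fan M} (hΔ : Δ.IsCompatible (newtonPolytope f))
  (t : Multiplicative M →* Fˣ)

/-- The local equation of `t^* s_f` on the affine chart of a cone. -/
noncomputable def Fan.IsCompatible.localEquation (σ : Δ.cones) :
    AddMonoidAlgebra F (dualMonoid σ.1) :=
  (exists_localEquation hf (hΔ.slope_spec hf σ) t).choose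

lemma Fan.IsCompatible.toLaurent_localEquation (σ : Δ.cones) :
    toLaurent F (dualMonoid σ.1) (hΔ.localEquation hf t σ) =
      AddMonoidAlgebra.single (-hΔ.slope hf σ) 1 * twist t (baseChange F f) :=
  (exists_localEquation hf (hΔ.slope_spec hf σ) t).choose_spec

variable [Module.Free ℤ M] [Module.Finite ℤ M]

/-- The slope here is the same choice as in the definition of the divisor, so the two equations
agree by definition. -/
lemma Fan.IsCompatible.twistedSection_mul_eqn (σ : Δ.cones) :
    Δ.twistedSection t (baseChange F f) * (Δ.newtonDivisor F hf hΔ).eqn σ =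
      Δ.ratFun F (toLaurent F (dualMonoid σ.1) (hΔ.localEquation hf t σ)) := by
  rw [toLaurent_localEquation, map_mul, Δ.twistedSection_eq, mul_comm]
  rfl

lemma Fan.IsCompatible.twistedSection_mem_sections :
    Δ.twistedSection t (baseChange F f) ∈ (Δ.newtonDivisor F hf hΔ).sections ⊤ := by
  intro x _ σ hσ
  obtain ⟨θ, hθ⟩ := Δ.ratFun_toLaurent F σ x hσ
  exact ⟨θ (hΔ.localEquation hf t σ), ((hΔ.twistedSection_mul_eqn hf t σ).trans (hθ _)).symm⟩

/-- The germ of the local equation is a unit exactly where the equation avoids the prime of the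
point; questions on zero sets thus become questions on prime ideals. -/
lemma Fan.IsCompatible.chart_mem_zeroSet_iff {σ : Δ.cones} {y : Δ.affineChart F σ} :
    Δ.chart F σ y ∈ (Δ.newtonDivisor F hf hΔ).zeroSet (Δ.twistedSection t (baseChange F f)) ↔
      hΔ.localEquation hf t σ ∈ Δ.chartIdeal y := by
  obtain ⟨θ, hθ, hθ'⟩ := Δ.exists_germ (F := F) σ y
  have hy : Δ.chart F σ y ∈ (Δ.newtonDivisor F hf hΔ).U σ := ⟨y, rfl⟩
  rw [CartierDivisor.mem_zeroSet_iff _ hy ((hΔ.twistedSection_mul_eqn hf t σ).trans (hθ _)), hθ',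
    not_not]

/-- On the torus the local ideals of `t^* s_f` are those of `t^* f`. -/
lemma Fan.IsCompatible.map_localIdeal (z : torus F M) :
    ((Δ.newtonDivisor F hf hΔ).localIdeal (Δ.twistedSection t (baseChange F f))
      (Δ.torusIncl F z)).map (CartierDivisor.stalkEquiv (Δ.torusIncl F) z) =
    (CartierDivisor.trivial.{max u v, v} (torus F M)).localIdeal
      (torusFun F (twist t (baseChange F f))) z := by
  have hz : Δ.torusIncl F z ∈ (Δ.chart F Δ.zeroCone).opensRange := ⟨_, rfl⟩
  obtain ⟨θ, hθ⟩ := Δ.ratFun_toLaurent F Δ.zeroCone _ hz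
  obtain ⟨θ₀, hθ₀⟩ := exists_germ_torus (F := F) z
  have hz' : Δ.torusIncl F z ∈ (Δ.newtonDivisor F hf hΔ).U Δ.zeroCone := hz
  rw [CartierDivisor.localIdeal_eq_span _ hz'
      ((hΔ.twistedSection_mul_eqn hf t Δ.zeroCone).trans (hθ _)),
    CartierDivisor.localIdeal_eq_span (CartierDivisor.trivial (torus F M)) (i := PUnit.unit)
      (x := z) trivial ((mul_one _).trans (hθ₀ _)), Ideal.map_span, Set.image_singleton]
  -- On the torus the two local equations differ by a character, which is invertible there.
  have h1 : CartierDivisor.stalkEquiv (Δ.torusIncl F) z (θ (hΔ.localEquation hf t Δ.zeroCone)) =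
      θ₀ (AddMonoidAlgebra.single (-hΔ.slope hf Δ.zeroCone) 1) *
        θ₀ (twist t (baseChange F f)) := by
    apply IsFractionRing.injective ((torus F M).presheaf.stalk z) (torus F M).functionField
    refine (algebraMap_stalkMap (Δ.torusIncl F) z _).trans ?_
    rw [← hθ, Δ.pullbackRat_torusIncl_ratFun, hΔ.toLaurent_localEquation, ← map_mul, hθ₀]
  have h2 : IsUnit (θ₀ (AddMonoidAlgebra.single (-hΔ.slope hf Δ.zeroCone) 1)) := by
    refine IsUnit.map θ₀ (IsUnit.of_mul_eq_one
      (AddMonoidAlgebra.single (hΔ.slope hf Δ.zeroCone) 1) ?_)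
    rw [AddMonoidAlgebra.single_mul_single, neg_add_cancel, mul_one, AddMonoidAlgebra.one_def]
  rw [h1]
  exact Ideal.span_singleton_mul_left_unit h2 _

/-- Krull's height theorem for the common zero set of the twists. -/
lemma Fan.coheight_le_card {k : ℕ} {f : Fin k → AddMonoidAlgebra K M} (hf : ∀ i, f i ≠ 0)
    (hΔ : ∀ i, Δ.IsCompatible (newtonPolytope (f i))) (t : Fin k → Multiplicative M →* Fˣ)
    (I : Finset (Fin k)) {z : Δ.toricVariety F}
    (hz : ∀ i ∈ I, z ∈ (Δ.newtonDivisor F (hf i) (hΔ i)).zeroSet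
      (Δ.twistedSection (t i) (baseChange F (f i))))
    (hmax : ∀ w, w ⤳ z → (∀ i ∈ I, w ∈ (Δ.newtonDivisor F (hf i) (hΔ i)).zeroSet
      (Δ.twistedSection (t i) (baseChange F (f i)))) → w = z) : Order.coheight z ≤ I.card := by
  classical
  obtain ⟨σ, y, rfl⟩ := Δ.exists_chart F z
  have := Δ.finiteType (F := F) σ
  have : IsNoetherianRing (AddMonoidAlgebra F (dualMonoid σ.1)) :=
    Algebra.FiniteType.isNoetherianRing F _
  rw [Δ.coheight_chart]
  let a : Fin k → AddMonoidAlgebra F (dualMonoid σ.1) := fun i =>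
    (hΔ i).localEquation (hf i) (t i) σ
  -- Since no proper generization of the point is a common zero, its prime is minimal over the local
  -- equations.
  have hmin : Δ.chartIdeal y ∈
      (Ideal.span ((I.image a : Finset _) :
        Set (AddMonoidAlgebra F (dualMonoid σ.1)))).minimalPrimes := by
    refine ⟨⟨inferInstance, ?_⟩, fun r ⟨hr, hIr⟩ hry => ?_⟩
    · rw [Ideal.span_le]
      intro x hx
      obtain ⟨i, hi, rfl⟩ := Finset.mem_image.1 (Finset.mem_coe.1 hx)
      exact ((hΔ i).chart_mem_zeroSet_iff (hf i) (t i)).1 (hz i hi)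
    · let w : Δ.affineChart F σ := (⟨r, hr⟩ : PrimeSpectrum (AddMonoidAlgebra F (dualMonoid σ.1)))
      have h1 : w ⤳ y := (PrimeSpectrum.le_iff_specializes
        (R := AddMonoidAlgebra F (dualMonoid σ.1)) w y).1 hry
      have h2 := hmax _ (h1.map (Δ.chart F σ).continuous) fun i hi =>
        ((hΔ i).chart_mem_zeroSet_iff (hf i) (t i)).2 (hIr (Ideal.subset_span
          (Finset.mem_coe.2 (Finset.mem_image_of_mem a hi))))
      have h3 : w = y := (Δ.chart F σ).isOpenEmbedding.injective h2
      rw [← h3]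
  refine (Ideal.height_le_card_of_mem_minimalPrimes_span_finset hmin).trans ?_
  exact_mod_cast Finset.card_image_le

/-- For generic `t`, the common zero set of the twists indexed by `I` has codimension at least
`#I`, and larger than `#I` in the boundary of the torus. -/
theorem Fan.exists_generic_twist (Kbar : Type u) [Field Kbar] [Algebra K Kbar] (Δ : Fan M) {k : ℕ}
    {f : Fin k → AddMonoidAlgebra K M} (hf : ∀ i, f i ≠ 0)
    (hΔ : ∀ i, Δ.IsCompatible (newtonPolytope (f i))) :
    ∃ h : AddMonoidAlgebra K (Fin k → M), h ≠ 0 ∧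
      ∀ t : AddMonoidAlgebra K (Fin k → M) →ₐ[K] Kbar, t h ≠ 0 →
      ∀ (I : Finset (Fin k)) (z : Δ.toricVariety Kbar),
        (∀ i ∈ I, z ∈ (Δ.newtonDivisor Kbar (hf i) (hΔ i)).zeroSet
          (Δ.twistedSection (component t i) (baseChange Kbar (f i)))) →
        (I.card : ℕ∞) ≤ Order.coheight z ∧
        (z ∉ Set.range (Δ.torusIncl Kbar) → ((I.card + 1 : ℕ) : ℕ∞) ≤ Order.coheight z) := by
  classical
  have hdom : IsDomain (AddMonoidAlgebra K (Fin k → M)) := isDomain_laurent K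
  choose h h0 H using fun σ : Δ.cones => exists_generic_twist_cone Kbar hf (Δ.rational σ.1 σ.2)
    (fun i => (hΔ i).slope_spec (hf i) σ)
  refine ⟨∏ σ, h σ, Finset.prod_ne_zero_iff.2 fun σ _ => h0 σ, fun t ht I z hz => ?_⟩
  obtain ⟨σ, y, rfl, hy⟩ := Δ.exists_chart_orbit z
  have := Δ.finiteType (F := Kbar) σ
  have hσ : t (h σ) ≠ 0 := fun h1 => ht (by
    rw [map_prod]
    exact Finset.prod_eq_zero (Finset.mem_univ σ) h1)
  have h1 := H σ t hσ I (fun i => (hΔ i).localEquation (hf i) (component t i) σ)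
    (fun i => (hΔ i).toLaurent_localEquation (hf i) (component t i) σ) (Δ.chartIdeal y) hy
    (fun i hi => ((hΔ i).chart_mem_zeroSet_iff (hf i) (component t i)).1 (hz i hi))
  have h2 := height_add_trdeg_quotient (F := Kbar) (Δ.chartIdeal y)
  have h3 : (Module.finrank ℤ M : ℕ∞) ≤
      Cardinal.toENat (Algebra.trdeg Kbar (AddMonoidAlgebra Kbar (dualMonoid σ.1))) := by
    have := Cardinal.toENat.monotone' (Δ.finrank_le_trdeg (F := Kbar) σ)
    simpa using this
  obtain ⟨d, hd⟩ := Cardinal.lt_aleph0.1 ((trdeg_le_of_surjective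
    (Ideal.Quotient.mkₐ Kbar (Δ.chartIdeal y)) Ideal.Quotient.mk_surjective).trans_lt
      trdeg_lt_aleph0_of_finiteType)
  rw [hd] at h1
  rw [← h2, hd, Cardinal.toENat_nat, ← Δ.coheight_chart] at h3
  have h4 : d + I.card ≤ Module.finrank ℤ (perp σ.1) := by exact_mod_cast h1
  -- Here `c` is a lower bound for the codimension of the orbit. The dimension `d` of the closure of
  -- the point is at most the dimension of the orbit minus `#I`, and its codimension is at least the
  -- rank of `M` minus `d`. The value `0` serves any cone, the value `1` any nonzero cone.
  have key : ∀ c : ℕ, Module.finrank ℤ (perp σ.1) + c ≤ Module.finrank ℤ M →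
      ((I.card + c : ℕ) : ℕ∞) ≤ Order.coheight (Δ.chart Kbar σ y) := by
    intro c hc
    have h5 : ((I.card + c + d : ℕ) : ℕ∞) ≤ Order.coheight (Δ.chart Kbar σ y) + d := by
      refine le_trans ?_ h3
      exact_mod_cast (by omega : I.card + c + d ≤ Module.finrank ℤ M)
    rw [Nat.cast_add _ d] at h5
    exact (ENat.add_le_add_iff_right (ENat.natCast_ne_top d)).1 h5
  refine ⟨key 0 (Submodule.finrank_le _), fun hz => key 1 (finrank_perp_add_one_le fun hbot => ?_)⟩
  obtain rfl : σ = Δ.zeroCone := Subtype.ext hbot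
  exact hz (Δ.chart_zeroCone_mem_range y)

end Newton

end ToricCycles


theorem theorem1 {K : Type u} [Field K] {Kbar : Type u} [Field Kbar] [Algebra K Kbar]
    [IsAlgClosure K Kbar]
    {M : Type v} [AddCommGroup M] [Module.Free ℤ M] [Module.Finite ℤ M]
    (k : ℕ) (hk : k ≤ Module.finrank ℤ M)
    (f : Fin k → AddMonoidAlgebra K M) (hf : ∀ i, f i ≠ 0)
    (Δ : Fan M) (hΔ : Δ.IsComplete) (hcomp : ∀ i, Δ.IsCompatible (newtonPolytope (f i))) :
    ∃ H : Set (torus K (Fin k → M)), IsClosed H ∧ H ≠ Set.univ ∧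
      ∀ t : AddMonoidAlgebra K (Fin k → M) →ₐ[K] Kbar, underlyingPoint t ∉ H →
        let D : Fin k → CartierDivisor.{max u v, v} (Δ.toricVariety Kbar) :=
          fun i => Δ.newtonDivisor Kbar (hf i) (hcomp i)
        let s : Fin k → (Δ.toricVariety Kbar).functionField :=
          fun i => Δ.twistedSection (component t i) (baseChange Kbar (f i))
        let D₀ : Fin k → CartierDivisor.{max u v, v} (torus Kbar M) :=
          fun _ => CartierDivisor.trivial (torus Kbar M)
        let s₀ : Fin k → (torus Kbar M).functionField :=
          fun i => torusFun Kbar (twist (component t i) (baseChange Kbar (f i)))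
        (∀ i, s i ∈ (D i).sections ⊤) ∧
        MeetProperly D s ∧ MeetProperly D₀ s₀ ∧
        (intersectionCycle D₀ s₀).mapDomain (Δ.torusIncl Kbar) = intersectionCycle D s := by
  have hdom : IsDomain (AddMonoidAlgebra K (Fin k → M)) := isDomain_laurent K
  obtain ⟨h, h0, H⟩ := Δ.exists_generic_twist Kbar hf hcomp
  -- The zero locus of `h ≠ 0` misses the generic point, hence is proper.
  refine ⟨PrimeSpectrum.zeroLocus {h}, PrimeSpectrum.isClosed_zeroLocus _, fun huniv => ?_, ?_⟩
  · have h1 : (⟨⊥, Ideal.isPrime_bot⟩ : PrimeSpectrum (AddMonoidAlgebra K (Fin k → M))) ∈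
        PrimeSpectrum.zeroLocus {h} := by
      rw [huniv]
      trivial
    exact h0 (by simpa using h1)
  intro t ht D s D₀ s₀
  have hth : t h ≠ 0 := fun h1 => ht (Set.singleton_subset_iff.2 h1)
  have hloc : ∀ i z, ((D i).localIdeal (s i) (Δ.torusIncl Kbar z)).map
      (CartierDivisor.stalkEquiv (Δ.torusIncl Kbar) z) = (D₀ i).localIdeal (s₀ i) z :=
    fun i z => (hcomp i).map_localIdeal (hf i) (component t i) z
  -- The upper bound is Krull's height theorem, the lower bound comes from the genericity of `t`.
  have hcard : ∀ (I : Finset (Fin k)) (z : Δ.toricVariety Kbar),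
      (∀ i ∈ I, z ∈ (D i).zeroSet (s i)) →
      (∀ w, w ⤳ z → (∀ i ∈ I, w ∈ (D i).zeroSet (s i)) → w = z) →
      Order.coheight z = I.card := fun I z hz hmax =>
    le_antisymm (Fan.coheight_le_card hf hcomp (fun i => component t i) I hz hmax)
      (H t hth I z hz).1
  exact ⟨fun i => (hcomp i).twistedSection_mem_sections (hf i) (component t i),
    meetProperly_of_points hcard, meetProperly_restrict (Δ.torusIncl Kbar) hloc hcard,
    mapDomain_intersectionCycle (Δ.torusIncl Kbar) hloc (fun z η => Δ.coheight_le_of_covBy)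
      fun I z hz hzI => (H t hth I z hzI).2 hz⟩
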